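/- Let $k$ be an algebraically closed field of characteristic $p>0$ and let $X\to\mathbb{P}^1$ be a Harbater–Katz–Gabber cover over $k$ whose Galois group $G$ is a finite $p$-group: $X$ is a smooth projective curve with function field $F$, $F^{G}$ is a rational function field, and $X\to X/G=\mathbb{P}^1$ is totally ramified at one point $P$ and unramified everywhere else. Let $g$ be the genus of $X$. Let $G_j$ be the lower ramification groups at $P$, let $b_1<\dots<b_r$ be their jumps (the $j$ with $G_{j+1}\ne G_j$), and put $F_i=F^{G_{b_i}}$, $F_{i+1}=F^{G_{b_i+1}}$ (so $F_1=F^{G}$, $F_{r+1}=F$), $p^{n_i}=[F_{i+1}:F_i]$ and $m_i=|G_{b_i+1}|\,b_i$ for $1\le i\le r$. Choose generators as follows: $F_1=k(f_0)$, where $f_0$ has its pole at $P$; and $F_{i+1}=F_i(f_i)$, where $f_i$ has pole divisor $m_iP$ on $X$ and $$f_i^{p^{n_i}}+a^{(i)}_{n_i-1}f_i^{p^{n_i-1}}+\dots+a^{(i)}_0f_i=D_i\quad\text{with } a^{(i)}_j\in k,\ D_i\in F_i .$$ For $\lambda=(\lambda_0,\dots,\lambda_r)\in\mathbb{N}^{r+1}$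 put $\|\lambda\|=\lambda_0|G|+\sum_{\nu=1}^r\lambda_\nu m_\nu$ and $\omega_\lambda=f_0^{\lambda_0}\cdots f_r^{\lambda_r}\,df_0$, and let $\mathbf{A}=\{\lambda:\|\lambda\|\le 2g-2\}$, $\mathbf{A}+\mathbf{A}=\{L+K: L,K\in\mathbf{A}\}$. Assume that every field $F_{i+1}$, $1\le i\le r$, has genus at least $3$, is not hyperelliptic, and is not trigonal (has no map of degree $3$ to $\mathbb{P}^1$). Then for every $1\le i\le r$: 1. $D_i$ has pole divisor $p^{n_i}m_iP$, and $p^{n_i}m_i\le 4g-4$. 2. $D_i\,df_0^{\otimes 2}$ is a holomorphic $2$-differential on $X$. 3. $D_i$ can be written in exactly one way as a finite sum $$D_i=\sum_{\lambda} a^{(i)}_{\lambda}\, f_0^{\lambda_0}\cdots f_{i-1}^{\lambda_{i-1}},\qquad a^{(i)}_\lambda\in k,\quad \lambda=(\lambda_0,\dots,\lambda_{i-1},0,\dots,0),\quad \lambda_\nu<p^{n_\nu}\text{ for }1\le\nu\le i-1.$$ 4. For every $L\in\mathbf{A}$ the differential $\omega_L$ is holomorphic. If moreover $X$ is not isomorphic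 to a smooth plane quintic, then every $\lambda$ with $a^{(i)}_\lambda\neq0$ satisfies $\|\lambda\|\le p^{n_i}m_i$ and lies in $\mathbf{A}+\mathbf{A}$, and $$D_i\,df_0^{\otimes 2}=\sum_{\lambda} a^{(i)}_\lambda\,\omega_\lambda^{\otimes 2},$$ where $\omega_\lambda^{\otimes2}=\omega_L\otimes\omega_K$ for any $L,K\in\mathbf{A}$ with $L+K=\lambda$. -/

import Mathlib

open scoped TensorProduct Pointwise

noncomputable section

namespace HKG

universe u v

/-! ### Places, holomorphic (poly)differentials and the genus of a function field -/

/-- A place of the field `F` over the constant field `k`: a non-trivial valuation ring of `F`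
containing `k`. For a function field of one variable over an algebraically closed field these are
the closed points of the smooth projective curve with function field `F`. -/
structure Place (k : Type u) (F : Type v) [Field k] [Field F] [Algebra k F] where
  ring : ValuationSubring F
  algebraMap_mem : ∀ c : k, algebraMap k F c ∈ ring
  ne_top : ring ≠ ⊤

section Differentials

variable (k : Type u) {F : Type v} [Field k] [Field F] [Algebra k F]

variable {k} in
/-- The order of vanishing of `f` at `P` is the integer `m`: `f = u * t ^ m` with `t` a
uniformizer and `u` a unit of the valuation ring. (A pole of order `m` is `HasOrd P f (-m)`.) -/
def HasOrd (P : Place k F) (f : F) (m : ℤ) : Prop :=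
  ∃ t : P.ring, IsLocalRing.maximalIdeal P.ring = Ideal.span {t} ∧
    ∃ w : (P.ring)ˣ, f = ((w : P.ring) : F) * (t : F) ^ m

/-- Differentials that are regular at `P`: those of the form `∑ g_s • d a_s` with `g_s, a_s`
regular at `P`. -/
def regularAt (P : Place k F) : Submodule k (Ω[F⁄k]) :=
  Submodule.span k {w | ∃ g ∈ P.ring, ∃ a ∈ P.ring, w = g • KaehlerDifferential.D k F a}

/-- `2`-differentials that are regular at `P`: those of the form `∑ g_s • (d a_s ⊗ d b_s)` with
`g_s, a_s, b_s` regular at `P`. -/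
def regularAt₂ (P : Place k F) : Submodule k (Ω[F⁄k] ⊗[F] Ω[F⁄k]) :=
  Submodule.span k {w | ∃ g ∈ P.ring, ∃ a ∈ P.ring, ∃ b ∈ P.ring,
    w = g • (KaehlerDifferential.D k F a ⊗ₜ[F] KaehlerDifferential.D k F b)}

variable (F)

/-- The space `H⁰(X, Ω)` of holomorphic differentials. -/
def holomorphic : Submodule k (Ω[F⁄k]) := ⨅ P : Place k F, regularAt k P

/-- The space `H⁰(X, Ω^{⊗ 2})` of holomorphic `2`-differentials. -/
def holomorphic₂ : Submodule k (Ω[F⁄k] ⊗[F] Ω[F⁄k]) := ⨅ P : Place k F, regularAt₂ k P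

/-- The genus: the dimension of the space of holomorphic differentials. -/
def genus : ℕ := Module.finrank k (holomorphic k F)

/-- The curve with function field `F` has a morphism of degree `m` to the projective line. -/
def HasMapOfDegree (m : ℕ) : Prop :=
  ∃ x : F, Transcendental k x ∧ Module.finrank (IntermediateField.adjoin k {x}) F = m

/-- Hyperelliptic: genus at least `2` and a map of degree `2` to the projective line. -/
def IsHyperelliptic : Prop := 2 ≤ genus k F ∧ HasMapOfDegree k F 2

/-- Trigonal: there is a map of degree `3` to the projective line. -/
def IsTrigonal : Prop := HasMapOfDegree k F 3

/-- `F` is the function field of a smooth plane curve of degree `5`: it is generated by two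
elements `x, y` with `Q(x, y, 1) = 0`, where `Q` is a form of degree `5` in three variables whose
projective zero set has no singular point. -/
def IsPlaneQuintic : Prop :=
  ∃ (Q : MvPolynomial (Fin 3) k) (x y : F),
    Q.IsHomogeneous 5 ∧
    (∀ z : Fin 3 → k, z ≠ 0 → MvPolynomial.eval z Q = 0 →
      ∃ s, MvPolynomial.eval z (MvPolynomial.pderiv s Q) ≠ 0) ∧
    IntermediateField.adjoin k {x, y} = ⊤ ∧
    MvPolynomial.aeval ![x, y, 1] Q = 0

end Differentials

/-! ### Ramification groups and Harbater–Katz–Gabber covers -/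

section Covers

variable {k : Type u} {F : Type v} [Field k] [Field F] [Algebra k F]

/-- The lower ramification group `G_j(P)`: the elements of `G` that stabilize the valuation ring
`O` of `P` and act trivially on `O / 𝔪 ^ (j + 1)`. -/
def ramGroup (G : Subgroup (F ≃ₐ[k] F)) (P : Place k F) (j : ℕ) : Subgroup (F ≃ₐ[k] F) :=
  G ⊓ ((((IsLocalRing.maximalIdeal P.ring) ^ (j + 1)).toAddSubgroup.inertia
    (P.ring.decompositionSubgroup k)).map (P.ring.decompositionSubgroup k).subtype)

/-- A Harbater–Katz–Gabber cover `X → X / G = ℙ¹` with Galois group a finite `p`-group `G`,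
totally ramified at `P` and unramified at all other points of `X`. -/
structure IsHKGCover (p : ℕ) (G : Subgroup (F ≃ₐ[k] F)) (P : Place k F) : Prop where
  finite : Finite G
  isPGroup : IsPGroup p G
  rational : ∃ x : F, Transcendental k x ∧
    IntermediateField.fixedField G = IntermediateField.adjoin k {x}
  totally_ramified : ramGroup G P 0 = G
  unramified : ∀ Q : Place k F, Q ≠ P → ramGroup G Q 0 = ⊥

/-- The sequence of Artin–Schreier type extensions attached to an HKG-cover, with a choice of
generators. The steps `1, …, r` are indexed by `i : Fin r` (so the `i`-th step in `Fin r` is the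
step number `i + 1`), the generators `f_0, …, f_r` by `Fin (r + 1)`; thus `f i.succ` is the
generator that is adjoined in the step `i`. -/
structure Tower (p : ℕ) (G : Subgroup (F ≃ₐ[k] F)) (P : Place k F) where
  /-- the number of jumps of the ramification filtration at `P` -/
  r : ℕ
  /-- the jumps, in increasing order -/
  b : Fin r → ℕ
  b_strictMono : StrictMono b
  b_jump : ∀ j : ℕ, (∃ i, b i = j) ↔ ramGroup G P (j + 1) ≠ ramGroup G P j
  /-- the successive quotients of the filtration have order `p ^ n i` -/
  n : Fin r → ℕ
  card_eq : ∀ i, Nat.card (ramGroup G P (b i)) = p ^ n i * Nat.card (ramGroup G P (b i + 1))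
  /-- the generators -/
  f : Fin (r + 1) → F
  /-- the coefficients of the additive polynomials -/
  a : (i : Fin r) → Fin (n i) → k
  /-- `f 0` generates the rational function field `F ^ G` and has its pole at `P` -/
  f_zero : IntermediateField.fixedField G = IntermediateField.adjoin k {f 0}
  f_zero_pole : f 0 ∉ P.ring
  /-- `F_{i+1} = F_i (f_i)` -/
  f_gen : ∀ i : Fin r, IntermediateField.fixedField (ramGroup G P (b i + 1)) =
    IntermediateField.fixedField (ramGroup G P (b i)) ⊔ IntermediateField.adjoin k {f i.succ}
  /-- `f_i` has the pole divisor `m_i P`, where `m_i = |G_{b_i + 1}| b_i`;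
  the group `G_{b_i + 1}` is the ramification group of the next jump (trivial in the last step) -/
  f_pole : ∀ i : Fin r,
    HasOrd P (f i.succ) (-((Nat.card (ramGroup G P (b i + 1)) * b i : ℕ) : ℤ))
  f_regular : ∀ (i : Fin r) (Q : Place k F), Q ≠ P → f i.succ ∈ Q.ring
  /-- `f_i ^ (p ^ n_i) + ∑ a_j f_i ^ (p ^ j)` lies in `F_i` (it is the element `D_i`) -/
  D_mem : ∀ i : Fin r, f i.succ ^ p ^ n i +
    ∑ j : Fin (n i), algebraMap k F (a i j) * f i.succ ^ p ^ (j : ℕ) ∈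
      IntermediateField.fixedField (ramGroup G P (b i))

namespace Tower

variable {p : ℕ} {G : Subgroup (F ≃ₐ[k] F)} {P : Place k F} (T : Tower p G P)

/-- The field `F_{i+1}` at the top of the step `i`, i.e. `F_i (f_i)`. -/
def upper (i : Fin T.r) : IntermediateField k F :=
  IntermediateField.fixedField (ramGroup G P (T.b i + 1))

/-- The element `D_i`: the polynomial of `f_i` over `F_i` is
`X ^ (p ^ n_i) + ∑ a_j X ^ (p ^ j) - D_i`. -/
def D (i : Fin T.r) : F := T.f i.succ ^ p ^ T.n i +
  ∑ j : Fin (T.n i), algebraMap k F (T.a i j) * T.f i.succ ^ p ^ (j : ℕ)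

/-- The pole number `m_i` of `f_i` at `P`. -/
def m (i : Fin T.r) : ℕ := Nat.card (ramGroup G P (T.b i + 1)) * T.b i

/-- The weight `‖(i_0, …, i_r)‖ = i_0 |G| + ∑ i_ν m_ν`. -/
def weight (e : Fin (T.r + 1) →₀ ℕ) : ℕ := e 0 * Nat.card G + ∑ i : Fin T.r, e i.succ * T.m i

/-- The set `A` of exponents of weight at most `2 g - 2`. -/
def A : Set (Fin (T.r + 1) →₀ ℕ) := {e | (T.weight e : ℤ) ≤ 2 * (genus k F : ℤ) - 2}

/-- The differential `ω_L = f_0 ^ {i_0} ⋯ f_r ^ {i_r} d f_0` for `L = (i_0, …, i_r)`. -/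
def ω (L : Fin (T.r + 1) →₀ ℕ) : Ω[F⁄k] :=
  (∏ j, T.f j ^ L j) • KaehlerDifferential.D k F (T.f 0)

/-- `c` expresses `D_i` as a polynomial in `f_0, …, f_{i - 1}`, reduced in the sense that the
exponent of `f_ν` is less than `p ^ n_ν` for `1 ≤ ν`. -/
def IsExpression (i : Fin T.r) (c : MvPolynomial (Fin (T.r + 1)) k) : Prop :=
  (∀ e ∈ c.support, (∀ j, i.castSucc < j → e j = 0) ∧ ∀ j : Fin T.r, e j.succ < p ^ T.n j) ∧
    MvPolynomial.aeval T.f c = T.D i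

end Tower

end Covers

end HKG

end

/-! Everything is read off from pole orders at the one place P. Let R be the ring of functions
regular outside P. The conjugates of f_i differ from f_i by constants, because an additive
polynomial with coefficients in k kills the differences. Lagrange interpolation over these
conjugates therefore has constant denominators, and by induction every element of R in F_i is a
k-linear combination of reduced monomials in f_0, …, f_{i-1} (`exists_reduced`). The jumps are prime
to p (`not_dvd_of_artinSchreier`), so |G|, m_1, …, m_r generate a telescopic numerical semigroup and
distinct reduced monomials have distinct pole orders (`weight_inj`). Nothing cancels in a reduced
expression: it is unique, and every weight occurring in it is at most the pole order of the
function. Applied to D_i, which lies in R and in F_i and has pole order p^{n_i} m_i, this gives the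
expansion and the weight bound.

Outside P the cover is unramified, so df_0 generates the regular differentials there. At P the order
of df_0 is the different minus 2|G|, which the ramification groups turn into d = `canDeg`, the sum
of (p^{n_l} - 1) m_l over all steps, minus |G| + 1. A holomorphic differential is thus h df_0 with h
in R of pole order at most d, and the genus counts the semigroup elements up to d. A telescopic
semigroup is symmetric, hence 2g - 2 = d (`two_mul_genus`); this count does the work of
Riemann–Hurwitz and Riemann–Roch. In particular `A` consists of the exponents of weight at most d,
and the pole bound for D_i becomes p^{n_i} m_i ≤ 2d.

Let q_0 and b_0 be the degree and the jump of the lowest step. Its equation E(f_1) = A(f_0), with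
deg E = q_0 and deg A = b_0, gives maps to the line of degree at most q_0 and at most b_0, so the
gonality hypotheses force q_0, b_0 ≥ 4 (`four_le_q_and_jump`). The rest is arithmetic:
`pole_le_two_mul` gives the bound 2d, and `mem_A_add_A` splits the monomials of D_i. Above the
lowest step there is room for a greedy splitting. In the lowest step the monomial is f_0^n with n ≤
b_0 and is cut in half; this fails only for a single step with q_0 = 4 and b_0 = 5, and then the
equation homogenizes to a smooth plane quintic. -/

noncomputable section

namespace HKG

open Polynomial

/-! ### Valuation rings of function fields of one variable -/

section Places

variable {k F : Type*} [Field k] [Field F] [Algebra k F]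

/-- `F` is algebraic over every subfield generated over `k` by one transcendental element. -/
def TrdegLeOne (k F : Type*) [Field k] [Field F] [Algebra k F] : Prop :=
  ∀ y : F, Transcendental k y → Algebra.IsAlgebraic (IntermediateField.adjoin k {y}) F

theorem mem_of_monic_root (O : ValuationSubring F) {p : F[X]} (hp : p.Monic)
    (hc : ∀ n, p.coeff n ∈ O) {z : F} (hz : p.eval z = 0) : z ∈ O := by
  let q : O.toSubring[X] := p.toSubring O.toSubring (by
    intro a ha
    obtain ⟨n, -, rfl⟩ := Polynomial.mem_coeffs_iff.1 (Finset.mem_coe.1 ha)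
    exact hc n)
  have hq : q.Monic := (Polynomial.monic_toSubring _ _ _).2 hp
  have : IsIntegral O z := by
    refine ⟨q, hq, ?_⟩
    rw [← Polynomial.eval_map]
    have : q.map (algebraMap O F) = p := by
      ext n
      rw [Polynomial.coeff_map]
      exact Polynomial.coeff_toSubring p O.toSubring _
    rw [this, hz]
  obtain ⟨y, hy⟩ := (IsIntegrallyClosed.isIntegral_iff (R := O) (K := F)).1 this
  rw [← hy]
  exact y.2

theorem eval_map_mem {O : Subring F} (hk : ∀ c : k, algebraMap k F c ∈ O) {y : F} (hy : y ∈ O)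
    (p : k[X]) : aeval y p ∈ O := by
  rw [aeval_eq_sum_range]
  refine sum_mem fun i _ => ?_
  rw [Algebra.smul_def]
  exact mul_mem (hk _) (pow_mem hy _)

theorem mem_adjoin_singleton {y z : F} (hz : z ∈ IntermediateField.adjoin k {y}) :
    ∃ A B : k[X], aeval y B ≠ 0 ∧ z = aeval y A / aeval y B := by
  rw [IntermediateField.mem_adjoin_simple_iff] at hz
  obtain ⟨A, B, h⟩ := hz
  by_cases hB : aeval y B = 0
  · exact ⟨0, 1, by simp, by simp [h, hB]⟩
  · exact ⟨A, B, hB, h⟩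

theorem valuation_le_one {O : ValuationSubring F} {y : F} : O.valuation y ≤ 1 ↔ y ∈ O :=
  O.valuation_le_one_iff y

theorem mem_of_valuation_lt_one {O : ValuationSubring F} {y : F} (h : O.valuation y < 1) : y ∈ O :=
  valuation_le_one.1 h.le

theorem valuation_algebraMap {O : ValuationSubring F} (hk : ∀ c : k, algebraMap k F c ∈ O) {c : k}
    (hc : c ≠ 0) : O.valuation (algebraMap k F c) = 1 := by
  refine le_antisymm (valuation_le_one.2 (hk c)) ?_
  have h := valuation_le_one.2 (hk c⁻¹)
  rwa [map_inv₀, map_inv₀, inv_le_one₀] at h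
  exact zero_lt_iff.2 ((_root_.map_ne_zero _).2 ((_root_.map_ne_zero _).2 hc))

variable [IsAlgClosed k]

theorem algebraic_mem_range {y : F} (hy : ¬ Transcendental k y) : ∃ c : k, algebraMap k F c = y := by
  have h : IsAlgebraic k y := by simpa [Transcendental] using hy
  exact minpoly.mem_range_of_degree_eq_one k y
    (IsAlgClosed.degree_eq_one_of_irreducible k (minpoly.irreducible h.isIntegral))

/-- If no translate of `y` by a constant is in the maximal ideal, all nonzero polynomials in `y`
are units. -/
theorem valuation_aeval_eq_one {O : ValuationSubring F} (hk : ∀ c : k, algebraMap k F c ∈ O) {y : F}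
    (h : ∀ c : k, O.valuation (y - algebraMap k F c) = 1) {p : k[X]} (hp : p ≠ 0) :
    O.valuation (aeval y p) = 1 := by
  have hs := IsAlgClosed.splits p
  rw [hs.eq_prod_roots, map_mul, map_mul, aeval_C,
    valuation_algebraMap hk (leadingCoeff_ne_zero.2 hp), one_mul, map_multiset_prod,
    map_multiset_prod]
  refine Multiset.prod_eq_one ?_
  intro x hx
  simp only [Multiset.map_map, Multiset.mem_map, Function.comp] at hx
  obtain ⟨c, -, rfl⟩ := hx
  simpa using h c

/-- The residue field is k. If no y - c were in the maximal ideal, all nonzero polynomials in y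
would be units, so k(y) would lie in O; as F is algebraic over k(y) and O is integrally closed, O
would be all of F. -/
theorem exists_residue (htr : TrdegLeOne k F) {O : ValuationSubring F}
    (hk : ∀ c : k, algebraMap k F c ∈ O) (hO : O ≠ ⊤) {y : F} (hy : y ∈ O) :
    ∃ c : k, O.valuation (y - algebraMap k F c) < 1 := by
  by_cases hyt : Transcendental k y
  · by_contra! hcon
    have h1 : ∀ c : k, O.valuation (y - algebraMap k F c) = 1 := fun c =>
      le_antisymm (valuation_le_one.2 (sub_mem hy (hk c))) (hcon c)
    have hle : ∀ z ∈ IntermediateField.adjoin k {y}, z ∈ O := by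
      intro z hz
      obtain ⟨A, B, hB, rfl⟩ := mem_adjoin_singleton hz
      have hB0 : B ≠ 0 := fun h => hB (by simp [h])
      rw [← valuation_le_one, map_div₀, valuation_aeval_eq_one hk h1 hB0, div_one, valuation_le_one]
      exact eval_map_mem (O := O.toSubring) hk hy A
    apply hO
    rw [eq_top_iff]
    intro z _
    have := htr y hyt
    have hz := (Algebra.IsAlgebraic.isAlgebraic (R := IntermediateField.adjoin k {y}) z).isIntegral
    refine mem_of_monic_root O (p := (minpoly (IntermediateField.adjoin k {y}) z).map
      (algebraMap _ F)) ((minpoly.monic hz).map _) ?_ ?_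
    · intro n
      rw [coeff_map]
      exact hle _ (SetLike.coe_mem _)
    · rw [eval_map_algebraMap]
      exact minpoly.aeval _ _
  · obtain ⟨c, rfl⟩ := algebraic_mem_range hyt
    exact ⟨c, by simp⟩

theorem valuation_lt_one_iff_inv {O : ValuationSubring F} {y : F} (hy : y ≠ 0) :
    O.valuation y < 1 ↔ y⁻¹ ∉ O := by
  rw [← valuation_le_one, map_inv₀, not_le, one_lt_inv₀]
  exact zero_lt_iff.2 ((_root_.map_ne_zero _).2 hy)

/-- Subtracting its residue moves an element of the larger ring into that ring's maximal ideal. Its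
inverse is then outside both rings, so the element itself lies in the smaller one. -/
theorem eq_of_le_of_ne_top (htr : TrdegLeOne k F) {O O' : ValuationSubring F}
    (hk : ∀ c : k, algebraMap k F c ∈ O) (hle : O ≤ O') (hO' : O' ≠ ⊤) : O = O' := by
  refine le_antisymm hle fun z hz => ?_
  obtain ⟨c, hc⟩ := exists_residue htr (fun c => hle (hk c)) hO' hz
  have : z - algebraMap k F c ∈ O := by
    by_cases h0 : z - algebraMap k F c = 0
    · rw [h0]; exact zero_mem _
    · rw [valuation_lt_one_iff_inv h0] at hc
      exact (O.mem_or_inv_mem _).resolve_right fun h => hc (hle h)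
  simpa using add_mem this (hk c)

/-- The elements whose poles are cleared by a power of y form an overring of O containing y⁻¹. It is
strictly larger than O, hence equal to F by maximality: the valuation is archimedean. -/
theorem exists_pow_mul_mem (htr : TrdegLeOne k F) {O : ValuationSubring F}
    (hk : ∀ c : k, algebraMap k F c ∈ O) {y : F} (hy : O.valuation y < 1)
    (hy0 : y ≠ 0) (z : F) : ∃ n : ℕ, y ^ n * z ∈ O := by
  have hyO := mem_of_valuation_lt_one hy
  have mono : ∀ {w : F} {n m : ℕ}, n ≤ m → y ^ n * w ∈ O → y ^ m * w ∈ O := by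
    intro w n m hnm h
    obtain ⟨d, rfl⟩ := Nat.exists_eq_add_of_le hnm
    rw [pow_add, mul_comm (y ^ n), mul_assoc]
    exact mul_mem (pow_mem hyO _) h
  let S : Subring F :=
    { carrier := {w | ∃ n : ℕ, y ^ n * w ∈ O}
      mul_mem' := by
        rintro a b ⟨n, hn⟩ ⟨m, hm⟩
        refine ⟨n + m, ?_⟩
        have := mul_mem hn hm
        rwa [show y ^ n * a * (y ^ m * b) = y ^ (n + m) * (a * b) by ring] at this
      one_mem' := ⟨0, by simp⟩
      add_mem' := by
        rintro a b ⟨n, hn⟩ ⟨m, hm⟩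
        refine ⟨max n m, ?_⟩
        rw [mul_add]
        exact add_mem (mono (le_max_left _ _) hn) (mono (le_max_right _ _) hm)
      zero_mem' := ⟨0, by simp⟩
      neg_mem' := by
        rintro a ⟨n, hn⟩
        exact ⟨n, by rw [mul_neg]; exact neg_mem hn⟩ }
  let O' : ValuationSubring F := ValuationSubring.ofSubring S (fun x => by
    rcases O.mem_or_inv_mem x with h | h
    · exact Or.inl ⟨0, by simpa using h⟩
    · exact Or.inr ⟨0, by simpa using h⟩)
  have hle : O ≤ O' := fun x hx => ⟨0, by simpa using hx⟩
  by_cases htop : O' = ⊤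
  · have : z ∈ O' := by rw [htop]; trivial
    exact this
  · have heq := eq_of_le_of_ne_top htr hk hle htop
    exfalso
    have : y⁻¹ ∈ O' := ⟨1, by simp [hy0]⟩
    rw [← heq] at this
    exact (valuation_lt_one_iff_inv hy0).1 hy this

/-- The element `t` generates the value group of `O`. -/
def IsUnif (O : ValuationSubring F) (t : F) : Prop :=
  t ≠ 0 ∧ O.valuation t < 1 ∧ ∀ z : F, z ≠ 0 → ∃ n : ℤ, O.valuation z = O.valuation t ^ n

theorem isUnif_of_span (htr : TrdegLeOne k F) {O : ValuationSubring F}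
    (hk : ∀ c : k, algebraMap k F c ∈ O) (hO : O ≠ ⊤) {t : O}
    (ht : IsLocalRing.maximalIdeal O = Ideal.span {t}) : IsUnif O (t : F) := by
  have hdiv : ∀ z : F, O.valuation z < 1 → ∃ w ∈ O, z = t * w := by
    intro z hz
    have : (⟨z, mem_of_valuation_lt_one hz⟩ : O) ∈ IsLocalRing.maximalIdeal O :=
      (ValuationSubring.valuation_lt_one_iff O _).2 hz
    rw [ht, Ideal.mem_span_singleton] at this
    obtain ⟨w, hw⟩ := this
    exact ⟨w, w.2, congrArg Subtype.val hw⟩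
  have ht1 : O.valuation (t : F) < 1 := by
    rw [← ValuationSubring.valuation_lt_one_iff, ht]
    exact Ideal.mem_span_singleton_self t
  have ht0 : (t : F) ≠ 0 := by
    intro h0
    apply hO
    rw [eq_top_iff]
    intro z _
    rcases O.mem_or_inv_mem z with h | h
    · exact h
    · by_cases hz : z = 0
      · rw [hz]; exact zero_mem _
      · by_contra hcon
        have : O.valuation z⁻¹ < 1 := by
          rw [valuation_lt_one_iff_inv (inv_ne_zero hz), inv_inv]; exact hcon
        obtain ⟨w, -, hw⟩ := hdiv _ this
        rw [h0, zero_mul] at hw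
        exact inv_ne_zero hz hw
  refine ⟨ht0, ht1, ?_⟩
  have hv0 : O.valuation (t : F) ≠ 0 := (_root_.map_ne_zero _).2 ht0
  have key : ∀ z : F, z ≠ 0 → z ∈ O → ∃ n : ℤ, O.valuation z = O.valuation (t : F) ^ n := by
    intro z hz hzO
    obtain ⟨n, hn⟩ := exists_pow_mul_mem htr hk ht1 ht0 z⁻¹
    -- The exponent n bounds how often z can be divided by t; each division lowers it by one.
    induction n generalizing z with
    | zero =>
      refine ⟨0, ?_⟩
      rw [zpow_zero]
      refine le_antisymm (valuation_le_one.2 hzO) ?_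
      rw [pow_zero, one_mul, ← valuation_le_one, map_inv₀, inv_le_one₀] at hn
      · exact hn
      · exact zero_lt_iff.2 ((_root_.map_ne_zero _).2 hz)
    | succ n ih =>
      by_cases h1 : O.valuation z < 1
      · obtain ⟨w, hw, rfl⟩ := hdiv z h1
        have hw0 : w ≠ 0 := fun h => hz (by simp [h])
        obtain ⟨m, hm⟩ := ih w hw0 hw (by
          rw [pow_succ, mul_inv] at hn
          convert hn using 1
          field_simp)
        refine ⟨m + 1, ?_⟩
        rw [map_mul, hm, zpow_add_one₀ hv0, mul_comm]
      · exact ⟨0, by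
          rw [zpow_zero]; exact le_antisymm (valuation_le_one.2 hzO) (not_lt.1 h1)⟩
  intro z hz
  rcases O.mem_or_inv_mem z with h | h
  · exact key z hz h
  · obtain ⟨n, hn⟩ := key _ (inv_ne_zero hz) h
    exact ⟨-n, by rw [zpow_neg, ← hn, map_inv₀, inv_inv]⟩

end Places

end HKG

/-! ### Differentials of a separable extension of a rational function field -/

namespace HKG

open Polynomial

section Rational

variable {k F : Type*} [Field k] [Field F] [Algebra k F]

theorem trdegLeOne_of_adjoin {x : F} (hx : Algebra.IsAlgebraic (IntermediateField.adjoin k {x}) F) :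
    TrdegLeOne k F := by
  intro y hy
  have h1 : Algebra.IsAlgebraic (Algebra.adjoin k {x}) F := by
    open scoped IntermediateField.algebraAdjoinAdjoin in
    exact (IsFractionRing.comap_isAlgebraic_iff (A := Algebra.adjoin k {x})
      (K := IntermediateField.adjoin k {x}) (C := F)).2 hx
  have h2 : Algebra.trdeg k F ≤ 1 := by
    simpa using Algebra.IsAlgebraic.trdeg_le_cardinalMk k {x}
  have h3 : AlgebraicIndependent k (fun _ : Unit => y) :=
    algebraicIndependent_unique_type_iff.2 hy
  have h4 := h3.isTranscendenceBasis_of_lift_trdeg_le_of_finite (by simpa using h2)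
  have := h4.isAlgebraic_field
  rwa [Set.range_const] at this

/-- The map k[X] → k(x) is a localization and k(x) → F is separable algebraic; both are formally
étale, and so is the composite. -/
theorem formallyEtale_polynomial {x : F} (hx : Transcendental k x)
    [Algebra.IsSeparable (IntermediateField.adjoin k {x}) F] :
    letI := (aeval x : k[X] →ₐ[k] F).toAlgebra
    Algebra.FormallyEtale k[X] F := by
  let : Algebra k[X] F := (aeval x : k[X] →ₐ[k] F).toAlgebra
  let : Algebra k[X] (IntermediateField.adjoin k {x}) :=
    (aeval (IntermediateField.AdjoinSimple.gen k x) :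
      k[X] →ₐ[k] IntermediateField.adjoin k {x}).toAlgebra
  have hgen : ∀ p : k[X], ((aeval (IntermediateField.AdjoinSimple.gen k x) p :
      IntermediateField.adjoin k {x}) : F) = aeval x p := by
    intro p
    rw [← IntermediateField.coe_val, ← Polynomial.aeval_algHom_apply]
    simp
  have : IsScalarTower k[X] (IntermediateField.adjoin k {x}) F := IsScalarTower.of_algebraMap_eq
    (fun p => (hgen p).symm)
  have hinj : Function.Injective (aeval x : k[X] → F) :=
    transcendental_iff_injective.1 hx
  have : FaithfulSMul k[X] (IntermediateField.adjoin k {x}) := by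
    rw [faithfulSMul_iff_algebraMap_injective]
    intro p q hpq
    apply hinj
    rw [← hgen, ← hgen]
    exact congrArg _ hpq
  have : IsFractionRing k[X] (IntermediateField.adjoin k {x}) := by
    refine IsFractionRing.of_field _ _ ?_
    rintro ⟨z, hz⟩
    obtain ⟨A, B, hB, rfl⟩ := mem_adjoin_singleton hz
    refine ⟨A, B, Subtype.ext ?_⟩
    change _ = ((aeval (IntermediateField.AdjoinSimple.gen k x) A :
      IntermediateField.adjoin k {x}) : F) / ((aeval (IntermediateField.AdjoinSimple.gen k x) B :
      IntermediateField.adjoin k {x}) : F)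
    rw [hgen, hgen]
  have : Algebra.FormallyEtale k[X] (IntermediateField.adjoin k {x}) :=
    Algebra.FormallyEtale.of_isLocalization (nonZeroDivisors k[X])
  have : Algebra.FormallyEtale (IntermediateField.adjoin k {x}) F :=
    Algebra.FormallyEtale.of_isSeparable _ _
  exact Algebra.FormallyEtale.comp k[X] (IntermediateField.adjoin k {x}) F

/-- Étaleness identifies the differentials of F with the base change of those of k[X], where dX is a
basis. It makes the coefficient of df_0 in a differential unique. -/
theorem D_ne_zero {x : F} (hx : Transcendental k x)
    [Algebra.IsSeparable (IntermediateField.adjoin k {x}) F] :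
    KaehlerDifferential.D k F x ≠ 0 := by
  let : Algebra k[X] F := (aeval x : k[X] →ₐ[k] F).toAlgebra
  have : IsScalarTower k k[X] F := IsScalarTower.of_algebraMap_eq
    (fun c => by
      change _ = aeval x (algebraMap k k[X] c)
      simp)
  have := formallyEtale_polynomial hx
  intro h
  have h1 := KaehlerDifferential.tensorKaehlerEquivOfFormallyEtale_symm_D_algebraMap k k[X] F X
  have h2 : algebraMap k[X] F X = x := by
    change aeval x X = x
    simp
  rw [h2, h, map_zero] at h1
  have h3 := congrArg (LinearMap.liftBaseChange F ((Algebra.linearMap k[X] F) ∘ₗ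
    (KaehlerDifferential.polynomialEquiv k).toLinearMap)) h1
  simp at h3

/-- An element of `k(π)` is a power of `π` times a unit. -/
theorem exists_zpow_mul {π : F} (h0 : π ≠ 0) {z : F} (hz : z ∈ IntermediateField.adjoin k {π})
    (hz0 : z ≠ 0) : ∃ (n : ℤ) (A B : k[X]), A.eval 0 ≠ 0 ∧ B.eval 0 ≠ 0 ∧
      z = π ^ n * (aeval π A / aeval π B) := by
  obtain ⟨A, B, hB, rfl⟩ := mem_adjoin_singleton hz
  have hA0 : A ≠ 0 := fun h => hz0 (by simp [h])
  have hB0 : B ≠ 0 := fun h => hB (by simp [h])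
  obtain ⟨A', hA, hA'⟩ := Polynomial.exists_eq_pow_rootMultiplicity_mul_and_not_dvd A hA0 0
  obtain ⟨B', hB', hB''⟩ := Polynomial.exists_eq_pow_rootMultiplicity_mul_and_not_dvd B hB0 0
  refine ⟨A.rootMultiplicity 0 - B.rootMultiplicity 0, A', B', fun h => hA' (dvd_iff_isRoot.2 h),
    fun h => hB'' (dvd_iff_isRoot.2 h), ?_⟩
  conv_lhs => rw [hA, hB']
  simp only [map_mul, map_pow, aeval_X, map_zero, sub_zero]
  rw [zpow_sub₀ h0, zpow_natCast, zpow_natCast, mul_div_mul_comm]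

section Local

variable {O : ValuationSubring F} (hk : ∀ c : k, algebraMap k F c ∈ O) {π : F}
  (hπ : O.valuation π < 1)

include hk hπ

theorem valuation_aeval_of_eval_zero {p : k[X]} (hp : p.eval 0 ≠ 0) :
    O.valuation (aeval π p) = 1 := by
  have h := Polynomial.divX_mul_X_add p
  rw [← h, map_add, map_mul, aeval_X, aeval_C]
  have h0 : p.coeff 0 ≠ 0 := by rwa [coeff_zero_eq_eval_zero]
  rw [Valuation.map_add_eq_of_lt_right, valuation_algebraMap hk h0]
  rw [valuation_algebraMap hk h0, map_mul]
  refine (mul_le_of_le_one_left' ?_).trans_lt hπ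
  exact valuation_le_one.2 (eval_map_mem (O := O.toSubring) hk (mem_of_valuation_lt_one hπ) _)

theorem exists_valuation_zpow (h0 : π ≠ 0) {z : F} (hz : z ∈ IntermediateField.adjoin k {π})
    (hz0 : z ≠ 0) : ∃ n : ℤ, O.valuation z = O.valuation π ^ n := by
  obtain ⟨n, A, B, hA, hB, rfl⟩ := exists_zpow_mul h0 hz hz0
  refine ⟨n, ?_⟩
  rw [map_mul, map_div₀, valuation_aeval_of_eval_zero hk hπ hA,
    valuation_aeval_of_eval_zero hk hπ hB, map_zpow₀]
  simp

/-- The elements of `k(π)` that are regular at a place where `π` vanishes. -/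
theorem exists_div_of_mem (h0 : π ≠ 0) {z : F} (hz : z ∈ IntermediateField.adjoin k {π})
    (hzO : z ∈ O) : ∃ (A B : k[X]), B.eval 0 ≠ 0 ∧ z = aeval π A / aeval π B := by
  by_cases hz0 : z = 0
  · exact ⟨0, 1, by simp, by simp [hz0]⟩
  obtain ⟨n, A, B, hA, hB, rfl⟩ := exists_zpow_mul h0 hz hz0
  have hn : 0 ≤ n := by
    rw [← valuation_le_one, map_mul, map_div₀, valuation_aeval_of_eval_zero hk hπ hA,
      valuation_aeval_of_eval_zero hk hπ hB, map_zpow₀, div_one, mul_one] at hzO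
    by_contra hn
    have := one_lt_zpow_of_neg₀ (zero_lt_iff.2 ((_root_.map_ne_zero _).2 h0)) hπ (not_le.1 hn)
    exact absurd hzO (not_le.2 this)
  lift n to ℕ using hn
  refine ⟨X ^ n * A, B, hB, ?_⟩
  simp [mul_div_assoc]

/-- A regular z in k(π) is a quotient of polynomials in π whose denominator is a unit, so the
quotient rule introduces no pole. -/
theorem exists_D_eq_smul (h0 : π ≠ 0) {z : F} (hz : z ∈ IntermediateField.adjoin k {π})
    (hzO : z ∈ O) : ∃ z' ∈ O,
      KaehlerDifferential.D k F z = z' • KaehlerDifferential.D k F π := by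
  obtain ⟨A, B, hB, rfl⟩ := exists_div_of_mem hk hπ h0 hz hzO
  have hπO := mem_of_valuation_lt_one hπ
  have hp : ∀ p : k[X], aeval π p ∈ O := fun p => eval_map_mem (O := O.toSubring) hk hπO p
  have hB1 : (aeval π B)⁻¹ ∈ O := by
    rw [← valuation_le_one, map_inv₀, valuation_aeval_of_eval_zero hk hπ hB, inv_one]
  refine ⟨(aeval π B)⁻¹ ^ 2 * (aeval π B * aeval π A.derivative - aeval π A * aeval π B.derivative),
    mul_mem (pow_mem hB1 2) (sub_mem (mul_mem (hp _) (hp _)) (mul_mem (hp _) (hp _))), ?_⟩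
  rw [Derivation.leibniz_div, Derivation.map_aeval, Derivation.map_aeval, smul_smul, smul_smul,
    ← sub_smul, smul_smul]

end Local

/-- A place at which `x` is regular or has a pole has a generator of `k(x)` in its maximal ideal. -/
theorem exists_generator_mem [IsAlgClosed k] (htr : TrdegLeOne k F) {O : ValuationSubring F}
    (hk : ∀ c : k, algebraMap k F c ∈ O) (hO : O ≠ ⊤) {x : F} (hx : x ∈ O) :
    ∃ c : k, O.valuation (x - algebraMap k F c) < 1 ∧
      IntermediateField.adjoin k {x - algebraMap k F c} = IntermediateField.adjoin k {x} := by
  obtain ⟨c, hc⟩ := exists_residue htr hk hO hx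
  refine ⟨c, hc, le_antisymm ?_ ?_⟩
  · rw [IntermediateField.adjoin_simple_le_iff]
    exact sub_mem (IntermediateField.mem_adjoin_simple_self k x) (algebraMap_mem _ c)
  · rw [IntermediateField.adjoin_simple_le_iff]
    have := add_mem (IntermediateField.mem_adjoin_simple_self k (x - algebraMap k F c))
      (algebraMap_mem (IntermediateField.adjoin k {x - algebraMap k F c}) c)
    simpa using this

theorem adjoin_inv (x : F) :
    IntermediateField.adjoin k {x⁻¹} = IntermediateField.adjoin k {x} := by
  refine le_antisymm ?_ ?_ <;> rw [IntermediateField.adjoin_simple_le_iff]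
  · exact inv_mem (IntermediateField.mem_adjoin_simple_self k x)
  · simpa using inv_mem (IntermediateField.mem_adjoin_simple_self k x⁻¹)

end Rational

end HKG

/-! ### Regular differentials at unramified places -/

namespace HKG

open Polynomial

section Unramified

variable {k F : Type*} [Field k] [Field F] [Algebra k F]

/-- It will be applied to the characteristic polynomial at its root y: the left side vanishes, and
dy is expressed through the differentials of the coefficients, which come from the fixed field. -/
theorem D_eval (p : F[X]) (y : F) :
    KaehlerDifferential.D k F (p.eval y) =
      ∑ i ∈ Finset.range (p.natDegree + 1), y ^ i • KaehlerDifferential.D k F (p.coeff i) +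
        p.derivative.eval y • KaehlerDifferential.D k F y := by
  rw [eval_eq_sum_range, map_sum, derivative_eval, Polynomial.sum_over_range _ (by simp),
    Finset.sum_smul, ← Finset.sum_add_distrib]
  refine Finset.sum_congr rfl fun i _ => ?_
  rw [Derivation.leibniz, Derivation.leibniz_pow, add_comm]
  congr 1
  rw [← Nat.cast_smul_eq_nsmul F, smul_smul, smul_smul, mul_assoc]

/-- The characteristic polynomial `∏ (X - σ y)` of `y` with respect to a finite group. -/
abbrev groupPoly (H : Subgroup (F ≃ₐ[k] F)) [Fintype H] (y : F) : F[X] :=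
  ∏ σ : H, (X - C ((σ : F ≃ₐ[k] F) y))

variable (H : Subgroup (F ≃ₐ[k] F)) [Fintype H]

theorem groupPoly_monic (y : F) : (groupPoly H y).Monic :=
  monic_prod_of_monic _ _ fun _ _ => monic_X_sub_C _

theorem groupPoly_eval_self (y : F) : (groupPoly H y).eval y = 0 := by
  rw [eval_prod]
  exact Finset.prod_eq_zero (Finset.mem_univ 1) (by simp)

theorem groupPoly_coeff_mem_fixedField (y : F) (n : ℕ) :
    (groupPoly H y).coeff n ∈ IntermediateField.fixedField H := by
  rw [IntermediateField.mem_fixedField_iff]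
  intro τ hτ
  have : (groupPoly H y).map (τ : F →+* F) = groupPoly H y := by
    rw [groupPoly, Polynomial.map_prod]
    refine Fintype.prod_equiv (Equiv.mulLeft (⟨τ, hτ⟩ : H)) _ _ fun σ => ?_
    simp
  conv_rhs => rw [← this]
  rw [coeff_map]
  rfl

theorem coeff_mem_of_monic_factors {S : Subring F} {ι : Type*} (s : Finset ι) (f : ι → F)
    (hf : ∀ i ∈ s, f i ∈ S) (n : ℕ) : (∏ i ∈ s, (X - C (f i))).coeff n ∈ S := by
  classical
  induction s using Finset.induction_on generalizing n with
  | empty =>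
    rw [Finset.prod_empty, coeff_one]
    split_ifs
    · exact one_mem _
    · exact zero_mem _
  | insert i s hi ih =>
    rw [Finset.prod_insert hi, sub_mul, coeff_sub, coeff_C_mul]
    refine sub_mem ?_ (mul_mem (hf i (Finset.mem_insert_self _ _))
      (ih (fun j hj => hf j (Finset.mem_insert_of_mem hj)) _))
    cases n with
    | zero => rw [coeff_X_mul_zero]; exact zero_mem _
    | succ n =>
      rw [coeff_X_mul]
      exact ih (fun j hj => hf j (Finset.mem_insert_of_mem hj)) _

theorem groupPoly_coeff_mem {S : Subring F} {y : F} (hy : ∀ σ ∈ H, σ y ∈ S) (n : ℕ) :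
    (groupPoly H y).coeff n ∈ S :=
  coeff_mem_of_monic_factors Finset.univ (fun σ : H => (σ : F ≃ₐ[k] F) y)
    (fun σ _ => hy σ.1 σ.2) n

theorem groupPoly_derivative_eval [DecidableEq H] (y : F) :
    (groupPoly H y).derivative.eval y =
      ∏ σ ∈ Finset.univ.erase (1 : H), (y - (σ : F ≃ₐ[k] F) y) := by
  rw [groupPoly, ← Finset.mul_prod_erase _ _ (Finset.mem_univ 1), derivative_mul, eval_add,
    eval_mul, eval_mul]
  simp [eval_prod]

/-- If the characteristic polynomial of `y` is separable at a place, then `d y` is regular there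
relative to the differentials coming from the fixed field. -/
theorem exists_D_eq_smul_of_groupPoly {O : ValuationSubring F} {ω : Ω[F⁄k]}
    (hA : ∀ c ∈ IntermediateField.fixedField H, c ∈ O →
      ∃ c' ∈ O, KaehlerDifferential.D k F c = c' • ω)
    {y : F} (hy : ∀ σ ∈ H, σ y ∈ O)
    (hφ : O.valuation ((groupPoly H y).derivative.eval y) = 1) :
    ∃ y' ∈ O, KaehlerDifferential.D k F y = y' • ω := by
  have hyO : y ∈ O := hy 1 (one_mem _)
  choose! c' hc'O hc' using hA
  -- Differentiate φ(y) = 0 and solve for dy; this is harmless at the place because φ'(y) is a unit.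
  have h := D_eval (k := k) (groupPoly H y) y
  rw [groupPoly_eval_self, map_zero] at h
  set e := (groupPoly H y).derivative.eval y with he
  have he0 : e ≠ 0 := by
    intro h0
    rw [h0, map_zero] at hφ
    exact zero_ne_one hφ
  have h1 : ∀ i, y ^ i • KaehlerDifferential.D k F ((groupPoly H y).coeff i) =
      (y ^ i * c' ((groupPoly H y).coeff i)) • ω := by
    intro i
    rw [hc' _ (groupPoly_coeff_mem_fixedField H y i)
      (groupPoly_coeff_mem (S := O.toSubring) H hy i), smul_smul]
  simp only [h1, ← Finset.sum_smul] at h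
  refine ⟨-(e⁻¹ * ∑ i ∈ Finset.range ((groupPoly H y).natDegree + 1),
    y ^ i * c' ((groupPoly H y).coeff i)), ?_, ?_⟩
  · refine neg_mem (mul_mem ?_ (sum_mem fun i _ => mul_mem (pow_mem hyO _) (hc'O _
      (groupPoly_coeff_mem_fixedField H y i) (groupPoly_coeff_mem (S := O.toSubring) H hy i))))
    rw [← valuation_le_one, map_inv₀, hφ, inv_one]
  · rw [neg_smul, mul_smul, eq_neg_of_add_eq_zero_left h.symm, smul_neg, neg_neg, smul_smul,
      inv_mul_cancel₀ he0, one_smul]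

/-- An inclusion σO ⊆ O is already an equality, since σ⁻¹ is a power of σ. -/
theorem exists_mem_not_mem_of_smul_ne {O : ValuationSubring F}
    {σ : F ≃ₐ[k] F} (hσ : σ ∈ H) (hO : σ • O ≠ O) : ∃ y ∈ O, σ y ∉ O := by
  by_contra! hcon
  apply hO
  have hpow : ∀ (n : ℕ) (y : F), y ∈ O → (σ ^ n) y ∈ O := by
    intro n
    induction n with
    | zero => intro y hy; simpa using hy
    | succ n ih =>
      intro y hy
      rw [pow_succ']
      exact hcon _ (ih y hy)
  ext y
  rw [ValuationSubring.mem_pointwise_smul_iff_inv_smul_mem]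
  constructor
  · intro h
    have := hcon _ h
    rwa [← AlgEquiv.smul_def, smul_inv_smul] at this
  · intro h
    have h1 : σ ^ Nat.card H = 1 := by
      have := pow_card_eq_one' (x := (⟨σ, hσ⟩ : H))
      exact congrArg Subtype.val this
    have h2 : σ⁻¹ = σ ^ (Nat.card H - 1) := by
      refine (eq_inv_of_mul_eq_one_left ?_).symm
      rw [← pow_succ, Nat.sub_add_cancel Nat.card_pos, h1]
    rw [h2]
    exact hpow _ y h

/-- A weak approximation. For each σ ≠ 1 take y regular with σy a pole; then (y - c)⁻¹ is a unit,
its σ-conjugate vanishes, and all conjugates are regular once c avoids the residues of the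
conjugates of y. The product over all σ ≠ 1 serves every σ at once. -/
theorem exists_separating [Infinite k] {O : ValuationSubring F}
    (hk : ∀ c : k, algebraMap k F c ∈ O) (hinc : ∀ σ ∈ H, σ ≠ 1 → ∃ y ∈ O, σ y ∉ O) :
    ∃ w : F, O.valuation w = 1 ∧ ∀ σ ∈ H, σ w ∈ O ∧ (σ ≠ 1 → O.valuation (σ w) < 1) := by
  classical
  have step : ∀ σ : H, ∃ s : F, σ ≠ 1 → O.valuation s = 1 ∧
      O.valuation ((σ : F ≃ₐ[k] F) s) < 1 ∧ ∀ τ ∈ H, τ s ∈ O := by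
    intro σ
    by_cases hσ : σ = 1
    · exact ⟨0, fun h => absurd hσ h⟩
    obtain ⟨y, hy, hσy⟩ := hinc σ σ.2 (fun h => hσ (Subtype.ext h))
    -- Each conjugate of y excludes at most one constant, and k is infinite.
    have hfin : (⋃ τ : H, {c : k | O.valuation ((τ : F ≃ₐ[k] F) y - algebraMap k F c) < 1}).Finite := by
      refine Set.finite_iUnion fun τ => Set.Subsingleton.finite ?_
      intro a ha b hb
      by_contra hab
      have h1 := valuation_algebraMap hk (sub_ne_zero.2 hab)
      have h2 := O.valuation.map_sub_lt hb ha
      rw [map_sub] at h1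
      rw [sub_sub_sub_cancel_left, h1] at h2
      exact lt_irrefl _ h2
    obtain ⟨c, hc⟩ := hfin.exists_notMem
    simp only [Set.mem_iUnion, Set.mem_ofPred_eq, not_exists, not_lt] at hc
    refine ⟨(y - algebraMap k F c)⁻¹, fun _ => ⟨?_, ?_, ?_⟩⟩
    · rw [map_inv₀, inv_eq_one]
      exact le_antisymm (valuation_le_one.2 (sub_mem hy (hk c))) (hc 1)
    · rw [map_inv₀, map_sub, AlgEquiv.commutes]
      have h1 : (σ : F ≃ₐ[k] F) y - algebraMap k F c ∉ O := by
        intro h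
        apply hσy
        simpa using add_mem h (hk c)
      have h0 : (σ : F ≃ₐ[k] F) y - algebraMap k F c ≠ 0 := fun h => h1 (by rw [h]; exact zero_mem _)
      rw [valuation_lt_one_iff_inv (inv_ne_zero h0), inv_inv]
      exact h1
    · intro τ hτ
      rw [map_inv₀, map_sub, AlgEquiv.commutes, ← valuation_le_one, map_inv₀]
      exact inv_le_one_of_one_le₀ (hc ⟨τ, hτ⟩)
  choose s hs using step
  refine ⟨∏ σ ∈ Finset.univ.erase (1 : H), s σ, ?_, fun σ hσ => ⟨?_, fun hσ1 => ?_⟩⟩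
  · rw [map_prod]
    exact Finset.prod_eq_one fun σ hσ => (hs σ (Finset.ne_of_mem_erase hσ)).1
  · rw [map_prod]
    exact prod_mem fun τ hτ => (hs τ (Finset.ne_of_mem_erase hτ)).2.2 σ hσ
  · have hmem : (⟨σ, hσ⟩ : H) ∈ Finset.univ.erase (1 : H) :=
      Finset.mem_erase.2 ⟨fun h => hσ1 (congrArg Subtype.val h), Finset.mem_univ _⟩
    rw [map_prod, ← Finset.mul_prod_erase _ _ hmem, map_mul]
    refine (mul_le_of_le_one_right' ?_).trans_lt (hs _ (Finset.ne_of_mem_erase hmem)).2.1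
    rw [valuation_le_one]
    exact prod_mem fun τ hτ => (hs τ (Finset.ne_of_mem_erase (Finset.mem_of_mem_erase hτ))).2.2 σ hσ

/-- At a place with trivial decomposition group, the differentials of the fixed field generate the
regular differentials. -/
theorem exists_D_eq_smul_of_unramified [IsAlgClosed k] (htr : TrdegLeOne k F)
    {O : ValuationSubring F} (hk : ∀ c : k, algebraMap k F c ∈ O)
    (hinc : ∀ σ ∈ H, σ ≠ 1 → ∃ y ∈ O, σ y ∉ O) {ω : Ω[F⁄k]}
    (hA : ∀ c ∈ IntermediateField.fixedField H, c ∈ O →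
      ∃ c' ∈ O, KaehlerDifferential.D k F c = c' • ω)
    {y : F} (hy : y ∈ O) : ∃ y' ∈ O, KaehlerDifferential.D k F y = y' • ω := by
  classical
  have : Infinite k := IsAlgClosed.instInfinite
  obtain ⟨w, hw1, hw⟩ := exists_separating H hk hinc
  have hw0 : w ≠ 0 := by
    rintro rfl
    simp at hw1
  have key : ∀ z : F, O.valuation z = 1 → (∀ σ ∈ H, σ ≠ 1 → O.valuation (σ z) < 1) →
      ∃ y' ∈ O, KaehlerDifferential.D k F z = y' • ω := by
    intro z hz hz'
    refine exists_D_eq_smul_of_groupPoly H hA ?_ ?_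
    · intro σ hσ
      by_cases h1 : σ = 1
      · rw [h1, ← valuation_le_one]
        exact hz.le
      · exact mem_of_valuation_lt_one (hz' σ hσ h1)
    · rw [groupPoly_derivative_eval, map_prod]
      refine Finset.prod_eq_one fun σ hσ => ?_
      rw [Valuation.map_sub_eq_of_lt_left, hz]
      rw [hz]
      exact hz' σ σ.2 (fun h => Finset.ne_of_mem_erase hσ (Subtype.ext h))
  have unit_case : ∀ z : F, O.valuation z = 1 →
      ∃ y' ∈ O, KaehlerDifferential.D k F z = y' • ω := by
    intro z hz
    have hz0 : z ≠ 0 := by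
      rintro rfl
      simp at hz
    -- A high power of w makes all nontrivial conjugates of w^m z vanish, so that φ' is a unit at
    -- w^m z. Then dz is recovered from d(w^m z) and d(w^m) by the product rule.
    have harch : ∀ σ : H, ∃ n : ℕ, σ ≠ 1 → ∀ m, n ≤ m →
        O.valuation ((σ : F ≃ₐ[k] F) (w ^ m * z)) < 1 := by
      intro σ
      by_cases hσ : σ = 1
      · exact ⟨0, fun h => absurd hσ h⟩
      have hlt := (hw σ σ.2).2 (fun h => hσ (Subtype.ext h))
      obtain ⟨n, hn⟩ := exists_pow_mul_mem htr hk hlt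
        ((_root_.map_ne_zero (σ : F ≃ₐ[k] F)).2 hw0) ((σ : F ≃ₐ[k] F) z)
      refine ⟨n + 1, fun _ m hm => ?_⟩
      obtain ⟨d, rfl⟩ := Nat.exists_eq_add_of_le hm
      have : (σ : F ≃ₐ[k] F) (w ^ (n + 1 + d) * z) = ((σ : F ≃ₐ[k] F) w ^ n * (σ : F ≃ₐ[k] F) z) *
          (σ : F ≃ₐ[k] F) w ^ d * (σ : F ≃ₐ[k] F) w := by
        rw [map_mul, map_pow]; ring
      rw [this, map_mul]
      refine (mul_le_of_le_one_left' ?_).trans_lt hlt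
      rw [valuation_le_one]
      exact mul_mem hn (pow_mem (hw σ σ.2).1 _)
    choose n hn using harch
    -- The sum dominates every bound n σ; the added 1 makes m positive, which is needed for w^m
    -- itself.
    set m := ∑ σ, n σ + 1 with hm
    have hle : ∀ σ, n σ ≤ m := fun σ =>
      (Finset.single_le_sum (fun _ _ => Nat.zero_le _) (Finset.mem_univ σ)).trans (Nat.le_succ _)
    obtain ⟨a, haO, ha⟩ := key (w ^ m * z) (by rw [map_mul, map_pow, hw1, hz, one_pow, one_mul])
      (fun σ hσ h1 => hn ⟨σ, hσ⟩ (fun h => h1 (congrArg Subtype.val h)) m (hle _))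
    obtain ⟨b, hbO, hb⟩ := key (w ^ m) (by rw [map_pow, hw1, one_pow]) (fun σ hσ h1 => by
      rw [map_pow, map_pow]
      exact pow_lt_one' ((hw σ hσ).2 h1) (Nat.succ_ne_zero _))
    rw [Derivation.leibniz, hb, smul_smul] at ha
    have hwm : w ^ m ≠ 0 := pow_ne_zero _ hw0
    refine ⟨(w ^ m)⁻¹ * (a - z * b), mul_mem ?_ (sub_mem haO (mul_mem
      (valuation_le_one.1 hz.le) hbO)), ?_⟩
    · rw [← valuation_le_one, map_inv₀, map_pow, hw1, one_pow, inv_one]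
    · rw [mul_smul, sub_smul, ← ha, add_sub_cancel_right, smul_smul, inv_mul_cancel₀ hwm, one_smul]
  by_cases hy1 : O.valuation y = 1
  · exact unit_case y hy1
  · have hlt : O.valuation y < 1 := lt_of_le_of_ne (valuation_le_one.2 hy) hy1
    obtain ⟨a, haO, ha⟩ := unit_case (1 + y) (O.valuation.map_one_add_of_lt hlt)
    refine ⟨a, haO, ?_⟩
    rw [← ha, map_add, Derivation.map_one_eq_zero, zero_add]

end Unramified

end HKG

/-! ### Fixed fields of finite groups and discrete valuations stable under a group -/

namespace HKG

open Polynomial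

section FixedFields

variable {k F : Type*} [Field k] [Field F] [Algebra k F] (H : Subgroup (F ≃ₐ[k] F))

theorem finiteDimensional_fixedField [Finite H] :
    FiniteDimensional (IntermediateField.fixedField H) F :=
  inferInstanceAs (FiniteDimensional (FixedPoints.subfield H F) F)

theorem isSeparable_fixedField [Finite H] :
    Algebra.IsSeparable (IntermediateField.fixedField H) F :=
  inferInstanceAs (Algebra.IsSeparable (FixedPoints.subfield H F) F)

theorem finrank_fixedField [Finite H] :
    Module.finrank (IntermediateField.fixedField H) F = Nat.card H := by
  have := Fintype.ofFinite H
  rw [Nat.card_eq_fintype_card, ← FixedPoints.finrank_eq_card H F]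
  rfl

theorem mem_of_fixes_fixedField [Finite H] {σ : F ≃ₐ[k] F}
    (h : ∀ z ∈ IntermediateField.fixedField H, σ z = z) : σ ∈ H := by
  let f : F →ₐ[FixedPoints.subfield H F] F :=
    { (σ : F →+* F) with
      commutes' := fun z => h z.1 z.2 }
  obtain ⟨τ, hτ⟩ := (FixedPoints.toAlgHom_bijective H F).2 f
  have : σ = τ := by
    ext z
    exact (DFunLike.congr_fun hτ z).symm
  rw [this]
  exact τ.2

end FixedFields

section Ultrametric

variable {k F : Type*} [Field k] [Field F] [Algebra k F] {O : ValuationSubring F}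

/-- In a sum of terms with different valuations no cancellation occurs. -/
theorem valuation_le_sum {ι : Type*} (s : Finset ι) (x : ι → F)
    (hinj : ∀ i ∈ s, ∀ j ∈ s, x i ≠ 0 → x j ≠ 0 → O.valuation (x i) = O.valuation (x j) → i = j) :
    ∀ i ∈ s, O.valuation (x i) ≤ O.valuation (∑ j ∈ s, x j) := by
  classical
  intro i hi
  obtain ⟨j, hj, hmax⟩ := Finset.exists_max_image s (fun i => O.valuation (x i)) ⟨i, hi⟩
  by_cases h0 : x j = 0
  · have := hmax i hi
    rw [h0, map_zero] at this
    exact this.trans zero_le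
  refine (hmax i hi).trans (le_of_eq ?_)
  rw [Valuation.map_sum_eq_of_lt _ hj]
  intro l hl
  rw [Finset.mem_sdiff, Finset.mem_singleton] at hl
  refine lt_of_le_of_ne (hmax l hl.1) fun heq => ?_
  have hl0 : x l ≠ 0 := by
    intro h
    rw [h, map_zero] at heq
    exact h0 ((map_eq_zero _).1 heq.symm)
  exact hl.2 (hinj l hl.1 j hj hl0 h0 heq)

namespace IsUnif

variable {t : F} (hU : IsUnif O t)

include hU

theorem val_pos : 0 < O.valuation t := zero_lt_iff.2 ((_root_.map_ne_zero _).2 hU.1)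

theorem zpow_le_zpow {n m : ℤ} : O.valuation t ^ n ≤ O.valuation t ^ m ↔ m ≤ n :=
  zpow_le_zpow_iff_right_of_lt_one₀ hU.val_pos hU.2.1

theorem zpow_inj {n m : ℤ} (h : O.valuation t ^ n = O.valuation t ^ m) : n = m :=
  le_antisymm (hU.zpow_le_zpow.1 h.ge) (hU.zpow_le_zpow.1 h.le)

theorem zpow_le_one {n : ℤ} : O.valuation t ^ n ≤ 1 ↔ 0 ≤ n := by
  rw [← zpow_zero (O.valuation t), hU.zpow_le_zpow]

theorem le_of_lt_zpow {z : F} {n : ℤ} (h : O.valuation z < O.valuation t ^ n) :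
    O.valuation z ≤ O.valuation t ^ (n + 1) := by
  by_cases hz : z = 0
  · rw [hz, map_zero]; exact zero_le
  obtain ⟨m, hm⟩ := hU.2.2 z hz
  rw [hm] at h ⊢
  rw [hU.zpow_le_zpow]
  have := mt hU.zpow_le_zpow.2 (not_le.2 h)
  omega

theorem eq_zero_of_le {z : F} (h : ∀ M : ℕ, O.valuation z ≤ O.valuation t ^ (M : ℤ)) : z = 0 := by
  by_contra hz
  obtain ⟨m, hm⟩ := hU.2.2 z hz
  have := h (m.toNat + 1)
  rw [hm, hU.zpow_le_zpow] at this
  omega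

-- All generators of the maximal ideal have the same valuation, so the uniformizer chosen inside
-- `HasOrd` does not matter.
omit hU in
theorem hasOrd_iff {P : Place k F} {t z : F} (hU : IsUnif P.ring t)
    (ht : ∃ s : P.ring, IsLocalRing.maximalIdeal P.ring = Ideal.span {s}) {n : ℤ} :
    HasOrd P z n ↔ P.ring.valuation z = P.ring.valuation t ^ n := by
  have key : ∀ s : P.ring, IsLocalRing.maximalIdeal P.ring = Ideal.span {s} →
      P.ring.valuation (s : F) = P.ring.valuation t := by
    intro s hs
    apply le_antisymm
    · have h1 : P.ring.valuation (s : F) < 1 := by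
        rw [← ValuationSubring.valuation_lt_one_iff, hs]
        exact Ideal.mem_span_singleton_self s
      rw [← zpow_zero (P.ring.valuation t)] at h1
      simpa using hU.le_of_lt_zpow h1
    · have : (⟨t, mem_of_valuation_lt_one hU.2.1⟩ : P.ring) ∈ IsLocalRing.maximalIdeal P.ring :=
        (ValuationSubring.valuation_lt_one_iff _ _).2 hU.2.1
      rw [hs, Ideal.mem_span_singleton] at this
      obtain ⟨w, hw⟩ := this
      have hw' : t = (s : F) * (w : F) := congrArg Subtype.val hw
      rw [hw', map_mul]
      exact mul_le_of_le_one_right' (valuation_le_one.2 w.2)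
  constructor
  · rintro ⟨s, hs, w, rfl⟩
    rw [map_mul, map_zpow₀, key s hs, ValuationSubring.valuation_unit, one_mul]
  · intro h
    obtain ⟨s, hs⟩ := ht
    have hs0 : (s : F) ≠ 0 := by
      intro h0
      have := key s hs
      rw [h0, map_zero] at this
      exact hU.1 ((map_eq_zero _).1 this.symm)
    have h2 : P.ring.valuation z = P.ring.valuation ((s : F) ^ n) := by rw [h, map_zpow₀, key s hs]
    obtain ⟨w, hw⟩ := (ValuationSubring.valuation_eq_iff _ _ _).1 h2
    exact ⟨s, hs, w, hw.symm⟩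

variable {H : Subgroup (F ≃ₐ[k] F)} (hst : ∀ σ ∈ H, ∀ y ∈ O, σ y ∈ O)

include hst

omit hU in
theorem mem_iff_of_stable {σ : F ≃ₐ[k] F} (hσ : σ ∈ H) {y : F} : σ y ∈ O ↔ y ∈ O := by
  refine ⟨fun h => ?_, hst σ hσ y⟩
  have := hst σ⁻¹ (inv_mem hσ) _ h
  rwa [← AlgEquiv.smul_def, ← AlgEquiv.smul_def, inv_smul_smul] at this

omit hU in
theorem valuation_eq_one_of_stable {σ : F ≃ₐ[k] F} (hσ : σ ∈ H) {y : F} :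
    O.valuation (σ y) = 1 ↔ O.valuation y = 1 := by
  by_cases hy : y = 0
  · simp [hy]
  have h : ∀ z : F, z ≠ 0 → (O.valuation z = 1 ↔ z ∈ O ∧ z⁻¹ ∈ O) := by
    intro z hz
    rw [← valuation_le_one, ← valuation_le_one, map_inv₀,
      inv_le_one₀ (zero_lt_iff.2 ((_root_.map_ne_zero _).2 hz)), le_antisymm_iff]
  rw [h _ hy, h _ ((_root_.map_ne_zero _).2 hy), ← map_inv₀, mem_iff_of_stable hst hσ,
    mem_iff_of_stable hst hσ]

omit hU in
theorem valuation_lt_one_of_stable {σ : F ≃ₐ[k] F} (hσ : σ ∈ H) {y : F} :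
    O.valuation (σ y) < 1 ↔ O.valuation y < 1 := by
  rw [lt_iff_le_and_ne, lt_iff_le_and_ne, valuation_le_one, valuation_le_one,
    mem_iff_of_stable hst hσ, Ne, Ne, valuation_eq_one_of_stable hst hσ]

/-- A stabilizing automorphism preserves units, hence it acts on the value group through the order n
of σt. Applying σ⁻¹ shows that n is invertible in ℤ, and σt vanishes, so n = 1. -/
theorem valuation_apply {σ : F ≃ₐ[k] F} (hσ : σ ∈ H) (y : F) :
    O.valuation (σ y) = O.valuation y := by
  have ht0 := hU.1
  have key : ∀ τ ∈ H, ∀ z : F, ∀ n : ℤ, O.valuation z = O.valuation t ^ n →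
      O.valuation (τ z) = O.valuation (τ t) ^ n := by
    intro τ hτ z n hz
    have h1 : O.valuation (z / t ^ n) = 1 := by
      rw [map_div₀, map_zpow₀, hz, div_self (zpow_ne_zero _ hU.val_pos.ne')]
    rw [← valuation_eq_one_of_stable hst hτ, map_div₀, map_zpow₀, map_div₀, map_zpow₀,
      div_eq_one_iff_eq] at h1
    · exact h1
    · exact zpow_ne_zero _ ((_root_.map_ne_zero _).2 ((_root_.map_ne_zero τ).2 ht0))
  have ht : ∀ τ ∈ H, O.valuation (τ t) = O.valuation t := by
    intro τ hτ
    obtain ⟨n, hn⟩ := hU.2.2 (τ t) ((_root_.map_ne_zero τ).2 ht0)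
    obtain ⟨m, hm⟩ := hU.2.2 (τ⁻¹ t) ((_root_.map_ne_zero τ⁻¹).2 ht0)
    have h1 := key τ⁻¹ (inv_mem hτ) (τ t) n hn
    rw [← AlgEquiv.smul_def, ← AlgEquiv.smul_def τ, inv_smul_smul, hm, ← zpow_mul] at h1
    have h2 := hU.zpow_inj ((zpow_one _).trans h1)
    have hn0 : 0 ≤ n := by
      have := (valuation_lt_one_of_stable hst hτ (y := t)).2 hU.2.1
      rw [hn] at this
      exact hU.zpow_le_one.1 this.le
    have : n = 1 := by
      rcases Int.eq_one_or_neg_one_of_mul_eq_one' h2.symm with h | h <;> omega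
    rw [hn, this, zpow_one]
  by_cases hy : y = 0
  · simp [hy]
  obtain ⟨n, hn⟩ := hU.2.2 y hy
  rw [key σ hσ y n hn, ht σ hσ, hn]

end IsUnif

end Ultrametric

end HKG

/-! ### Total ramification at a stable place -/

namespace HKG

open Polynomial

section TotallyRamified

variable {k F : Type*} [Field k] [Field F] [Algebra k F] {O : ValuationSubring F} {t : F}

/-- The trace to the fixed field. -/
def groupTrace (H : Subgroup (F ≃ₐ[k] F)) [Fintype H] : F →ₗ[IntermediateField.fixedField H] F where
  toFun y := ∑ σ : H, (σ : F ≃ₐ[k] F) y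
  map_add' y z := by simp [Finset.sum_add_distrib]
  map_smul' c y := by
    rw [RingHom.id_apply, Finset.smul_sum]
    refine Finset.sum_congr rfl fun σ _ => ?_
    rw [IntermediateField.smul_def, IntermediateField.smul_def, smul_eq_mul, smul_eq_mul, map_mul,
      (IntermediateField.mem_fixedField_iff H _).1 c.2 σ σ.2]

variable (H : Subgroup (F ≃ₐ[k] F)) [Fintype H]

theorem groupTrace_mem (y : F) : groupTrace H y ∈ IntermediateField.fixedField H := by
  rw [IntermediateField.mem_fixedField_iff]
  intro τ hτ
  change τ (∑ σ : H, (σ : F ≃ₐ[k] F) y) = ∑ σ : H, (σ : F ≃ₐ[k] F) y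
  rw [map_sum]
  exact Fintype.sum_equiv (Equiv.mulLeft (⟨τ, hτ⟩ : H)) _ _ fun σ => by simp

/-- Nondegeneracy of the trace form, from the linear independence of the automorphisms as
characters. -/
theorem eq_zero_of_groupTrace {z : F} (h : ∀ y, groupTrace H (z * y) = 0) : z = 0 := by
  have hli := linearIndependent_monoidHom F F
  have hinj : Function.Injective (fun σ : H => (((σ : F ≃ₐ[k] F) : F →+* F) : F →* F)) := by
    intro σ τ hστ
    apply Subtype.ext
    ext y
    exact DFunLike.congr_fun hστ y
  have h2 := Fintype.linearIndependent_iff.1 (hli.comp _ hinj) (fun σ => (σ : F ≃ₐ[k] F) z) (by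
    ext y
    have := h y
    simpa [groupTrace] using this) 1
  simpa using h2

variable (hU : IsUnif O t) (hst : ∀ σ ∈ H, ∀ y ∈ O, σ y ∈ O)

include hU hst

theorem valuation_groupTrace_le (y : F) : O.valuation (groupTrace H y) ≤ O.valuation y :=
  Valuation.map_sum_le _ fun σ _ => (hU.valuation_apply hst σ.2 y).le

theorem exists_uniformizer_pow_card : ∃ s ∈ IntermediateField.fixedField H,
    O.valuation s = O.valuation t ^ (Nat.card H : ℤ) := by
  refine ⟨∏ σ : H, (σ : F ≃ₐ[k] F) t, ?_, ?_⟩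
  · rw [IntermediateField.mem_fixedField_iff]
    intro τ hτ
    rw [map_prod]
    exact Fintype.prod_equiv (Equiv.mulLeft (⟨τ, hτ⟩ : H)) _ _ fun σ => by simp
  · rw [map_prod, Finset.prod_congr rfl fun σ _ => hU.valuation_apply hst σ.2 t]
    simp

variable (hres : ∀ y ∈ O, ∃ c : k, O.valuation (y - algebraMap k F c) < 1)

omit [Fintype H] hst in
include hres in
/-- If an element of order `e` lies in the fixed field, then every regular element is approximated
by combinations of `1, t, …, t ^ (e - 1)`. -/
theorem exists_approx {e : ℕ} (he : 0 < e) {u : F} (hu : u ∈ IntermediateField.fixedField H)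
    (huv : O.valuation u = O.valuation t ^ (e : ℤ)) {y : F} (hy : y ∈ O) (M : ℕ) :
    ∃ x ∈ Submodule.span (IntermediateField.fixedField H) (Set.range fun j : Fin e => t ^ (j : ℕ)),
      O.valuation (y - x) ≤ O.valuation t ^ (M : ℤ) := by
  induction M with
  | zero => exact ⟨0, zero_mem _, by simpa using hy⟩
  | succ M ih =>
    obtain ⟨x, hx, hxv⟩ := ih
    have hu0 : u ≠ 0 := by
      rintro rfl
      rw [map_zero] at huv
      exact zpow_ne_zero _ hU.val_pos.ne' huv.symm
    -- Division with remainder gives an element of order exactly M in the span; a constant multiple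
    -- of it removes the leading term of the error.
    set m : F := u ^ (M / e) * t ^ (M % e) with hm
    have hm0 : m ≠ 0 := mul_ne_zero (pow_ne_zero _ hu0) (pow_ne_zero _ hU.1)
    have hmv : O.valuation m = O.valuation t ^ (M : ℤ) := by
      rw [hm, map_mul, map_pow, map_pow, huv, ← zpow_natCast, ← zpow_mul, ← zpow_natCast,
        ← zpow_add₀ hU.val_pos.ne']
      congr 1
      exact_mod_cast Nat.div_add_mod M e
    obtain ⟨c, hc⟩ := hres ((y - x) / m) (by
      rw [← valuation_le_one, map_div₀, hmv]
      exact div_le_one_of_le₀ hxv zero_le)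
    refine ⟨x + algebraMap k F c * m, add_mem hx ?_, ?_⟩
    · have h1 : algebraMap k F c * u ^ (M / e) ∈ IntermediateField.fixedField H :=
        mul_mem (algebraMap_mem _ c) (pow_mem hu _)
      have := Submodule.smul_mem (Submodule.span (IntermediateField.fixedField H)
        (Set.range fun j : Fin e => t ^ (j : ℕ))) (⟨_, h1⟩ : IntermediateField.fixedField H)
        (Submodule.subset_span ⟨⟨M % e, Nat.mod_lt _ he⟩, rfl⟩)
      rw [IntermediateField.smul_def, smul_eq_mul] at this
      rw [hm, ← mul_assoc]
      exact this
    · have h2 : y - (x + algebraMap k F c * m) = ((y - x) / m - algebraMap k F c) * m := by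
        field_simp
        ring
      rw [← zpow_zero (O.valuation t)] at hc
      have := hU.le_of_lt_zpow hc
      rw [h2, map_mul, hmv]
      push_cast
      rw [add_comm, zpow_add₀ hU.val_pos.ne']
      exact mul_le_mul_left (by simpa using this) _

include hres

/-- The ramification is total: the orders of the elements of the fixed field are the multiples of
the order of the group. -/
theorem exists_valuation_fixedField {z : F} (hz : z ∈ IntermediateField.fixedField H)
    (hz0 : z ≠ 0) : ∃ n : ℤ, O.valuation z = O.valuation t ^ (Nat.card H * n : ℤ) := by
  classical
  have hex : ∃ e : ℕ, 0 < e ∧ ∃ u ∈ IntermediateField.fixedField H,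
      O.valuation u = O.valuation t ^ (e : ℤ) :=
    ⟨Nat.card H, Nat.card_pos, exists_uniformizer_pow_card H hU hst⟩
  set e := Nat.find hex with he
  obtain ⟨he0, u, hu, huv⟩ := Nat.find_spec hex
  have hu0 : u ≠ 0 := by
    rintro rfl
    rw [map_zero] at huv
    exact zpow_ne_zero _ hU.val_pos.ne' huv.symm
  have hle : e ≤ Nat.card H :=
    Nat.find_min' hex ⟨Nat.card_pos, exists_uniformizer_pow_card H hU hst⟩
  have heq : e = Nat.card H := by
    refine le_antisymm hle (not_lt.1 fun hlt => ?_)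
    have := finiteDimensional_fixedField H
    -- If e < |H|, a dimension count yields w ≠ 0 that is trace-orthogonal to 1, t, …, t^(e-1).
    -- Approximation extends the orthogonality to O and then to F, contradicting nondegeneracy; no
    -- completion is needed.
    let T : F →ₗ[IntermediateField.fixedField H] (Fin e → IntermediateField.fixedField H) :=
      { toFun := fun z j => ⟨groupTrace H (z * t ^ (j : ℕ)), groupTrace_mem H _⟩
        map_add' := by
          intro a b
          ext j
          simp [add_mul]
        map_smul' := by
          intro c a
          ext j
          simp only [smul_mul_assoc, map_smul]
          rfl }
    obtain ⟨w, hw, hw0⟩ := Submodule.exists_mem_ne_zero_of_ne_bot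
      (LinearMap.ker_ne_bot_of_finrank_lt (f := T) (by
        rw [finrank_fixedField, Module.finrank_fin_fun]
        exact hlt))
    apply hw0
    have hspan : ∀ x ∈ Submodule.span (IntermediateField.fixedField H)
        (Set.range fun j : Fin e => t ^ (j : ℕ)), groupTrace H (w * x) = 0 := by
      intro x hx
      induction hx using Submodule.span_induction with
      | mem x hx =>
        obtain ⟨j, rfl⟩ := hx
        exact congrArg Subtype.val (congrFun (LinearMap.mem_ker.1 hw) j)
      | zero => simp
      | add x y _ _ hx hy => rw [mul_add, map_add, hx, hy, add_zero]
      | smul c x _ hx => rw [mul_smul_comm, map_smul, hx, smul_zero]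
    have hO : ∀ y ∈ O, groupTrace H (w * y) = 0 := by
      intro y hy
      obtain ⟨a, ha⟩ := hU.2.2 w hw0
      refine hU.eq_zero_of_le fun M => ?_
      obtain ⟨x, hx, hxv⟩ := exists_approx H hU hres he0 hu huv hy (M + a.natAbs)
      have h1 : groupTrace H (w * y) = groupTrace H (w * (y - x)) := by
        rw [mul_sub, map_sub, hspan x hx, sub_zero]
      rw [h1]
      refine (valuation_groupTrace_le H hU hst _).trans ?_
      rw [map_mul, ha]
      refine (mul_le_mul_right hxv _).trans ?_
      rw [← zpow_add₀ hU.val_pos.ne', hU.zpow_le_zpow]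
      push_cast
      have := neg_abs_le a
      omega
    refine eq_zero_of_groupTrace H fun y => ?_
    -- Poles are cleared by a power of u, which lies in the fixed field and so passes through the
    -- trace.
    obtain ⟨n, hn⟩ : ∃ n : ℕ, y * u ^ n ∈ O := by
      by_cases hy0 : y = 0
      · exact ⟨0, by rw [hy0, zero_mul]; exact zero_mem _⟩
      obtain ⟨a, ha⟩ := hU.2.2 y hy0
      refine ⟨a.natAbs, ?_⟩
      rw [← valuation_le_one, map_mul, map_pow, ha, huv, ← zpow_natCast, ← zpow_mul,
        ← zpow_add₀ hU.val_pos.ne', hU.zpow_le_one]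
      have : (1 : ℤ) ≤ e := by exact_mod_cast he0
      nlinarith [abs_nonneg a, neg_abs_le a, Int.natCast_natAbs a]
    have h1 := hO _ hn
    have h2 : w * (y * u ^ n) = (⟨u ^ n, pow_mem hu n⟩ : IntermediateField.fixedField H) • (w * y) := by
      rw [IntermediateField.smul_def, smul_eq_mul]
      ring
    rw [h2, map_smul, smul_eq_zero] at h1
    refine h1.resolve_left fun h => pow_ne_zero n hu0 (congrArg Subtype.val h)
  obtain ⟨n, hn⟩ := hU.2.2 z hz0
  -- A nonzero remainder would be a smaller positive order in the fixed field than the minimal one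
  -- e.
  have hmod : n % e = 0 := by
    by_contra hne
    have hpos : 0 ≤ n % (e : ℤ) := Int.emod_nonneg _ (by omega)
    have hlt : n % (e : ℤ) < e := Int.emod_lt_of_pos _ (by omega)
    have : e ≤ (n % (e : ℤ)).toNat := by
      refine Nat.find_min' hex ⟨by omega, z * u ^ (-(n / e)), mul_mem hz (zpow_mem hu _), ?_⟩
      rw [map_mul, map_zpow₀, hn, huv, ← zpow_mul, ← zpow_add₀ hU.val_pos.ne', Int.toNat_of_nonneg hpos]
      congr 1
      rw [Int.emod_def]
      ring
    omega
  refine ⟨n / e, ?_⟩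
  rw [hn, ← heq]
  congr 1
  have := Int.emod_add_mul_ediv n e
  omega

/-- The valuation ring is generated by `t` over the valuation ring of the fixed field. -/
theorem exists_coeffs {y : F} (hy : y ∈ O) : ∃ c : Fin (Nat.card H) → F,
    (∀ j, c j ∈ IntermediateField.fixedField H ∧ c j ∈ O) ∧ y = ∑ j, c j * t ^ (j : ℕ) := by
  have := finiteDimensional_fixedField H
  have hval : ∀ c : F, c ∈ IntermediateField.fixedField H → ∀ j : Fin (Nat.card H),
      c * t ^ (j : ℕ) ≠ 0 → ∃ n : ℤ, O.valuation c = O.valuation t ^ (Nat.card H * n : ℤ) ∧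
        O.valuation (c * t ^ (j : ℕ)) = O.valuation t ^ (Nat.card H * n + (j : ℕ) : ℤ) := by
    intro c hc j h0
    obtain ⟨n, hn⟩ := exists_valuation_fixedField H hU hst hres hc (left_ne_zero_of_mul h0)
    refine ⟨n, hn, ?_⟩
    rw [map_mul, hn, map_pow, ← zpow_natCast, ← zpow_add₀ hU.val_pos.ne']
  have hle : ∀ c : Fin (Nat.card H) → IntermediateField.fixedField H, ∀ i,
      O.valuation ((c i : F) * t ^ (i : ℕ)) ≤ O.valuation (∑ j, (c j : F) * t ^ (j : ℕ)) := by
    intro c i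
    refine valuation_le_sum Finset.univ (fun j => (c j : F) * t ^ (j : ℕ)) ?_ i (Finset.mem_univ i)
    intro i _ j _ hi hj heq
    obtain ⟨n, -, hn⟩ := hval _ (c i).2 i hi
    obtain ⟨m, -, hm⟩ := hval _ (c j).2 j hj
    rw [hn, hm] at heq
    have h1 := hU.zpow_inj heq
    have hi' := i.2
    have hj' := j.2
    have h2 : ((Nat.card H * n + (i : ℕ)) % Nat.card H : ℤ) = (Nat.card H * m + (j : ℕ)) % Nat.card H := by
      rw [h1]
    rw [Int.mul_add_emod_self_left, Int.mul_add_emod_self_left] at h2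
    norm_cast at h2
    rw [Nat.mod_eq_of_lt hi', Nat.mod_eq_of_lt hj'] at h2
    exact Fin.ext h2
  have hli : LinearIndependent (IntermediateField.fixedField H)
      (fun j : Fin (Nat.card H) => t ^ (j : ℕ)) := by
    rw [Fintype.linearIndependent_iff]
    intro g hg i
    have h1 := hle g i
    simp only [IntermediateField.smul_def, smul_eq_mul] at hg
    rw [hg, map_zero, le_zero_iff, map_eq_zero] at h1
    exact Subtype.ext ((mul_eq_zero.1 h1).resolve_right (pow_ne_zero _ hU.1))
  have htop := hli.span_eq_top_of_card_eq_finrank' (by rw [finrank_fixedField, Fintype.card_fin])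
  have hmem : y ∈ Submodule.span (IntermediateField.fixedField H)
      (Set.range (fun j : Fin (Nat.card H) => t ^ (j : ℕ))) := by rw [htop]; trivial
  obtain ⟨c, hc⟩ := (Submodule.mem_span_range_iff_exists_fun _).1 hmem
  simp only [IntermediateField.smul_def, smul_eq_mul] at hc
  refine ⟨fun j => c j, fun j => ⟨(c j).2, ?_⟩, hc.symm⟩
  by_cases h0 : (c j : F) = 0
  · change (c j : F) ∈ O
    rw [h0]; exact zero_mem _
  obtain ⟨n, hn, hn'⟩ := hval _ (c j).2 j (mul_ne_zero h0 (pow_ne_zero _ hU.1))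
  have h1 := hle c j
  rw [hc, hn'] at h1
  replace h1 := hU.zpow_le_one.1 (h1.trans (valuation_le_one.2 hy))
  rw [← valuation_le_one, hn, hU.zpow_le_one]
  have hj := j.2
  -- The order |H| n of c j is at least -j > -|H|, and a multiple of |H| above -|H| is nonnegative.
  have : (0 : ℤ) ≤ n := by
    by_contra hneg
    have h2 : (Nat.card H : ℤ) * n ≤ Nat.card H * (-1) :=
      mul_le_mul_of_nonneg_left (by omega) (by positivity)
    omega
  positivity

/-- Write y as a polynomial in t with regular invariant coefficients: σy - y is then divisible by σt
- t. Thus the uniformizer alone tests membership in a ramification group. -/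
theorem valuation_sub_le {σ : F ≃ₐ[k] F} (hσ : σ ∈ H) {y : F} (hy : y ∈ O) :
    O.valuation (σ y - y) ≤ O.valuation (σ t - t) := by
  obtain ⟨c, hc, rfl⟩ := exists_coeffs H hU hst hres hy
  rw [map_sum, ← Finset.sum_sub_distrib]
  refine Valuation.map_sum_le _ fun j _ => ?_
  rw [map_mul, (IntermediateField.mem_fixedField_iff H _).1 (hc j).1 σ hσ, ← mul_sub, map_pow,
    ← (Commute.all (σ t) t).geom_sum₂_mul, map_mul, map_mul]
  have htO := mem_of_valuation_lt_one hU.2.1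
  refine (mul_le_of_le_one_left' (valuation_le_one.2 (hc j).2)).trans
    (mul_le_of_le_one_left' (valuation_le_one.2 (sum_mem fun i _ => mul_mem (pow_mem (hst σ hσ t htO) _)
      (pow_mem htO _))))

theorem apply_uniformizer_ne {σ : F ≃ₐ[k] F} (hσ : σ ∈ H) (h1 : σ ≠ 1) : σ t ≠ t := by
  intro h
  apply h1
  have hO : ∀ y ∈ O, σ y = y := by
    intro y hy
    have := valuation_sub_le H hU hst hres hσ hy
    rw [h, sub_self, map_zero, le_zero_iff, map_eq_zero, sub_eq_zero] at this
    exact this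
  ext y
  rcases O.mem_or_inv_mem y with hy | hy
  · exact hO y hy
  · have := hO _ hy
    rw [map_inv₀] at this
    exact inv_injective this

end TotallyRamified

end HKG

/-! ### Lower ramification groups -/

namespace HKG

open Polynomial

section Ramification

variable {k F : Type*} [Field k] [Field F] [Algebra k F]

theorem mem_ramGroup {G : Subgroup (F ≃ₐ[k] F)} {P : Place k F} {j : ℕ} {σ : F ≃ₐ[k] F} :
    σ ∈ ramGroup G P j ↔ σ ∈ G ∧ ∃ _ : σ • P.ring = P.ring, ∀ y ∈ P.ring,
      ∃ h : σ y - y ∈ P.ring, (⟨σ y - y, h⟩ : P.ring) ∈ IsLocalRing.maximalIdeal P.ring ^ (j + 1) := by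
  rw [ramGroup, Subgroup.mem_inf]
  refine and_congr_right fun _ => ?_
  constructor
  · rintro ⟨τ, hτ, rfl⟩
    refine ⟨τ.2, fun y hy => ?_⟩
    have := hτ ⟨y, hy⟩
    exact ⟨(τ • (⟨y, hy⟩ : P.ring) - (⟨y, hy⟩ : P.ring)).2, this⟩
  · rintro ⟨h, h'⟩
    refine ⟨⟨σ, h⟩, fun y => ?_, rfl⟩
    obtain ⟨h1, h2⟩ := h' y y.2
    exact h2

theorem ramGroup_le (G : Subgroup (F ≃ₐ[k] F)) (P : Place k F) (j : ℕ) : ramGroup G P j ≤ G :=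
  inf_le_left

theorem ramGroup_antitone (G : Subgroup (F ≃ₐ[k] F)) (P : Place k F) :
    Antitone (ramGroup G P) := by
  intro i j hij σ hσ
  rw [mem_ramGroup] at hσ ⊢
  obtain ⟨h1, h2, h3⟩ := hσ
  refine ⟨h1, h2, fun y hy => ?_⟩
  obtain ⟨h, h4⟩ := h3 y hy
  exact ⟨h, Ideal.pow_le_pow_right (by omega) h4⟩

/-- The residue field is k, on which σ acts trivially, so the decomposition group is the inertia
group. -/
theorem smul_ne_of_ramGroup_eq_bot [IsAlgClosed k] (htr : TrdegLeOne k F)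
    {G : Subgroup (F ≃ₐ[k] F)} {Q : Place k F} (hQ : ramGroup G Q 0 = ⊥) {σ : F ≃ₐ[k] F}
    (hσ : σ ∈ G) (h1 : σ ≠ 1) : σ • Q.ring ≠ Q.ring := by
  intro h
  apply h1
  rw [← Subgroup.mem_bot, ← hQ, mem_ramGroup]
  have hst : ∀ y ∈ Q.ring, σ y ∈ Q.ring := by
    intro y hy
    rw [← h]
    exact ValuationSubring.smul_mem_pointwise_smul σ y _ hy
  refine ⟨hσ, h, fun y hy => ⟨sub_mem (hst y hy) hy, ?_⟩⟩
  rw [zero_add, pow_one, ValuationSubring.valuation_lt_one_iff]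
  change Q.ring.valuation (σ y - y) < 1
  obtain ⟨c, hc⟩ := exists_residue htr Q.algebraMap_mem Q.ne_top hy
  have hs : σ y - y = σ (y - algebraMap k F c) - (y - algebraMap k F c) := by
    rw [map_sub, AlgEquiv.commutes]
    ring
  rw [hs]
  refine Valuation.map_sub_lt _ ?_ hc
  by_cases h0 : y - algebraMap k F c = 0
  · rw [h0, map_zero, map_zero]; exact zero_lt_one
  · rw [valuation_lt_one_iff_inv h0] at hc
    rw [valuation_lt_one_iff_inv ((_root_.map_ne_zero σ).2 h0), ← map_inv₀]
    intro h2
    apply hc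
    rw [← h, ValuationSubring.mem_pointwise_smul_iff_inv_smul_mem] at h2
    rwa [← AlgEquiv.smul_def, inv_smul_smul] at h2

theorem stable_of_ramGroup_eq {G : Subgroup (F ≃ₐ[k] F)} {P : Place k F} (hP : ramGroup G P 0 = G) :
    ∀ σ ∈ G, ∀ y ∈ P.ring, σ y ∈ P.ring := by
  intro σ hσ y hy
  rw [← hP, mem_ramGroup] at hσ
  obtain ⟨-, h, -⟩ := hσ
  rw [← h]
  exact ValuationSubring.smul_mem_pointwise_smul σ y _ hy

theorem mem_maximalIdeal_pow {O : ValuationSubring F} {s : O}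
    (hs : IsLocalRing.maximalIdeal O = Ideal.span {s}) {z : O} {n : ℕ} :
    z ∈ IsLocalRing.maximalIdeal O ^ n ↔ O.valuation (z : F) ≤ O.valuation (s : F) ^ n := by
  rw [hs, Ideal.span_singleton_pow, Ideal.mem_span_singleton, ← map_pow,
    ValuationSubring.valuation_le_iff]
  constructor
  · rintro ⟨w, hw⟩
    exact ⟨w, by rw [hw, mul_comm]; rfl⟩
  · rintro ⟨w, hw⟩
    exact ⟨w, Subtype.ext (by rw [← hw, mul_comm]; rfl)⟩

theorem prod_X_sub_C_dvd {R ι : Type*} [CommRing R] [IsDomain R] [Fintype ι] {x : ι → R}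
    (hx : Function.Injective x) {p : R[X]} (hp : ∀ i, p.IsRoot (x i)) :
    ∏ i, (X - C (x i)) ∣ p := by
  by_cases h0 : p = 0
  · rw [h0]; exact dvd_zero _
  have h1 : ∏ i, (X - C (x i)) = ((Finset.univ.val.map x).map fun a => X - C a).prod := by
    rw [Multiset.map_map]
    rfl
  rw [h1, Multiset.prod_X_sub_C_dvd_iff_le_roots h0,
    Multiset.le_iff_subset (Finset.univ.nodup.map hx)]
  intro a ha
  obtain ⟨i, -, rfl⟩ := Multiset.mem_map.1 ha
  exact (mem_roots h0).2 (hp i)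

section AtP

variable {G : Subgroup (F ≃ₐ[k] F)} [Fintype G] {P : Place k F} {s : P.ring}
  (hs : IsLocalRing.maximalIdeal P.ring = Ideal.span {s}) (hU : IsUnif P.ring (s : F))
  (hst : ∀ σ ∈ G, ∀ y ∈ P.ring, σ y ∈ P.ring)
  (hres : ∀ y ∈ P.ring, ∃ c : k, P.ring.valuation (y - algebraMap k F c) < 1)

include hs hU hst hres

theorem mem_ramGroup_iff {j : ℕ} {σ : F ≃ₐ[k] F} : σ ∈ ramGroup G P j ↔
    σ ∈ G ∧ P.ring.valuation (σ s - s) ≤ P.ring.valuation (s : F) ^ ((j : ℤ) + 1) := by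
  rw [mem_ramGroup]
  refine and_congr_right fun hσ => ?_
  constructor
  · rintro ⟨-, h⟩
    obtain ⟨h1, h2⟩ := h s s.2
    rw [mem_maximalIdeal_pow hs] at h2
    exact_mod_cast h2
  · intro h
    refine ⟨?_, fun y hy => ⟨sub_mem (hst σ hσ y hy) hy, ?_⟩⟩
    · ext y
      rw [ValuationSubring.mem_pointwise_smul_iff_inv_smul_mem, AlgEquiv.smul_def,
        IsUnif.mem_iff_of_stable hst (inv_mem hσ)]
    · rw [mem_maximalIdeal_pow hs]
      refine (valuation_sub_le G hU hst hres hσ hy).trans ?_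
      exact_mod_cast h

/-- In characteristic `p` a totally ramified `p`-group is wildly ramified. -/
theorem ramGroup_one_eq (p : ℕ) [Fact p.Prime] [CharP k p] (hG : IsPGroup p G) :
    ramGroup G P 1 = G := by
  refine le_antisymm (ramGroup_le G P 1) fun σ hσ => ?_
  rw [mem_ramGroup_iff hs hU hst hres]
  refine ⟨hσ, ?_⟩
  set v := P.ring.valuation with hv
  have hs0 : (s : F) ≠ 0 := hU.1
  obtain ⟨c, hc⟩ := hres (σ s / s) (by
    rw [← valuation_le_one, map_div₀, hU.valuation_apply hst hσ, div_self hU.val_pos.ne'])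
  -- The residue of σs/s is multiplicative in powers of σ because σ acts trivially on residues.
  have hpow : ∀ n : ℕ, v ((σ ^ n) s / s - algebraMap k F (c ^ n)) < 1 := by
    intro n
    induction n with
    | zero => simp [hs0]
    | succ n ih =>
      have h1 : (σ ^ (n + 1)) (s : F) / s - algebraMap k F (c ^ (n + 1)) =
          σ ((σ ^ n) s / s - algebraMap k F (c ^ n)) * (σ s / s) +
          algebraMap k F (c ^ n) * (σ s / s - algebraMap k F c) := by
        have h2 : σ (s : F) ≠ 0 := (_root_.map_ne_zero σ).2 hs0
        rw [pow_succ' σ, map_sub, AlgEquiv.commutes, map_div₀, pow_succ c, map_mul, AlgEquiv.mul_apply]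
        field_simp
        ring
      rw [h1]
      refine Valuation.map_add_lt _ ?_ ?_
      · rw [map_mul, hU.valuation_apply hst hσ, map_div₀, hU.valuation_apply hst hσ,
          div_self hU.val_pos.ne', mul_one]
        exact ih
      · rw [map_mul]
        exact (mul_le_of_le_one_left' (valuation_le_one.2 (P.algebraMap_mem _))).trans_lt hc
  obtain ⟨n, hn⟩ := hG ⟨σ, hσ⟩
  have hn' : σ ^ p ^ n = 1 := congrArg Subtype.val hn
  have h1 := hpow (p ^ n)
  rw [hn', AlgEquiv.one_apply, div_self hs0, ← map_one (algebraMap k F), ← map_sub] at h1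
  -- The residue c is a p-power root of unity in characteristic p.
  have hc1 : c = 1 := by
    by_contra hne
    have h2 : (1 : k) - c ^ p ^ n ≠ 0 := by
      have : (1 : k) - c ^ p ^ n = (1 - c) ^ p ^ n := by
        rw [sub_pow_char_pow, one_pow]
      rw [this]
      exact pow_ne_zero _ (sub_ne_zero.2 (Ne.symm hne))
    rw [valuation_algebraMap P.algebraMap_mem h2] at h1
    exact lt_irrefl _ h1
  rw [hc1, map_one] at hc
  have h3 : σ (s : F) - s = (σ s / s - 1) * s := by field_simp
  have h4 := hU.le_of_lt_zpow (z := σ s / s - 1) (n := 0) (by rwa [zpow_zero])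
  rw [h3, map_mul]
  rw [zpow_add₀ hU.val_pos.ne', zpow_one]
  refine mul_le_mul_left (by simpa using h4) _

/-- The action on the fixed field of the next ramification group is as trivial as on the whole
field. -/
theorem valuation_sub_le_of_fixed {b : ℕ} {σ : F ≃ₐ[k] F} (hσ : σ ∈ ramGroup G P b)
    {y : F} (hy : y ∈ P.ring) (hyH : y ∈ IntermediateField.fixedField (ramGroup G P (b + 1))) :
    P.ring.valuation (σ y - y) ≤
      P.ring.valuation (s : F) ^ ((Nat.card (ramGroup G P (b + 1)) * (b + 1) : ℕ) : ℤ) := by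
  classical
  set H := ramGroup G P (b + 1) with hH
  have hHG : ∀ τ ∈ H, τ ∈ G := fun τ hτ => ramGroup_le G P _ hτ
  have hHb : ∀ τ ∈ H, τ ∈ ramGroup G P b := fun τ hτ => ramGroup_antitone G P (Nat.le_succ b) hτ
  have : Finite H := Set.Finite.subset (Set.toFinite (G : Set (F ≃ₐ[k] F))) hHG
  have := Fintype.ofFinite H
  have hσG := ramGroup_le G P _ hσ
  have hsO : (s : F) ∈ P.ring := s.2
  obtain ⟨c, hc, rfl⟩ := exists_coeffs G hU hst hres hy
  set y := ∑ j, c j * (s : F) ^ (j : ℕ) with hydef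
  let c' : Fin (Nat.card G) → P.ring := fun j => ⟨c j, (hc j).2⟩
  -- Here g(s) = y with invariant coefficients, so g - σy vanishes at στ(s) for all τ in H. Hence
  -- the product of the s - στ(s) divides y - σy, and each of its |H| factors has order at least b +
  -- 1.
  let g : P.ring[X] := ∑ j, C (c' j) * X ^ (j : ℕ)
  have hg : ∀ τ ∈ G, ∀ h : τ s ∈ P.ring, ((g.eval ⟨τ s, h⟩ : P.ring) : F) = τ y := by
    intro τ hτ h
    simp only [g, eval_finsetSum, eval_mul, eval_C, eval_pow, eval_X]
    rw [hydef, map_sum]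
    push_cast
    refine Finset.sum_congr rfl fun j _ => ?_
    rw [map_mul, map_pow, (IntermediateField.mem_fixedField_iff G _).1 (hc j).1 τ hτ]
  have hτO : ∀ τ : H, σ ((τ : F ≃ₐ[k] F) s) ∈ P.ring := fun τ =>
    hst _ hσG _ (hst _ (hHG _ τ.2) _ hsO)
  let x : H → P.ring := fun τ => ⟨σ ((τ : F ≃ₐ[k] F) s), hτO τ⟩
  have hxinj : Function.Injective x := by
    intro τ τ' h
    have h1 : (τ : F ≃ₐ[k] F) (s : F) = (τ' : F ≃ₐ[k] F) s := σ.injective (congrArg Subtype.val h)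
    by_contra hne
    refine apply_uniformizer_ne G hU hst hres (σ := (τ' : F ≃ₐ[k] F)⁻¹ * τ)
      (mul_mem (inv_mem (hHG _ τ'.2)) (hHG _ τ.2)) ?_ ?_
    · intro h2
      rw [inv_mul_eq_one] at h2
      exact hne (Subtype.ext h2.symm)
    · rw [AlgEquiv.mul_apply, h1, ← AlgEquiv.smul_def, ← AlgEquiv.smul_def, inv_smul_smul]
  have hσy : σ y ∈ P.ring := hst σ hσG y hy
  have hroot : ∀ τ : H, (g - C (⟨σ y, hσy⟩ : P.ring)).IsRoot (x τ) := by
    intro τ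
    rw [IsRoot.def, eval_sub, eval_C, sub_eq_zero]
    apply Subtype.ext
    have h1 := hg (σ * τ) (mul_mem hσG (hHG _ τ.2)) (hτO τ)
    refine h1.trans ?_
    change σ ((τ : F ≃ₐ[k] F) y) = σ y
    rw [(IntermediateField.mem_fixedField_iff H _).1 hyH τ τ.2]
  have hdvd : ∏ τ : H, (X - C (x τ)) ∣ g - C (⟨σ y, hσy⟩ : P.ring) :=
    prod_X_sub_C_dvd hxinj hroot
  obtain ⟨q, hq⟩ := hdvd
  have h1 := congrArg (eval s) hq
  rw [eval_sub, eval_C, eval_mul, eval_prod] at h1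
  have h2 : y - σ y = (∏ τ : H, ((s : F) - σ ((τ : F ≃ₐ[k] F) s))) * (q.eval s : P.ring) := by
    have h3 := congrArg (Subtype.val) h1
    have h4 := hg 1 (one_mem _) hsO
    have h5 : y - σ y = ((eval s g - ⟨σ y, hσy⟩ : P.ring) : F) := congrArg (· - σ y) h4.symm
    refine h5.trans (h3.trans ?_)
    · push_cast
      congr 1
      refine Finset.prod_congr rfl fun τ _ => ?_
      rw [eval_sub, eval_X, eval_C]
      rfl
  rw [Valuation.map_sub_swap, h2, map_mul, map_prod]
  refine (mul_le_of_le_one_right' (valuation_le_one.2 (q.eval s).2)).trans ?_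
  calc _ ≤ ∏ τ : H, P.ring.valuation (s : F) ^ ((b : ℤ) + 1) := by
        refine Finset.prod_le_prod' fun τ _ => ?_
        rw [Valuation.map_sub_swap]
        exact ((mem_ramGroup_iff hs hU hst hres).1 (mul_mem hσ (hHb _ τ.2))).2
    _ = _ := by
        rw [Finset.prod_const, Finset.card_univ, ← zpow_natCast, ← zpow_mul, Nat.card_eq_fintype_card]
        congr 1
        push_cast
        ring

end AtP

end Ramification

end HKG

/-! ### Jumps prime to p, and the order of dx at the ramified place -/

namespace HKG

open Polynomial

section AtP

variable {k F : Type*} [Field k] [Field F] [Algebra k F]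
variable {G : Subgroup (F ≃ₐ[k] F)} [Fintype G] {P : Place k F} {s : P.ring}
  (hs : IsLocalRing.maximalIdeal P.ring = Ideal.span {s}) (hU : IsUnif P.ring (s : F))
  (hst : ∀ σ ∈ G, ∀ y ∈ P.ring, σ y ∈ P.ring)
  (hres : ∀ y ∈ P.ring, ∃ c : k, P.ring.valuation (y - algebraMap k F c) < 1)

include hU hst hres

include hs in
/-- A jump of the ramification filtration is prime to `p` if it is the pole order of an
Artin–Schreier generator. -/
theorem not_dvd_of_artinSchreier (p : ℕ) [Fact p.Prime] [CharP k p] {b : ℕ} (hb : 1 ≤ b)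
    {σ : F ≃ₐ[k] F} (hσ : σ ∈ ramGroup G P b) {f : F}
    (hf : f ∈ IntermediateField.fixedField (ramGroup G P (b + 1)))
    (hfv : P.ring.valuation f =
      P.ring.valuation (s : F) ^ (-((Nat.card (ramGroup G P (b + 1)) * b : ℕ) : ℤ)))
    {c : k} (hc : c ≠ 0) (hσf : σ f - f = algebraMap k F c) : ¬ p ∣ b := by
  set H := ramGroup G P (b + 1) with hH
  set v := P.ring.valuation with hv
  have hfin : Finite H := Set.Finite.subset (Set.toFinite (G : Set (F ≃ₐ[k] F)))
    (fun τ hτ => ramGroup_le G P _ hτ)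
  have := Fintype.ofFinite H
  have hcard : 0 < Nat.card H := Nat.card_pos
  obtain ⟨u, hu, huv⟩ := exists_uniformizer_pow_card H hU (fun τ hτ => hst τ (ramGroup_le G P _ hτ))
  have hu0 : u ≠ 0 := by
    rintro rfl
    rw [map_zero] at huv
    exact zpow_ne_zero _ hU.val_pos.ne' huv.symm
  have huO : u ∈ P.ring := by
    rw [← valuation_le_one, huv, hU.zpow_le_one]
    positivity
  have hσG := ramGroup_le G P _ hσ
  rintro ⟨b', rfl⟩
  have : CharP F p := charP_of_injective_algebraMap (algebraMap k F).injective p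
  set b := p * b' with hbdef
  set N : ℤ := ((Nat.card H : ℕ) : ℤ) with hN
  -- Since u has order |H|, w is a unit in the fixed field of H. If p divided b, then u^b would be
  -- so nearly fixed by σ that σw - w would show the term c u^b, whose order |H| b is below the
  -- least possible order |H|(b + 1).
  set w := f * u ^ b with hw
  set x := σ u / u - 1 with hx
  have hxv : v x ≤ v (s : F) ^ (N * b : ℤ) := by
    have h1 := valuation_sub_le_of_fixed hs hU hst hres hσ huO hu
    have h2 : σ u - u = x * u := by rw [hx]; field_simp
    rw [h2, map_mul, huv] at h1
    have h3 := mul_le_mul_left h1 ((v (s : F) ^ (Nat.card H : ℤ))⁻¹)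
    rw [mul_assoc, mul_inv_cancel₀ (zpow_ne_zero _ hU.val_pos.ne'), mul_one, ← zpow_neg,
      ← zpow_add₀ hU.val_pos.ne'] at h3
    refine h3.trans (le_of_eq ?_)
    congr 1
    push_cast
    ring
  have hwv : v w = 1 := by
    rw [hw, map_mul, map_pow, hfv, huv, ← zpow_natCast, ← zpow_mul, ← zpow_add₀ hU.val_pos.ne']
    have : -((Nat.card H * b : ℕ) : ℤ) + (Nat.card H : ℤ) * (b : ℤ) = 0 := by push_cast; ring
    rw [this, zpow_zero]
  have hwO : w ∈ P.ring := valuation_le_one.1 hwv.le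
  have hσw : v (σ w - w) ≤ v (s : F) ^ (N * (b + 1) : ℤ) := by
    have := valuation_sub_le_of_fixed hs hU hst hres hσ hwO (mul_mem hf (pow_mem hu b))
    push_cast at this
    exact this
  -- As p divides b, this difference is a multiple of x^p, of order at least p N b ≥ N (b + 1).
  have hη : v ((1 + x) ^ b - 1) ≤ v (s : F) ^ (N * (b + 1) : ℤ) := by
    have hxO : x ∈ P.ring := by
      rw [← valuation_le_one]
      refine hxv.trans (hU.zpow_le_one.2 (by positivity))
    have h1 : (1 + x) ^ b - 1 = (∑ i ∈ Finset.range b', (1 + x ^ p) ^ i * 1 ^ (b' - 1 - i)) * x ^ p := by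
      have h2 := (Commute.all (1 + x ^ p) 1).geom_sum₂_mul b'
      rw [add_sub_cancel_left, one_pow] at h2
      rw [h2, hbdef, pow_mul, add_pow_char, one_pow]
    rw [h1, map_mul]
    have hle : v (x ^ p) ≤ v (s : F) ^ (N * (b + 1) : ℤ) := by
      rw [map_pow]
      refine (pow_le_pow_left' hxv p).trans ?_
      rw [← zpow_natCast, ← zpow_mul, hU.zpow_le_zpow]
      have hp : (2 : ℤ) ≤ p := by exact_mod_cast (Fact.out : p.Prime).two_le
      have hb1 : (1 : ℤ) ≤ b := by exact_mod_cast hb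
      have hN0 : 0 ≤ N := by positivity
      rw [mul_assoc]
      refine mul_le_mul_of_nonneg_left ?_ hN0
      nlinarith
    refine (mul_le_of_le_one_left' (valuation_le_one.2 (sum_mem fun i _ => ?_))).trans hle
    exact mul_mem (pow_mem (add_mem (one_mem _) (pow_mem hxO _)) _) (pow_mem (one_mem _) _)
  have heq : algebraMap k F c * u ^ b =
      (σ w - w) - (w + algebraMap k F c * u ^ b) * ((1 + x) ^ b - 1) := by
    have h1 : σ u = u * (1 + x) := by rw [hx]; field_simp; ring
    have h2 : σ f = f + algebraMap k F c := by rw [← hσf]; ring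
    have h3 : σ w = (f + algebraMap k F c) * (u * (1 + x)) ^ b := by
      rw [hw, map_mul, map_pow, h1, h2]
    rw [h3, hw, mul_pow]
    ring
  have hfinal : v (algebraMap k F c * u ^ b) ≤ v (s : F) ^ (N * (b + 1) : ℤ) := by
    rw [heq]
    refine Valuation.map_sub_le _ hσw ?_
    rw [map_mul]
    refine (mul_le_of_le_one_left' (valuation_le_one.2 ?_)).trans hη
    exact add_mem hwO (mul_mem (P.algebraMap_mem c) (pow_mem huO _))
  rw [map_mul, valuation_algebraMap P.algebraMap_mem hc, one_mul, map_pow, huv, ← zpow_natCast,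
    ← zpow_mul, hU.zpow_le_zpow] at hfinal
  have : 0 < N := by rw [hN]; exact_mod_cast hcard
  nlinarith

variable {x : F} (hx : IntermediateField.fixedField G = IntermediateField.adjoin k {x})
  (hxP : x ∉ P.ring)

include hx hxP

/-- Orders on k(x) are multiples of the order of 1/x, while the norm of the uniformizer is an
element of the same field of order |G|; so 1/x has order exactly |G|. -/
theorem valuation_generator :
    P.ring.valuation x = P.ring.valuation (s : F) ^ (-(Nat.card G : ℤ)) := by
  have hx0 : x ≠ 0 := by rintro rfl; exact hxP (zero_mem _)
  have hxK : x ∈ IntermediateField.fixedField G := by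
    rw [hx]; exact IntermediateField.mem_adjoin_simple_self k x
  obtain ⟨n, hn⟩ := exists_valuation_fixedField G hU hst hres hxK hx0
  obtain ⟨u, hu, huv⟩ := exists_uniformizer_pow_card G hU hst
  have hu0 : u ≠ 0 := by
    rintro rfl
    rw [map_zero] at huv
    exact zpow_ne_zero _ hU.val_pos.ne' huv.symm
  have hinv : P.ring.valuation x⁻¹ < 1 := by
    rw [valuation_lt_one_iff_inv (inv_ne_zero hx0), inv_inv]; exact hxP
  rw [hx, ← adjoin_inv] at hu
  obtain ⟨m, hm⟩ := exists_valuation_zpow P.algebraMap_mem hinv (inv_ne_zero hx0) hu hu0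
  rw [map_inv₀, hn, huv, ← zpow_neg, ← zpow_mul] at hm
  have h1 := hU.zpow_inj hm
  have hN : (0 : ℤ) < Nat.card G := by exact_mod_cast Nat.card_pos
  have h2 : (-n) * m = 1 := by
    have : (Nat.card G : ℤ) * ((-n) * m) = Nat.card G * 1 := by rw [mul_one]; linarith
    exact mul_left_cancel₀ hN.ne' this
  have hn0 : n ≤ 0 := by
    by_contra hpos
    apply hxP
    rw [← valuation_le_one, hn, hU.zpow_le_one]
    have : 0 < n := not_le.1 hpos
    positivity
  have h3 : n = -1 := by
    rcases Int.eq_one_or_neg_one_of_mul_eq_one h2 with h | h <;> omega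
  rw [hn, h3, mul_neg_one]

/-- The different of the cover at the totally ramified place: the order of `d x`, and `d s`
generates the regular differentials. -/
theorem D_generator_and_regular {δ : ℤ} [DecidableEq G]
    (hδ : ∏ σ ∈ Finset.univ.erase (1 : G), P.ring.valuation ((s : F) - (σ : F ≃ₐ[k] F) s) =
      P.ring.valuation (s : F) ^ δ) :
    (∃ h : F, P.ring.valuation h = P.ring.valuation (s : F) ^ (δ - 2 * Nat.card G) ∧
      KaehlerDifferential.D k F x = h • KaehlerDifferential.D k F (s : F)) ∧
    ∀ a ∈ P.ring, ∃ a' ∈ P.ring,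
      KaehlerDifferential.D k F a = a' • KaehlerDifferential.D k F (s : F) := by
  set v := P.ring.valuation with hv
  set N : ℤ := ((Nat.card G : ℕ) : ℤ) with hN
  have hN0 : 0 < N := by rw [hN]; exact_mod_cast Nat.card_pos
  have hx0 : x ≠ 0 := by rintro rfl; exact hxP (zero_mem _)
  have hxv : v x = v (s : F) ^ (-N) := valuation_generator hU hst hres hx hxP
  set u := x⁻¹ with hu
  have hu0 : u ≠ 0 := inv_ne_zero hx0
  have huv : v u = v (s : F) ^ N := by rw [hu, map_inv₀, hxv, zpow_neg, inv_inv]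
  have hu1 : v u < 1 := by
    rw [valuation_lt_one_iff_inv hu0, hu, inv_inv]; exact hxP
  have hK : IntermediateField.fixedField G = IntermediateField.adjoin k {u} := by
    rw [hx, hu, adjoin_inv]
  have hsO : (s : F) ∈ P.ring := s.2
  have hA : ∀ c ∈ IntermediateField.fixedField G, c ∈ P.ring →
      ∃ c' ∈ P.ring, KaehlerDifferential.D k F c = c' • KaehlerDifferential.D k F u := by
    intro c hc hcO
    rw [hK] at hc
    exact exists_D_eq_smul P.algebraMap_mem hu1 hu0 hc hcO
  set φ := groupPoly G (s : F) with hφ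
  have hconj : ∀ σ ∈ G, σ (s : F) ∈ P.ring := fun σ hσ => hst σ hσ _ hsO
  have hcK := groupPoly_coeff_mem_fixedField G (s : F)
  have hcO := groupPoly_coeff_mem (S := P.ring.toSubring) G hconj
  have hc0 : v (φ.coeff 0) = v (s : F) ^ N := by
    rw [hφ, groupPoly, coeff_zero_prod, map_prod]
    simp only [coeff_sub, coeff_X_zero, coeff_C_zero, zero_sub, Valuation.map_neg]
    rw [Finset.prod_congr rfl fun σ _ => hU.valuation_apply hst σ.2 _]
    simp [hN, hv]
  obtain ⟨w', hw'O, hw'⟩ := hA (φ.coeff 0 / u) (div_mem (hcK 0) (by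
    rw [hK]; exact IntermediateField.mem_adjoin_simple_self k u)) (by
    rw [← valuation_le_one, map_div₀, hc0, huv, div_self (zpow_ne_zero _ hU.val_pos.ne')])
  -- The constant coefficient is a unit times u, as for an Eisenstein polynomial, so its
  -- differential is a unit times du. Only this term survives modulo the maximal ideal when φ(s) = 0
  -- is differentiated; hence du is a unit multiple of φ'(s) ds, and φ'(s) has order δ.
  have hex : ∀ i, ∃ c' : F, KaehlerDifferential.D k F (φ.coeff i) =
      c' • KaehlerDifferential.D k F u ∧ c' ∈ P.ring ∧ (i = 0 → v c' = 1) := by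
    intro i
    by_cases hi : i = 0
    · subst hi
      have h1 : φ.coeff 0 = φ.coeff 0 / u * u := by field_simp
      have h2 : v (φ.coeff 0 / u + u * w') = 1 := by
        rw [Valuation.map_add_eq_of_lt_left, map_div₀, hc0, huv,
          div_self (zpow_ne_zero _ hU.val_pos.ne')]
        rw [map_div₀, hc0, huv, div_self (zpow_ne_zero _ hU.val_pos.ne'), map_mul]
        exact (mul_le_of_le_one_right' (valuation_le_one.2 hw'O)).trans_lt hu1
      refine ⟨φ.coeff 0 / u + u * w', ?_, valuation_le_one.1 h2.le, fun _ => h2⟩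
      conv_lhs => rw [h1]
      rw [Derivation.leibniz, hw', smul_smul, ← add_smul]
    · obtain ⟨c', h1, h2⟩ := hA (φ.coeff i) (hcK i) (hcO i)
      exact ⟨c', h2, h1, fun h => absurd h hi⟩
  choose c' hc' hc'O hc'0 using hex
  have h := D_eval (k := k) φ (s : F)
  rw [groupPoly_eval_self, map_zero] at h
  simp only [hc', smul_smul, ← Finset.sum_smul] at h
  set e := ∑ i ∈ Finset.range (φ.natDegree + 1), (s : F) ^ i * c' i with he
  have hev : v e = 1 := by
    rw [he, Finset.sum_range_succ', pow_zero, one_mul, Valuation.map_add_eq_of_lt_right, hc'0 0 rfl]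
    rw [hc'0 0 rfl]
    refine Valuation.map_sum_lt _ one_ne_zero fun i _ => ?_
    rw [pow_succ, mul_assoc, mul_comm (s : F), ← mul_assoc, map_mul]
    exact (mul_le_of_le_one_left' (valuation_le_one.2 (mul_mem (pow_mem hsO _) (hc'O _)))).trans_lt hU.2.1
  have he0 : e ≠ 0 := by
    intro h0
    rw [h0, map_zero] at hev
    exact zero_ne_one hev
  set d := φ.derivative.eval (s : F) with hd
  have hdv : v d = v (s : F) ^ δ := by
    rw [hd, hφ, groupPoly_derivative_eval, map_prod, hδ]
  have hDu : KaehlerDifferential.D k F u = (-(e⁻¹ * d)) • KaehlerDifferential.D k F (s : F) := by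
    rw [neg_smul, mul_smul, eq_neg_of_add_eq_zero_right h.symm, smul_neg, neg_neg, smul_smul,
      inv_mul_cancel₀ he0, one_smul]
  have hδ0 : 0 ≤ δ := by
    rw [← hU.zpow_le_one, ← hδ]
    refine Finset.prod_le_one' fun σ _ => valuation_le_one.2 (sub_mem hsO (hconj σ σ.2))
  have hEO : -(e⁻¹ * d) ∈ P.ring := by
    rw [← valuation_le_one, Valuation.map_neg, map_mul, map_inv₀, hev, hdv, inv_one, one_mul,
      hU.zpow_le_one]
    exact hδ0
  constructor
  · refine ⟨u⁻¹ ^ 2 * (e⁻¹ * d), ?_, ?_⟩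
    · rw [map_mul, map_pow, map_inv₀, huv, map_mul, map_inv₀, hev, hdv, inv_one, one_mul, inv_pow,
        ← zpow_natCast, ← zpow_mul, ← zpow_neg, ← zpow_add₀ hU.val_pos.ne']
      congr 1
      push_cast
      ring
    · have h1 : x = u⁻¹ := by rw [hu, inv_inv]
      conv_lhs => rw [h1]
      rw [Derivation.leibniz_inv, hDu, neg_smul, neg_smul, smul_neg, neg_neg, smul_smul]
  · intro a ha
    obtain ⟨c, hc, rfl⟩ := exists_coeffs G hU hst hres ha
    have hterm : ∀ j : Fin (Nat.card G), ∃ a' ∈ P.ring, KaehlerDifferential.D k F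
        (c j * (s : F) ^ (j : ℕ)) = a' • KaehlerDifferential.D k F (s : F) := by
      intro j
      obtain ⟨c', hc', h1⟩ := hA (c j) (hc j).1 (hc j).2
      refine ⟨c j * ((j : ℕ) * (s : F) ^ ((j : ℕ) - 1)) + (s : F) ^ (j : ℕ) * (c' * -(e⁻¹ * d)),
        add_mem (mul_mem (hc j).2 (mul_mem (natCast_mem _ _) (pow_mem hsO _)))
          (mul_mem (pow_mem hsO _) (mul_mem hc' hEO)), ?_⟩
      rw [Derivation.leibniz, Derivation.leibniz_pow, h1, hDu, ← Nat.cast_smul_eq_nsmul F, smul_smul,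
        smul_smul, smul_smul, smul_smul, ← add_smul]
      congr 1
      ring
    choose a' ha' h2 using hterm
    refine ⟨∑ j, a' j, sum_mem fun j _ => ha' j, ?_⟩
    rw [map_sum, Finset.sum_smul]
    exact Finset.sum_congr rfl fun j _ => h2 j

end AtP

end HKG

namespace HKG

/-! ### Telescopic numerical semigroups -/

section Telescopic

variable {r : ℕ} {q b e : ℕ → ℕ}

/-- The semigroup generated by `e 0` and the `e (l + 1) * b l`, through reduced representations. -/
def telescopic (r : ℕ) (q b e : ℕ → ℕ) : Set ℤ :=
  {n | ∃ (a : ℤ) (x : ℕ → ℕ), 0 ≤ a ∧ (∀ l < r, x l < q l) ∧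
    n = a * e 0 + ∑ l ∈ Finset.range r, (x l : ℤ) * (e (l + 1) * b l : ℕ)}

variable (he : ∀ l < r, e l = q l * e (l + 1)) (hcop : ∀ l < r, Nat.Coprime (q l) (b l))

include he

theorem telescopic_dvd {i j : ℕ} (hij : i ≤ j) (hj : j ≤ r) : e j ∣ e i := by
  induction j, hij using Nat.le_induction with
  | base => exact dvd_rfl
  | succ j hij ih =>
    refine dvd_trans ?_ (ih (by omega))
    rw [he j (by omega)]
    exact dvd_mul_left _ _

theorem telescopic_dvd_sum {j : ℕ} (hj : j ≤ r) (a : ℤ) (x : ℕ → ℕ) :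
    (e j : ℤ) ∣ a * e 0 + ∑ l ∈ Finset.range j, (x l : ℤ) * (e (l + 1) * b l : ℕ) := by
  refine dvd_add (dvd_mul_of_dvd_right ?_ _) (Finset.dvd_sum fun l hl => dvd_mul_of_dvd_right ?_ _)
  · exact_mod_cast telescopic_dvd he (Nat.zero_le j) hj
  · have := Finset.mem_range.1 hl
    exact_mod_cast dvd_mul_of_dvd_left (telescopic_dvd he (by omega) hj) _

include hcop

/-- Modulo e j only the last term is visible, and coprimality of q j and b j determines its digit
modulo q j; then descend. -/
theorem telescopic_unique (hpos : ∀ l ≤ r, 0 < e l) {j : ℕ} (hj : j ≤ r) {a a' : ℤ}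
    {x y : ℕ → ℕ} (hx : ∀ l < j, x l < q l) (hy : ∀ l < j, y l < q l)
    (h : a * e 0 + ∑ l ∈ Finset.range j, (x l : ℤ) * (e (l + 1) * b l : ℕ) =
      a' * e 0 + ∑ l ∈ Finset.range j, (y l : ℤ) * (e (l + 1) * b l : ℕ)) :
    a = a' ∧ ∀ l < j, x l = y l := by
  induction j with
  | zero =>
    have h0 : (e 0 : ℤ) ≠ 0 := by exact_mod_cast (hpos 0 (Nat.zero_le r)).ne'
    simp only [Finset.range_zero, Finset.sum_empty, add_zero] at h
    exact ⟨mul_right_cancel₀ h0 h, by simp⟩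
  | succ j ih =>
    rw [Finset.sum_range_succ, Finset.sum_range_succ, ← add_assoc, ← add_assoc] at h
    have h1 := telescopic_dvd_sum (b := b) he (show j ≤ r by omega) a x
    have h2 := telescopic_dvd_sum (b := b) he (show j ≤ r by omega) a' y
    have h3 : (e j : ℤ) ∣ ((y j : ℤ) - x j) * (e (j + 1) * b j : ℕ) := by
      have := dvd_sub h1 h2
      rwa [show a * (e 0 : ℤ) + ∑ l ∈ Finset.range j, (x l : ℤ) * (e (l + 1) * b l : ℕ) -
        (a' * e 0 + ∑ l ∈ Finset.range j, (y l : ℤ) * (e (l + 1) * b l : ℕ)) =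
        ((y j : ℤ) - x j) * (e (j + 1) * b j : ℕ) by linear_combination h] at this
    rw [he j (by omega)] at h3
    push_cast at h3
    have h4 : (e (j + 1) : ℤ) ≠ 0 := by exact_mod_cast (hpos (j + 1) hj).ne'
    have h5 : (q j : ℤ) ∣ ((y j : ℤ) - x j) * b j := by
      rw [← mul_dvd_mul_iff_right h4]
      rwa [mul_assoc, mul_comm (b j : ℤ)]
    have h6 : (q j : ℤ) ∣ (y j : ℤ) - x j :=
      IsCoprime.dvd_of_dvd_mul_right (Nat.isCoprime_iff_coprime.2 (hcop j (by omega))) h5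
    have hxy : x j = y j := by
      have hxj := hx j (Nat.lt_succ_self j)
      have hyj := hy j (Nat.lt_succ_self j)
      have := Int.eq_zero_of_abs_lt_dvd h6 (by rw [abs_lt]; constructor <;> omega)
      omega
    rw [hxy] at h
    obtain ⟨h7, h8⟩ := ih (by omega) (fun l hl => hx l (by omega)) (fun l hl => hy l (by omega))
      (add_right_cancel h)
    refine ⟨h7, fun l hl => ?_⟩
    rcases Nat.lt_succ_iff_lt_or_eq.1 hl with h | rfl
    · exact h8 l h
    · exact hxy

theorem telescopic_exists (hq : ∀ l < r, 0 < q l) {j : ℕ} (hj : j ≤ r) {n : ℤ}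
    (hn : (e j : ℤ) ∣ n) : ∃ (a : ℤ) (x : ℕ → ℕ), (∀ l < j, x l < q l) ∧
      n = a * e 0 + ∑ l ∈ Finset.range j, (x l : ℤ) * (e (l + 1) * b l : ℕ) := by
  induction j generalizing n with
  | zero =>
    obtain ⟨a, ha⟩ := hn
    exact ⟨a, 0, by simp, by simp [ha, mul_comm]⟩
  | succ j ih =>
    obtain ⟨n', rfl⟩ := hn
    have hqj : 0 < q j := hq j (by omega)
    obtain ⟨u, w, huw⟩ := Nat.isCoprime_iff_coprime.2 (hcop j (by omega))
    -- The number w inverts b j modulo q j, so this digit makes n' - y * b j divisible by q j.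
    set y : ℤ := (n' * w) % q j with hy
    have hy0 : 0 ≤ y := Int.emod_nonneg _ (by omega)
    have hylt : y < q j := Int.emod_lt_of_pos _ (by omega)
    have hdvd : (q j : ℤ) ∣ n' - y * b j := by
      have h1 : (q j : ℤ) ∣ n' * w - y := Int.dvd_self_sub_emod
      have h2 : n' - y * b j = n' * u * q j + (n' * w - y) * b j := by
        linear_combination (-n') * huw
      rw [h2]
      exact dvd_add (dvd_mul_left _ _) (dvd_mul_of_dvd_left h1 _)
    obtain ⟨n'', hn''⟩ := hdvd
    obtain ⟨a, x, hx, hax⟩ := ih (n := (e (j + 1) : ℤ) * (n' - y * b j)) (by omega) (by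
      rw [hn'', he j (by omega)]
      exact ⟨n'', by push_cast; ring⟩)
    refine ⟨a, fun l => if l = j then y.toNat else x l, ?_, ?_⟩
    · intro l hl
      dsimp only
      split_ifs with h
      · subst h; omega
      · exact hx l (by omega)
    · rw [Finset.sum_range_succ, ← add_assoc]
      have : ∑ l ∈ Finset.range j, ((if l = j then y.toNat else x l : ℕ) : ℤ) * (e (l + 1) * b l : ℕ) =
          ∑ l ∈ Finset.range j, (x l : ℤ) * (e (l + 1) * b l : ℕ) := by
        refine Finset.sum_congr rfl fun l hl => ?_
        rw [if_neg (Finset.mem_range.1 hl).ne]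
      rw [this, ← hax]
      simp only [if_true]
      rw [Int.toNat_of_nonneg hy0]
      push_cast
      ring

variable (hr : e r = 1) (hq : ∀ l < r, 0 < q l)

include hr hq

omit hcop in
theorem telescopic_pos {l : ℕ} (hl : l ≤ r) : 0 < e l := by
  have := telescopic_dvd he hl le_rfl
  by_contra h0
  have h1 : e l = 0 := by omega
  induction l with
  | zero =>
    have : ∀ j ≤ r, 0 < e (r - j) := by
      intro j
      induction j with
      | zero => intro _; rw [Nat.sub_zero, hr]; exact one_pos
      | succ j ih =>
        intro hj
        rw [he (r - (j + 1)) (by omega), show r - (j + 1) + 1 = r - j by omega]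
        exact Nat.mul_pos (hq _ (by omega)) (ih (by omega))
    have := this r le_rfl
    rw [Nat.sub_self] at this
    omega
  | succ l ih =>
    refine ih (by omega) (telescopic_dvd he (by omega) le_rfl) ?_ ?_ <;>
    · rw [he l (by omega), h1]; simp

/-- A telescopic semigroup is symmetric. -/
theorem telescopic_symm (n : ℤ) : n ∈ telescopic r q b e ↔
    (∑ l ∈ Finset.range r, ((q l : ℤ) - 1) * (e (l + 1) * b l : ℕ) - e 0) - n ∉
      telescopic r q b e := by
  have hpos : ∀ l ≤ r, 0 < e l := fun l hl => telescopic_pos he hr hq hl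
  have key : ∀ (n a : ℤ) (x : ℕ → ℕ), (∀ l < r, x l < q l) →
      n = a * e 0 + ∑ l ∈ Finset.range r, (x l : ℤ) * (e (l + 1) * b l : ℕ) →
      (n ∈ telescopic r q b e ↔ 0 ≤ a) := by
    intro n a x hx hn
    constructor
    · rintro ⟨a', x', ha', hx', hn'⟩
      rw [(telescopic_unique he hcop hpos le_rfl hx hx' (hn.symm.trans hn')).1]
      exact ha'
    · intro ha
      exact ⟨a, x, ha, hx, hn⟩
  obtain ⟨a, x, hx, hn⟩ := telescopic_exists he hcop hq le_rfl (n := n) (by rw [hr]; simp)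
  -- Reflection complements each digit and sends a to -1 - a; exactly one of a and -1 - a is
  -- nonnegative.
  rw [key n a x hx hn, key _ (-1 - a) (fun l => q l - 1 - x l) (fun l hl => by
    have := hq l hl
    omega)]
  · omega
  · rw [hn]
    have : ∑ l ∈ Finset.range r, ((q l - 1 - x l : ℕ) : ℤ) * (e (l + 1) * b l : ℕ) =
        ∑ l ∈ Finset.range r, (((q l : ℤ) - 1) * (e (l + 1) * b l : ℕ) -
          (x l : ℤ) * (e (l + 1) * b l : ℕ)) := by
      refine Finset.sum_congr rfl fun l hl => ?_
      have := hx l (Finset.mem_range.1 hl)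
      rw [Nat.cast_sub (by omega), Nat.cast_sub (by omega)]
      push_cast
      ring
    rw [this, Finset.sum_sub_distrib]
    ring

omit he hcop hr in
theorem zero_mem_telescopic : (0 : ℤ) ∈ telescopic r q b e :=
  ⟨0, 0, le_rfl, hq, by simp⟩

open Classical in
/-- The number of elements below the conductor. -/
theorem telescopic_card {d : ℤ} (hd : d + 1 = ∑ l ∈ Finset.range r, ((q l : ℤ) - 1) *
    (e (l + 1) * b l : ℕ) - e 0) (hd0 : -2 ≤ d) :
    (2 * ((Finset.Icc 0 d).filter (· ∈ telescopic r q b e)).card : ℤ) = d + 2 := by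
  have hsymm : ∀ n, n ∈ telescopic r q b e ↔ d + 1 - n ∉ telescopic r q b e := by
    intro n
    rw [hd]
    exact telescopic_symm he hcop hr hq n
  -- The number d + 1 is a gap, being the reflection of 0. Adding it makes the interval symmetric,
  -- and exactly half of its d + 2 integers belong to the semigroup.
  have h1 : (Finset.Icc 0 d).filter (· ∈ telescopic r q b e) =
      (Finset.Icc 0 (d + 1)).filter (· ∈ telescopic r q b e) := by
    ext n
    simp only [Finset.mem_filter, Finset.mem_Icc]
    constructor
    · rintro ⟨⟨h1, h2⟩, h3⟩
      exact ⟨⟨h1, by omega⟩, h3⟩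
    · rintro ⟨⟨h1, h2⟩, h3⟩
      refine ⟨⟨h1, ?_⟩, h3⟩
      by_contra h4
      have h5 : n = d + 1 := by omega
      rw [hsymm, h5, sub_self] at h3
      exact h3 (zero_mem_telescopic hq)
  have h2 : ((Finset.Icc 0 (d + 1)).filter (· ∈ telescopic r q b e)).card =
      ((Finset.Icc 0 (d + 1)).filter (· ∉ telescopic r q b e)).card := by
    refine Finset.card_bij' (fun n _ => d + 1 - n) (fun n _ => d + 1 - n) ?_ ?_ ?_ ?_
    · intro n hn
      simp only [Finset.mem_filter, Finset.mem_Icc] at hn ⊢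
      exact ⟨by omega, (hsymm n).1 hn.2⟩
    · intro n hn
      simp only [Finset.mem_filter, Finset.mem_Icc] at hn ⊢
      refine ⟨by omega, ?_⟩
      rw [hsymm]
      rw [show d + 1 - (d + 1 - n) = n by ring]
      exact hn.2
    · intro n _; ring
    · intro n _; ring
  have h3 := Finset.card_filter_add_card_filter_not (s := Finset.Icc 0 (d + 1))
    (fun n => n ∈ telescopic r q b e)
  rw [Int.card_Icc, ← h2, ← h1] at h3
  omega

end Telescopic

/-! ### Inequalities between the pole orders and the degree d of the canonical divisor -/

section Estimates

variable {r : ℕ} {q b e : ℕ → ℕ}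
  (he : ∀ l < r, e l = q l * e (l + 1)) (hcop : ∀ l < r, Nat.Coprime (q l) (b l))
  (hr : e r = 1) (hq : ∀ l < r, 2 ≤ q l)
  (h0 : 0 < r) (hq0 : 4 ≤ q 0) (hb0 : 4 ≤ b 0)
  {d : ℤ} (hd : d + 1 = ∑ l ∈ Finset.range r, ((q l : ℤ) - 1) * (e (l + 1) * b l : ℕ) - e 0)

include hq hd in
theorem sum_subset_le {s : Finset ℕ} (hs : s ⊆ Finset.range r) :
    ∑ l ∈ s, ((q l : ℤ) - 1) * (e (l + 1) * b l : ℕ) ≤ d + 1 + e 0 := by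
  rw [hd, sub_add_cancel]
  refine Finset.sum_le_sum_of_subset_of_nonneg hs fun l hl _ => ?_
  have := hq l (Finset.mem_range.1 hl)
  exact mul_nonneg (by omega) (by positivity)

include he hcop hr hq h0 hq0 hb0 hd

/-- For i = 0 the claim reduces to (q₀ - 2)(b₀ - 2) ≥ 6, where q₀ = b₀ = 4 is excluded by
coprimality. For i > 0 the i-th summand of d, doubled, covers the pole order, and the summand of the
lowest step pays for the subtracted terms. -/
theorem pole_le_two_mul {i : ℕ} (hi : i < r) : (q i * (e (i + 1) * b i) : ℤ) ≤ 2 * d := by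
  have hE : (1 : ℤ) ≤ e 1 := by
    exact_mod_cast telescopic_pos he hr (fun l hl => by have := hq l hl; omega)
      (show 1 ≤ r from h0)
  have hN : (e 0 : ℤ) = q 0 * e 1 := by exact_mod_cast he 0 h0
  have hq0' : (4 : ℤ) ≤ q 0 := by exact_mod_cast hq0
  have hb0' : (4 : ℤ) ≤ b 0 := by exact_mod_cast hb0
  rcases Nat.eq_zero_or_pos i with rfl | hpos
  · have h1 := sum_subset_le (s := {0}) (b := b) hq hd (by simpa using h0)
    rw [Finset.sum_singleton, zero_add, hN] at h1
    push_cast at h1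
    have h2 : (6 : ℤ) ≤ (q 0 - 2) * (b 0 - 2) := by
      by_cases h : 5 ≤ q 0
      · have : (5 : ℤ) ≤ q 0 := by exact_mod_cast h
        nlinarith
      · have hq4 : q 0 = 4 := by omega
        have : (5 : ℤ) ≤ b 0 := by
          by_contra hb
          have hb4 : b 0 = 4 := by omega
          have := hcop 0 h0
          rw [hq4, hb4] at this
          norm_num at this
        rw [hq4]
        push_cast
        linarith
    rw [zero_add]
    nlinarith
  · have h1 := sum_subset_le (s := {0, i}) (b := b) hq hd (by
      intro l hl
      simp only [Finset.mem_insert, Finset.mem_singleton] at hl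
      rw [Finset.mem_range]
      omega)
    rw [Finset.sum_pair (by omega), zero_add, hN] at h1
    push_cast at h1
    have hqi : (2 : ℤ) ≤ q i := by exact_mod_cast hq i hi
    have hm : (0 : ℤ) ≤ e (i + 1) * b i := by positivity
    have h2 : (q i * (e (i + 1) * b i) : ℤ) ≤ 2 * ((q i - 1) * (e (i + 1) * b i)) := by nlinarith
    have h3 : (2 : ℤ) ≤ 2 * ((q 0 - 1) * (e 1 * b 0)) - 2 * (q 0 * e 1) := by
      have : (2 : ℤ) ≤ 2 * (q 0 - 1) * b 0 - 2 * q 0 := by nlinarith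
      nlinarith
    linarith

omit hcop in
/-- The slack needed for splitting monomials greedily, in the later steps. -/
theorem pole_add_le {i : ℕ} (hi : i < r) (hpos : 0 < i) :
    (q i * (e (i + 1) * b i) : ℤ) + e 0 ≤ 2 * d + 1 ∧
    ∀ ν < i, (q i * (e (i + 1) * b i) : ℤ) + e (ν + 1) * b ν ≤ 2 * d + 1 := by
  have hE : (1 : ℤ) ≤ e 1 := by
    exact_mod_cast telescopic_pos he hr (fun l hl => by have := hq l hl; omega)
      (show 1 ≤ r from h0)
  have hN : (e 0 : ℤ) = q 0 * e 1 := by exact_mod_cast he 0 h0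
  have hq0' : (4 : ℤ) ≤ q 0 := by exact_mod_cast hq0
  have hb0' : (4 : ℤ) ≤ b 0 := by exact_mod_cast hb0
  have h1 := sum_subset_le (s := {0, i}) (b := b) hq hd (by
    intro l hl
    simp only [Finset.mem_insert, Finset.mem_singleton] at hl
    rw [Finset.mem_range]
    omega)
  rw [Finset.sum_pair (by omega), zero_add, hN] at h1
  push_cast at h1
  have half : ∀ l < r, (q l * (e (l + 1) * b l) : ℤ) ≤ 2 * ((q l - 1) * (e (l + 1) * b l)) := by
    intro l hl
    have hql : (2 : ℤ) ≤ q l := by exact_mod_cast hq l hl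
    have hm : (0 : ℤ) ≤ e (l + 1) * b l := by positivity
    nlinarith
  have h2 := half i hi
  have hqb : (16 : ℤ) ≤ q 0 * b 0 := by nlinarith
  refine ⟨?_, fun ν hν => ?_⟩
  · rw [hN]
    have h3 : (1 : ℤ) ≤ e 1 * (2 * (q 0 - 1) * b 0 - 3 * q 0) := by
      have : (1 : ℤ) ≤ 2 * (q 0 - 1) * b 0 - 3 * q 0 := by nlinarith
      nlinarith
    linarith
  · rcases Nat.eq_zero_or_pos ν with rfl | hν0
    · have h3 : (1 : ℤ) ≤ e 1 * ((2 * q 0 - 3) * b 0 - 2 * q 0) := by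
        have : (1 : ℤ) ≤ (2 * q 0 - 3) * b 0 - 2 * q 0 := by nlinarith
        nlinarith
      rw [zero_add]
      linarith
    · have h4 := sum_subset_le (s := {0, ν, i}) (b := b) hq hd (by
        intro l hl
        simp only [Finset.mem_insert, Finset.mem_singleton] at hl
        rw [Finset.mem_range]
        omega)
      rw [Finset.sum_insert (by simp; omega), Finset.sum_pair (by omega), zero_add, hN] at h4
      push_cast at h4
      have h5 := half ν (by omega)
      have h6 : (e (ν + 1) * b ν : ℤ) ≤ q ν * (e (ν + 1) * b ν) := by
        have hqν : (2 : ℤ) ≤ q ν := by exact_mod_cast hq ν (by omega)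
        have hm : (0 : ℤ) ≤ e (ν + 1) * b ν := by positivity
        nlinarith
      have h3 : (1 : ℤ) ≤ e 1 * (2 * (q 0 - 1) * b 0 - 2 * q 0) := by
        have : (1 : ℤ) ≤ 2 * (q 0 - 1) * b 0 - 2 * q 0 := by nlinarith
        nlinarith
      linarith

/-- The slack needed for splitting a power of the first generator; the exception is the smooth
plane quintic. -/
theorem half_le (hb : ∀ l, 0 < l → l < r → 5 ≤ b l) (hexc : ¬ (r = 1 ∧ q 0 = 4 ∧ b 0 = 5)) :
    (e 0 * ((b 0 + 1) / 2 : ℕ) : ℤ) ≤ d := by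
  have hE : (1 : ℤ) ≤ e 1 := by
    exact_mod_cast telescopic_pos he hr (fun l hl => by have := hq l hl; omega)
      (show 1 ≤ r from h0)
  have hN : (e 0 : ℤ) = q 0 * e 1 := by exact_mod_cast he 0 h0
  have hq0' : (4 : ℤ) ≤ q 0 := by exact_mod_cast hq0
  have hb0' : (4 : ℤ) ≤ b 0 := by exact_mod_cast hb0
  have h1 := sum_subset_le (s := {0}) (b := b) hq hd (by simpa using h0)
  rw [Finset.sum_singleton, zero_add, hN] at h1
  push_cast at h1
  rw [hN]
  have hco := hcop 0 h0
  have hc : (((b 0 + 1) / 2 : ℕ) : ℤ) * 2 ≤ b 0 + 1 := by omega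
  set c : ℤ := (((b 0 + 1) / 2 : ℕ) : ℤ) with hcdef
  rcases Nat.even_or_odd (b 0) with hev | hodd
  · have hc' : c * 2 = b 0 := by
      obtain ⟨b', hb'⟩ := hev
      omega
    have h2 : (6 : ℤ) ≤ (q 0 - 2) * (b 0 - 2) := by
      have : (5 : ℤ) ≤ q 0 := by
        by_contra h
        have hq4 : q 0 = 4 := by omega
        rw [hq4] at hco
        obtain ⟨b', hb'⟩ := hev
        have h2 : 2 ∣ Nat.gcd 4 (b 0) := Nat.dvd_gcd (by norm_num) ⟨b', by omega⟩
        rw [hco] at h2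
        norm_num at h2
      nlinarith
    nlinarith
  · have hb5 : 5 ≤ b 0 := by
      obtain ⟨b', hb'⟩ := hodd
      omega
    -- For odd b₀ this inequality is what the lowest step alone requires. It fails only at (4, 5),
    -- the pair (5, 5) not being coprime; if there is a second step, its contribution to d closes
    -- the gap.
    by_cases hbig : (8 : ℤ) ≤ (q 0 - 2) * (b 0 - 3)
    · nlinarith
    · have h45 : q 0 = 4 ∧ b 0 = 5 := by
        have h5 : (5 : ℤ) ≤ b 0 := by exact_mod_cast hb5
        have hq5 : (q 0 : ℤ) ≤ 5 := by
          by_contra h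
          apply hbig
          nlinarith
        have hb6 : (b 0 : ℤ) ≤ 6 := by
          by_contra h
          apply hbig
          nlinarith
        have hb : b 0 = 5 := by
          obtain ⟨b', hb'⟩ := hodd
          omega
        refine ⟨?_, hb⟩
        by_contra h
        have : q 0 = 5 := by omega
        rw [this, hb] at hco
        norm_num at hco
      have hr1 : 1 < r := by
        by_contra h
        exact hexc ⟨by omega, h45⟩
      have h4 := sum_subset_le (s := {0, 1}) (b := b) hq hd (by
        intro l hl
        simp only [Finset.mem_insert, Finset.mem_singleton] at hl
        rw [Finset.mem_range]
        omega)
      rw [Finset.sum_pair (by omega), zero_add, hN, h45.1, h45.2] at h4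
      push_cast at h4
      have hE1 : (e 1 : ℤ) = q 1 * e 2 := by exact_mod_cast he 1 hr1
      have hE2 : (1 : ℤ) ≤ e 2 := by
        exact_mod_cast telescopic_pos he hr (fun l hl => by have := hq l hl; omega)
          (show 2 ≤ r from hr1)
      have hq1 : (2 : ℤ) ≤ q 1 := by exact_mod_cast hq 1 hr1
      have hb1 : (5 : ℤ) ≤ b 1 := by exact_mod_cast hb 1 one_pos hr1
      rw [h45.2] at hcdef
      norm_num at hcdef
      rw [h45.1, hcdef]
      push_cast
      have h6 : ((q 1 - 1) * e 2 * 5 : ℤ) ≤ (q 1 - 1) * (e (1 + 1) * b 1) := by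
        rw [show (1 + 1 : ℕ) = 2 from rfl, mul_assoc]
        have h7 : (0 : ℤ) ≤ (q 1 - 1) * e 2 := by nlinarith
        nlinarith
      nlinarith

end Estimates

end HKG

namespace HKG
open Polynomial

/-! ### Functions that are regular outside one place -/

section PolynomialRing

variable {k F : Type*} [Field k] [Field F] [Algebra k F]

-- The ring k[t] is a polynomial ring, hence integrally closed in its fraction field k(t).
open scoped IntermediateField.algebraAdjoinAdjoin in
theorem exists_aeval_of_isIntegral {t y : F} (ht : Transcendental k t)
    (hy : y ∈ IntermediateField.adjoin k {t}) (hint : IsIntegral (Algebra.adjoin k {t}) y) :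
    ∃ A : k[X], aeval t A = y := by
  have : IsIntegrallyClosed (Algebra.adjoin k {t}) :=
    IsIntegrallyClosed.of_equiv (algEquivOfTranscendental k t ht).toRingEquiv
  have h1 : IsIntegral (Algebra.adjoin k {t}) (⟨y, hy⟩ : IntermediateField.adjoin k {t}) := by
    refine (isIntegral_algebraMap_iff (B := F)
      (FaithfulSMul.algebraMap_injective (IntermediateField.adjoin k {t}) F)).1 ?_
    exact hint
  obtain ⟨⟨z, hz⟩, h2⟩ := IsIntegrallyClosed.isIntegral_iff.1 h1
  rw [Algebra.adjoin_singleton_eq_range_aeval] at hz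
  obtain ⟨A, hA⟩ := hz
  exact ⟨A, hA.trans (congrArg Subtype.val h2)⟩

/-- If `y` lies in every place that contains `t`, then it is integral over `k[t]`. -/
theorem isIntegral_of_forall_place {t y : F}
    (h : ∀ Q : Place k F, t ∈ Q.ring → y ∈ Q.ring) : IsIntegral (Algebra.adjoin k {t}) y := by
  by_contra hy
  -- The integral closure of k[t] is the intersection of the valuation rings containing it; one that
  -- omits y is not all of F, so it is a place.
  have h1 : y ∉ (⨅ V : {V : ValuationSubring F //
      ((Algebra.adjoin k {t} : Subalgebra k F) : Set F) ⊆ V.toSubring}, V.1.toSubring) := by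
    rw [iInf_valuationSubring_superset]
    intro h2
    apply hy
    have h3 : IsIntegral (Subring.closure ((Algebra.adjoin k {t} : Subalgebra k F) : Set F)) y := h2
    have h4 : Subring.closure ((Algebra.adjoin k {t} : Subalgebra k F) : Set F) =
      (Algebra.adjoin k {t}).toSubring := Subring.closure_eq (Algebra.adjoin k {t}).toSubring
    obtain ⟨p, hp, hpy⟩ := h3
    refine ⟨p.map (Subring.inclusion h4.le), hp.map _, ?_⟩
    rw [eval₂_map]
    exact hpy
  rw [Subring.mem_iInf] at h1
  push Not at h1
  obtain ⟨⟨V, hV⟩, hyV⟩ := h1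
  refine hyV (h ⟨V, fun c => hV (Subalgebra.algebraMap_mem _ c), ?_⟩
    (hV (Algebra.subset_adjoin rfl)))
  rintro rfl
  exact hyV trivial

/-- A nonconstant function has a zero: otherwise t⁻¹ would be integral over k[t], hence a polynomial
in t. -/
theorem exists_place_inv_notMem {t : F} (ht : Transcendental k t) :
    ∃ Q : Place k F, t ∈ Q.ring ∧ t⁻¹ ∉ Q.ring := by
  by_contra! h
  obtain ⟨A, hA⟩ := exists_aeval_of_isIntegral ht
    (inv_mem (IntermediateField.mem_adjoin_simple_self k t)) (isIntegral_of_forall_place h)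
  have ht0 : t ≠ 0 := fun h0 => ht (h0 ▸ isAlgebraic_zero)
  have h1 : aeval t (X * A - 1) = 0 := by
    rw [map_sub, map_mul, aeval_X, hA, map_one, mul_inv_cancel₀ ht0, sub_self]
  have h2 := congrArg (eval 0) ((transcendental_iff.1 ht) _ h1)
  simp at h2

theorem exists_aeval_of_forall_place {t y : F} (ht : Transcendental k t)
    (hy : y ∈ IntermediateField.adjoin k {t})
    (h : ∀ Q : Place k F, t ∈ Q.ring → y ∈ Q.ring) : ∃ A : k[X], aeval t A = y :=
  exists_aeval_of_isIntegral ht hy (isIntegral_of_forall_place h)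

end PolynomialRing

section RegularOutside

variable {k F : Type*} [Field k] [Field F] [Algebra k F]

theorem Place.ext_ring {Q Q' : Place k F} (h : Q.ring = Q'.ring) : Q = Q' := by
  cases Q; cases Q'; cases h; rfl

/-- The ring of functions that are regular outside `P`. -/
def regularOutside (P : Place k F) : Subring F :=
  ⨅ Q : {Q : Place k F // Q ≠ P}, Q.1.ring.toSubring

theorem mem_regularOutside {P : Place k F} {y : F} :
    y ∈ regularOutside P ↔ ∀ Q : Place k F, Q ≠ P → y ∈ Q.ring := by
  simp only [regularOutside, Subring.mem_iInf, Subtype.forall]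
  rfl

theorem algebraMap_mem_regularOutside (P : Place k F) (c : k) :
    algebraMap k F c ∈ regularOutside P :=
  mem_regularOutside.2 fun Q _ => Q.algebraMap_mem c

/-- The place `σ⁻¹ Q`. -/
def Place.comap (Q : Place k F) (σ : F ≃ₐ[k] F) : Place k F where
  ring := Q.ring.comap (σ : F →+* F)
  algebraMap_mem c := by
    rw [ValuationSubring.mem_comap]
    simpa using Q.algebraMap_mem c
  ne_top h := Q.ne_top (by
    rw [eq_top_iff]
    intro z _
    have : σ.symm z ∈ Q.ring.comap (σ : F →+* F) := h ▸ trivial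
    simpa using this)

/-- The group permutes the places and fixes P, so it permutes the others. -/
theorem map_mem_regularOutside {P : Place k F} {G : Subgroup (F ≃ₐ[k] F)}
    (hst : ∀ σ ∈ G, ∀ y ∈ P.ring, σ y ∈ P.ring) {σ : F ≃ₐ[k] F} (hσ : σ ∈ G) {y : F}
    (hy : y ∈ regularOutside P) : σ y ∈ regularOutside P := by
  rw [mem_regularOutside] at hy ⊢
  intro Q hQ
  refine hy (Q.comap σ) fun h => hQ ?_
  have hmem : ∀ z, σ z ∈ Q.ring ↔ z ∈ P.ring := fun z => by rw [← h]; rfl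
  refine Place.ext_ring (SetLike.ext fun z => ?_)
  have h1 : σ (σ⁻¹ z) = z := by rw [← AlgEquiv.mul_apply, mul_inv_cancel, AlgEquiv.one_apply]
  rw [← h1, hmem]
  constructor
  · intro h2
    exact hst σ hσ _ h2
  · intro h2
    have := hst σ⁻¹ (inv_mem hσ) _ h2
    rw [h1] at this
    exact this

variable [IsAlgClosed k]

/-- A totally ramified cover of the line has only one place above infinity. -/
theorem generator_mem_regularOutside {G : Subgroup (F ≃ₐ[k] F)} [Fintype G] {P : Place k F}
    (htr : TrdegLeOne k F) (hst : ∀ σ ∈ G, ∀ y ∈ P.ring, σ y ∈ P.ring) {x : F}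
    (hx : IntermediateField.fixedField G = IntermediateField.adjoin k {x}) (hxP : x ∉ P.ring) :
    x ∈ regularOutside P := by
  rw [mem_regularOutside]
  intro Q hQ
  by_contra hxQ
  have hx0 : x ≠ 0 := by rintro rfl; exact hxP (zero_mem _)
  have hP : P.ring.valuation x⁻¹ < 1 := by
    rw [valuation_lt_one_iff_inv (inv_ne_zero hx0), inv_inv]; exact hxP
  have hQ1 : Q.ring.valuation x⁻¹ < 1 := by
    rw [valuation_lt_one_iff_inv (inv_ne_zero hx0), inv_inv]; exact hxQ
  -- Elements of k(x) regular where 1/x vanishes at P are regular at Q as well. A function regular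
  -- at P is a root of its characteristic polynomial, whose coefficients are of this kind; so the
  -- ring of P lies in that of Q.
  refine hQ (Place.ext_ring (eq_of_le_of_ne_top htr P.algebraMap_mem ?_ Q.ne_top).symm)
  intro y hy
  refine mem_of_monic_root Q.ring (groupPoly_monic G y) (fun n => ?_) (groupPoly_eval_self G y)
  have h1 := groupPoly_coeff_mem_fixedField G y n
  have h2 : (groupPoly G y).coeff n ∈ P.ring :=
    groupPoly_coeff_mem G (S := P.ring.toSubring) (fun σ hσ => hst σ hσ y hy) n
  rw [hx, ← adjoin_inv] at h1
  obtain ⟨A, B, hB, hAB⟩ := exists_div_of_mem P.algebraMap_mem hP (inv_ne_zero hx0) h1 h2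
  rw [hAB, ← valuation_le_one, map_div₀, valuation_aeval_of_eval_zero Q.algebraMap_mem hQ1 hB,
    div_one, valuation_le_one]
  exact eval_map_mem (O := Q.ring.toSubring) Q.algebraMap_mem
    (mem_of_valuation_lt_one hQ1) A

omit [IsAlgClosed k] in
theorem exists_aeval_of_mem_regularOutside {P : Place k F} {x y : F} (hx : Transcendental k x)
    (hxP : x ∉ P.ring) (hy : y ∈ IntermediateField.adjoin k {x}) (hyR : y ∈ regularOutside P) :
    ∃ A : k[X], aeval x A = y :=
  exists_aeval_of_forall_place hx hy fun Q hQ =>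
    mem_regularOutside.1 hyR Q (by rintro rfl; exact hxP hQ)

end RegularOutside

/-! ### Interpolation over the conjugates of an Artin–Schreier generator -/

section Interpolation

variable {k F : Type*} [Field k] [Field F] [Algebra k F]

/-- If the conjugates of `f` differ from `f` by constants, functions in a ring `R` fixed by the
stabilizer of `f` are polynomials in `f` with invariant coefficients in `R`. -/
theorem exists_poly_of_translates (H : Subgroup (F ≃ₐ[k] F)) [Fintype H] {R : Subring F}
    (hkR : ∀ c : k, algebraMap k F c ∈ R) (hHR : ∀ σ ∈ H, ∀ y ∈ R, σ y ∈ R) {f y : F}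
    (hf : f ∈ R) (hy : y ∈ R) (hfy : ∀ σ ∈ H, σ f = f → σ y = y)
    (htrans : ∀ σ ∈ H, ∃ c : k, σ f = f + algebraMap k F c)
    {p : F[X]} (hp0 : p ≠ 0) (hp : ∀ σ ∈ H, p.eval (σ f) = 0) :
    ∃ L : F[X], L.degree < p.natDegree ∧
      (∀ n, L.coeff n ∈ R ∧ L.coeff n ∈ IntermediateField.fixedField H) ∧ L.eval f = y := by
  classical
  set S : Finset F := Finset.univ.image fun σ : H => (σ : F ≃ₐ[k] F) f with hS
  have hmemS : ∀ σ ∈ H, σ f ∈ S := fun σ hσ => Finset.mem_image.2 ⟨⟨σ, hσ⟩, Finset.mem_univ _, rfl⟩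
  have hSmem : ∀ s ∈ S, ∃ σ ∈ H, σ f = s := fun s hs => by
    obtain ⟨σ, -, h⟩ := Finset.mem_image.1 hs
    exact ⟨σ, σ.2, h⟩
  have hval : ∀ s : F, ∃ z : F, ∀ σ ∈ H, σ f = s → σ y = z := by
    intro s
    by_cases hs : ∃ τ ∈ H, τ f = s
    · obtain ⟨τ, hτ, rfl⟩ := hs
      refine ⟨τ y, fun σ hσ h => ?_⟩
      have h1 := hfy (τ⁻¹ * σ) (mul_mem (inv_mem hτ) hσ) (by
        rw [AlgEquiv.mul_apply, h, ← AlgEquiv.mul_apply, inv_mul_cancel, AlgEquiv.one_apply])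
      have h2 : τ ((τ⁻¹ * σ) y) = σ y := by
        rw [← AlgEquiv.mul_apply, mul_inv_cancel_left]
      rw [← h2, h1]
    · push Not at hs
      exact ⟨0, fun σ hσ h => absurd h (hs σ hσ)⟩
  choose z hz using hval
  have hinj : Set.InjOn id (S : Set F) := Function.injective_id.injOn
  obtain ⟨L, hL⟩ : ∃ L, L = Lagrange.interpolate S id z := ⟨_, rfl⟩
  have hLeval : ∀ σ ∈ H, L.eval (σ f) = σ y := fun σ hσ => by
    rw [hz _ σ hσ rfl, hL]
    exact Lagrange.eval_interpolate_at_node (v := id) (i := σ f) z hinj (hmemS σ hσ)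
  have hdeg : L.degree < S.card := hL ▸ Lagrange.degree_interpolate_lt z hinj
  have hcard : S.card ≤ p.natDegree := by
    refine le_trans (Finset.card_le_card (t := p.roots.toFinset) fun s hs => ?_)
      (p.roots.toFinset_card_le.trans p.card_roots')
    obtain ⟨σ, hσ, rfl⟩ := hSmem s hs
    rw [Multiset.mem_toFinset, mem_roots hp0]
    exact hp σ hσ
  refine ⟨L, hdeg.trans_le (by exact_mod_cast hcard), fun n => ⟨?_, ?_⟩, hLeval 1 (one_mem H)⟩
  · have hzR : ∀ s ∈ S, z s ∈ R := fun s hs => by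
      obtain ⟨σ, hσ, rfl⟩ := hSmem s hs
      rw [← hz _ σ hσ rfl]
      exact hHR σ hσ y hy
    have hSR : ∀ s ∈ S, s ∈ R := fun s hs => by
      obtain ⟨σ, hσ, rfl⟩ := hSmem s hs
      exact hHR σ hσ f hf
    have hLR : L ∈ Polynomial.liftsRing R.subtype := by
      have hC : ∀ w ∈ R, C w ∈ Polynomial.liftsRing R.subtype := fun w hw =>
        (mem_lifts _).2 ⟨C ⟨w, hw⟩, by simp⟩
      have hX : (X : F[X]) ∈ Polynomial.liftsRing R.subtype := (mem_lifts _).2 ⟨X, by simp⟩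
      rw [hL, Lagrange.interpolate_apply]
      refine sum_mem fun s hs => mul_mem (hC _ (hzR s hs)) ?_
      rw [Lagrange.basis]
      refine prod_mem fun s' hs' => ?_
      rw [Lagrange.basisDivisor]
      refine mul_mem (hC _ ?_) (sub_mem hX (hC _ (hSR s' (Finset.mem_of_mem_erase hs'))))
      obtain ⟨σ, hσ, rfl⟩ := hSmem s hs
      obtain ⟨τ, hτ, rfl⟩ := hSmem s' (Finset.mem_of_mem_erase hs')
      obtain ⟨c, hc⟩ := htrans σ hσ
      obtain ⟨c', hc'⟩ := htrans τ hτ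
      -- The denominators of the Lagrange basis are differences of translates, thus constants, so
      -- the coefficients stay in R.
      have : (id (σ f) - id (τ f))⁻¹ = algebraMap k F (c - c')⁻¹ := by
        rw [map_inv₀, map_sub, id, id, hc, hc', add_sub_add_left_eq_sub]
      rw [this]
      exact hkR _
    obtain ⟨L', hL'⟩ := (mem_lifts _).1 hLR
    rw [← hL', coeff_map]
    exact (L'.coeff n).2
  · rw [IntermediateField.mem_fixedField_iff]
    intro τ hτ
    -- Invariance follows from uniqueness of interpolation: τ permutes the nodes compatibly with the
    -- values.
    have h1 : L.map (τ : F →+* F) = L := by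
      refine eq_of_degrees_lt_of_eval_finset_eq S ?_ hdeg fun s hs => ?_
      · exact (degree_map_le).trans_lt hdeg
      · obtain ⟨σ, hσ, rfl⟩ := hSmem s hs
        have h2 : ∀ z, (τ : F →+* F) ((τ⁻¹ * σ) z) = σ z := fun z => by
          change τ ((τ⁻¹ * σ) z) = σ z
          rw [← AlgEquiv.mul_apply, mul_inv_cancel_left]
        rw [← h2 f, eval_map_apply, hLeval _ (mul_mem (inv_mem hτ) hσ), h2, h2, hLeval _ hσ]
    have h2 := congrArg (fun p => coeff p n) h1
    simpa using h2

end Interpolation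

end HKG

namespace HKG
open Polynomial

/-! ### The chain of ramification groups of a tower -/

section Chain

variable {k F : Type*} [Field k] [Field F] [Algebra k F]
  {p : ℕ} {G : Subgroup (F ≃ₐ[k] F)} {P : Place k F}

theorem ramGroup_const {a c : ℕ} (hac : a ≤ c)
    (h : ∀ j, a ≤ j → j < c → ramGroup G P (j + 1) = ramGroup G P j) :
    ramGroup G P c = ramGroup G P a := by
  induction c, hac using Nat.le_induction with
  | base => rfl
  | succ c hac ih =>
    rw [h c hac (Nat.lt_succ_self c)]
    exact ih fun j h1 h2 => h j h1 (by omega)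

theorem IsHKGCover.stable (hX : IsHKGCover p G P) : ∀ σ ∈ G, ∀ y ∈ P.ring, σ y ∈ P.ring :=
  stable_of_ramGroup_eq hX.totally_ramified

theorem IsHKGCover.trdegLeOne (hX : IsHKGCover p G P) : TrdegLeOne k F := by
  obtain ⟨x, -, hx⟩ := hX.rational
  have := hX.finite
  have := finiteDimensional_fixedField G
  rw [hx] at this
  exact trdegLeOne_of_adjoin (x := x) inferInstance

theorem residue_of_cover [IsAlgClosed k] (hX : IsHKGCover p G P) :
    ∀ y ∈ P.ring, ∃ c : k, P.ring.valuation (y - algebraMap k F c) < 1 :=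
  fun _ hy => exists_residue hX.trdegLeOne P.algebraMap_mem P.ne_top hy

namespace Tower

variable (T : Tower p G P)

/-- The group that fixes the bottom of the step `l`, trivial beyond the last step. -/
def Γ (l : ℕ) : Subgroup (F ≃ₐ[k] F) :=
  if h : l < T.r then ramGroup G P (T.b ⟨l, h⟩) else ⊥

/-- The degrees of the steps. -/
def q (l : ℕ) : ℕ := if h : l < T.r then p ^ T.n ⟨l, h⟩ else 1

/-- The jumps. -/
def jump (l : ℕ) : ℕ := if h : l < T.r then T.b ⟨l, h⟩ else 0

/-- The orders of the groups. -/
def e (l : ℕ) : ℕ := Nat.card (T.Γ l)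

theorem q_fin (i : Fin T.r) : T.q i = p ^ T.n i := dif_pos i.2

theorem jump_fin (i : Fin T.r) : T.jump i = T.b i := dif_pos i.2

theorem Γ_fin (i : Fin T.r) : T.Γ i = ramGroup G P (T.b i) := dif_pos i.2

theorem Γ_of_le {l : ℕ} (hl : T.r ≤ l) : T.Γ l = ⊥ := dif_neg (by omega)

theorem e_last : T.e T.r = 1 := by rw [e, Γ_of_le T le_rfl, Subgroup.card_bot]

theorem Γ_zero (hX : IsHKGCover p G P) (h0 : 0 < T.r) : T.Γ 0 = G := by
  refine (Γ_fin T ⟨0, h0⟩).trans ((ramGroup_const (Nat.zero_le _) ?_).trans hX.totally_ramified)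
  intro j _ hj
  by_contra h
  obtain ⟨i, hi⟩ := (T.b_jump j).2 h
  have := T.b_strictMono.monotone (show (⟨0, h0⟩ : Fin T.r) ≤ i from Nat.zero_le _)
  omega

variable [IsAlgClosed k] {s : P.ring}

theorem isUnif (hX : IsHKGCover p G P) (hs : IsLocalRing.maximalIdeal P.ring = Ideal.span {s}) :
    IsUnif P.ring (s : F) :=
  isUnif_of_span hX.trdegLeOne P.algebraMap_mem P.ne_top hs

theorem exists_ramGroup_eq_bot (hX : IsHKGCover p G P)
    (hs : IsLocalRing.maximalIdeal P.ring = Ideal.span {s}) : ∃ c, ramGroup G P c = ⊥ := by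
  have := hX.finite
  have := Fintype.ofFinite G
  have hU := isUnif hX hs
  have h1 : ∀ σ : G, ∃ n : ℕ, (σ : F ≃ₐ[k] F) ∈ ramGroup G P n → (σ : F ≃ₐ[k] F) = 1 := by
    intro σ
    by_cases hσ : (σ : F ≃ₐ[k] F) = 1
    · exact ⟨0, fun _ => hσ⟩
    · obtain ⟨m, hm⟩ := hU.2.2 _ (sub_ne_zero.2
        (apply_uniformizer_ne G hU hX.stable (residue_of_cover hX) σ.2 hσ))
      refine ⟨m.toNat, fun h => ?_⟩
      rw [mem_ramGroup_iff hs hU hX.stable (residue_of_cover hX), hm, hU.zpow_le_zpow] at h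
      omega
  choose n hn using h1
  refine ⟨∑ σ, n σ, (Subgroup.eq_bot_iff_forall _).2 fun σ hσ => ?_⟩
  have hσG := ramGroup_le G P _ hσ
  exact hn ⟨σ, hσG⟩ (ramGroup_antitone G P (Finset.single_le_sum (fun _ _ => Nat.zero_le _)
    (Finset.mem_univ (⟨σ, hσG⟩ : G))) hσ)

/-- The filtration is constant between consecutive jumps, and after the last jump it stays at its
eventual value, the trivial group. -/
theorem Γ_succ (hX : IsHKGCover p G P)
    (hs : IsLocalRing.maximalIdeal P.ring = Ideal.span {s}) (i : Fin T.r) :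
    T.Γ (i + 1) = ramGroup G P (T.b i + 1) := by
  by_cases hi : (i : ℕ) + 1 < T.r
  · rw [Γ_fin T ⟨i + 1, hi⟩]
    have hlt := T.b_strictMono (show i < ⟨i + 1, hi⟩ from Nat.lt_succ_self i.1)
    refine ramGroup_const (by omega) fun j h1 h2 => ?_
    by_contra h
    obtain ⟨l, rfl⟩ := (T.b_jump j).2 h
    have h3 : i < l := by
      rw [← T.b_strictMono.lt_iff_lt]; omega
    have h4 : l < ⟨i + 1, hi⟩ := T.b_strictMono.lt_iff_lt.1 h2
    rw [Fin.lt_def] at h3 h4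
    simp at h4
    omega
  · rw [Γ_of_le T (by omega)]
    obtain ⟨c, hc⟩ := exists_ramGroup_eq_bot hX hs
    have hc' : ramGroup G P (max c (T.b i + 1)) = ⊥ :=
      le_bot_iff.1 (hc ▸ ramGroup_antitone G P (le_max_left _ _))
    rw [← hc']
    refine ramGroup_const (le_max_right _ _) fun j h1 _ => ?_
    by_contra h
    obtain ⟨l, rfl⟩ := (T.b_jump j).2 h
    have h3 : i < l := by
      rw [← T.b_strictMono.lt_iff_lt]; omega
    rw [Fin.lt_def] at h3
    omega

omit [IsAlgClosed k] in
theorem Γ_le (l : ℕ) : T.Γ l ≤ G := by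
  by_cases h : l < T.r
  · rw [Γ_fin T ⟨l, h⟩]
    exact ramGroup_le G P _
  · rw [Γ_of_le T (by omega)]
    exact bot_le

omit [IsAlgClosed k] in
theorem finite_Γ (hX : IsHKGCover p G P) (l : ℕ) : Finite (T.Γ l) := by
  have := hX.finite
  exact Finite.of_injective _ (Subgroup.inclusion_injective (T.Γ_le l))

variable (hX : IsHKGCover p G P) (hs : IsLocalRing.maximalIdeal P.ring = Ideal.span {s})

include hX hs

theorem Γ_succ_le (i : Fin T.r) : T.Γ (i + 1) ≤ T.Γ i := by
  rw [Γ_fin, Γ_succ T hX hs]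
  exact ramGroup_antitone G P (Nat.le_succ _)

theorem e_eq {l : ℕ} (hl : l < T.r) : T.e l = T.q l * T.e (l + 1) := by
  have := T.card_eq ⟨l, hl⟩
  rw [e, e, q_fin T ⟨l, hl⟩, Γ_fin T ⟨l, hl⟩, Γ_succ T hX hs ⟨l, hl⟩]
  exact this

theorem m_eq (i : Fin T.r) : T.m i = T.e (i + 1) * T.jump i := by
  rw [m, e, Γ_succ T hX hs, jump_fin]

theorem two_le_q {l : ℕ} (hl : l < T.r) : 2 ≤ T.q l := by
  have h1 := T.e_eq hX hs hl
  have := T.finite_Γ hX l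
  have hpos : 0 < T.e l := Nat.card_pos
  have h2 : T.q l ≠ 0 := by rintro h; rw [h, zero_mul] at h1; omega
  have h3 : T.q l ≠ 1 := by
    intro h
    rw [h, one_mul] at h1
    have h4 : T.Γ (l + 1) = T.Γ l :=
      Subgroup.eq_of_le_of_card_ge (T.Γ_succ_le hX hs ⟨l, hl⟩) h1.le
    rw [Γ_fin T ⟨l, hl⟩, Γ_succ T hX hs ⟨l, hl⟩] at h4
    exact (T.b_jump _).1 ⟨_, rfl⟩ h4
  omega

theorem fixedField_Γ_succ (i : Fin T.r) : IntermediateField.fixedField (T.Γ (i + 1)) =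
    IntermediateField.fixedField (T.Γ i) ⊔ IntermediateField.adjoin k {T.f i.succ} := by
  rw [Γ_fin, Γ_succ T hX hs, T.f_gen]

omit [IsAlgClosed k] hX hs in
theorem D_mem_fixedField (i : Fin T.r) : T.D i ∈ IntermediateField.fixedField (T.Γ i) := by
  rw [Γ_fin]
  exact T.D_mem i

variable [Fact p.Prime] [CharP k p]

theorem one_le_jump (i : Fin T.r) : 1 ≤ T.b i := by
  have := hX.finite
  have := Fintype.ofFinite G
  by_contra h
  have h0 : T.b i = 0 := by omega
  have h1 := (T.b_jump 0).1 ⟨i, h0⟩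
  rw [zero_add, ramGroup_one_eq hs (isUnif hX hs) hX.stable (residue_of_cover hX) p hX.isPGroup,
    hX.totally_ramified] at h1
  exact h1 rfl

omit hX hs in
/-- The conjugates of the generators are their translates by constants. -/
theorem exists_translate (i : Fin T.r) {σ : F ≃ₐ[k] F} (hσ : σ ∈ T.Γ i) :
    ∃ c : k, σ (T.f i.succ) = T.f i.succ + algebraMap k F c := by
  have : CharP F p := charP_of_injective_algebraMap (algebraMap k F).injective p
  set y := T.f i.succ
  have h1 : σ (T.D i) = T.D i := (IntermediateField.mem_fixedField_iff _ _).1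
    (T.D_mem_fixedField i) σ hσ
  set A : k[X] := X ^ p ^ T.n i + ∑ j : Fin (T.n i), C (T.a i j) * X ^ p ^ (j : ℕ) with hA
  have h2 : aeval (σ y - y) A = 0 := by
    -- The polynomial A is additive in characteristic p. Hence σy - y is one of its roots, so it is
    -- algebraic over k and therefore constant.
    have h3 : aeval (σ y - y) A = σ (T.D i) - T.D i := by
      rw [D]
      simp only [hA, map_add, map_sum, map_mul, map_pow, aeval_X, aeval_C, sub_pow_char_pow,
        AlgEquiv.commutes, mul_sub, Finset.sum_sub_distrib]
      ring
    rw [h3, h1, sub_self]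
  have hA0 : A ≠ 0 := by
    intro h
    have h4 : A.coeff (p ^ T.n i) = 1 := by
      rw [hA, coeff_add, coeff_X_pow_self, finsetSum_coeff, Finset.sum_eq_zero, add_zero]
      intro j _
      rw [coeff_C_mul, coeff_X_pow, if_neg, mul_zero]
      exact (Nat.pow_lt_pow_right (Fact.out : p.Prime).one_lt j.2).ne'
    rw [h, coeff_zero] at h4
    exact zero_ne_one h4
  obtain ⟨c, hc⟩ := algebraic_mem_range (k := k) (y := σ y - y) (by
    rw [transcendental_iff]
    push Not
    exact ⟨A, h2, hA0⟩)
  exact ⟨c, by rw [hc]; ring⟩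

omit [Fact p.Prime] [CharP k p] in
theorem mem_Γ_succ_of_apply_eq (i : Fin T.r) {σ : F ≃ₐ[k] F} (hσ : σ ∈ T.Γ i)
    (h : σ (T.f i.succ) = T.f i.succ) : σ ∈ T.Γ (i + 1) := by
  have := T.finite_Γ hX (i + 1)
  refine mem_of_fixes_fixedField _ fun z hz => ?_
  have h1 : IntermediateField.fixedField (T.Γ (i + 1)) ≤
      IntermediateField.fixedField (Subgroup.zpowers σ) := by
    rw [T.fixedField_Γ_succ hX hs i]
    refine sup_le ?_ ?_
    · intro w hw
      rw [IntermediateField.mem_fixedField_iff] at hw ⊢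
      exact fun τ hτ => hw τ (Subgroup.zpowers_le.2 hσ hτ)
    · rw [IntermediateField.adjoin_simple_le_iff, IntermediateField.mem_fixedField_iff]
      intro τ hτ
      have h2 : Subgroup.zpowers σ ≤ MulAction.stabilizer (F ≃ₐ[k] F) (T.f i.succ) :=
        Subgroup.zpowers_le.2 h
      exact h2 hτ
  exact (IntermediateField.mem_fixedField_iff _ _).1 (h1 hz) σ (Subgroup.mem_zpowers σ)

omit [Fact p.Prime] [CharP k p] in
theorem f_mem_fixedField (i : Fin T.r) :
    T.f i.succ ∈ IntermediateField.fixedField (T.Γ (i + 1)) := by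
  rw [T.fixedField_Γ_succ hX hs i]
  exact (le_sup_right : _ ≤ _ ⊔ IntermediateField.adjoin k {T.f i.succ})
    (IntermediateField.mem_adjoin_simple_self k _)

omit [Fact p.Prime] [CharP k p] in
theorem valuation_f (i : Fin T.r) : P.ring.valuation (T.f i.succ) =
    P.ring.valuation (s : F) ^ (-((T.e (i + 1) * T.jump i : ℕ) : ℤ)) := by
  rw [← (isUnif hX hs).hasOrd_iff ⟨s, hs⟩, ← T.m_eq hX hs]
  exact T.f_pole i

/-- Some σ in the l-th group is outside the next one, so it translates the generator by a nonzero
constant; the Artin–Schreier argument then shows that p does not divide the jump. -/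
theorem coprime_q_jump {l : ℕ} (hl : l < T.r) : Nat.Coprime (T.q l) (T.jump l) := by
  have := hX.finite
  have := Fintype.ofFinite G
  rw [T.q_fin ⟨l, hl⟩, T.jump_fin ⟨l, hl⟩]
  refine Nat.Coprime.pow_left _ (((Fact.out : p.Prime).coprime_iff_not_dvd).2 ?_)
  obtain ⟨σ, hσ, hσ'⟩ : ∃ σ ∈ T.Γ l, σ ∉ T.Γ (l + 1) := by
    by_contra! h
    have h4 : T.Γ (l + 1) = T.Γ l := le_antisymm (T.Γ_succ_le hX hs ⟨l, hl⟩) h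
    rw [Γ_fin T ⟨l, hl⟩, Γ_succ T hX hs ⟨l, hl⟩] at h4
    exact (T.b_jump _).1 ⟨_, rfl⟩ h4
  obtain ⟨c, hc⟩ := T.exists_translate ⟨l, hl⟩ hσ
  have h1 := T.valuation_f hX hs ⟨l, hl⟩
  have h2 := T.f_mem_fixedField hX hs ⟨l, hl⟩
  rw [e, Γ_succ T hX hs ⟨l, hl⟩, T.jump_fin] at h1
  rw [Γ_succ T hX hs ⟨l, hl⟩] at h2
  refine not_dvd_of_artinSchreier hs (isUnif hX hs) hX.stable (residue_of_cover hX) p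
    (T.one_le_jump hX hs ⟨l, hl⟩) (σ := σ) (f := T.f (Fin.succ ⟨l, hl⟩)) (c := c) ?_ h2 h1 ?_ ?_
  · rwa [← Γ_fin]
  · rintro rfl
    rw [map_zero, add_zero] at hc
    exact hσ' (T.mem_Γ_succ_of_apply_eq hX hs ⟨l, hl⟩ hσ hc)
  · rw [hc, add_sub_cancel_left]

omit [IsAlgClosed k] hs [Fact p.Prime] [CharP k p] in
theorem e_zero (h0 : 0 < T.r) : T.e 0 = Nat.card G := by rw [e, T.Γ_zero hX h0]

omit [Fact p.Prime] [CharP k p] in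
theorem valuation_f_zero (h0 : 0 < T.r) : P.ring.valuation (T.f 0) =
    P.ring.valuation (s : F) ^ (-(T.e 0 : ℤ)) := by
  have := hX.finite
  have := Fintype.ofFinite G
  rw [T.e_zero hX h0]
  exact valuation_generator (isUnif hX hs) hX.stable (residue_of_cover hX) T.f_zero T.f_zero_pole

omit hX hs [Fact p.Prime] [CharP k p] in
theorem transcendental_f_zero : Transcendental k (T.f 0) := by
  by_contra h
  obtain ⟨c, hc⟩ := algebraic_mem_range h
  exact T.f_zero_pole (hc ▸ P.algebraMap_mem c)

omit hs [Fact p.Prime] [CharP k p] in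
theorem f_mem_regularOutside (j : Fin (T.r + 1)) : T.f j ∈ regularOutside P := by
  have := hX.finite
  have := Fintype.ofFinite G
  refine Fin.cases ?_ (fun i => ?_) j
  · exact generator_mem_regularOutside hX.trdegLeOne hX.stable T.f_zero T.f_zero_pole
  · exact mem_regularOutside.2 (T.f_regular i)

end Tower

end Chain

end HKG

namespace HKG
open Polynomial

/-! ### Reduced monomials in the generators of a tower -/

section Monomials

variable {k F : Type*} [Field k] [Field F] [Algebra k F]
  {p : ℕ} {G : Subgroup (F ≃ₐ[k] F)} {P : Place k F}

namespace Tower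

variable (T : Tower p G P)

/-- The exponents of the reduced monomials in `f_0, …, f_l`. -/
def reducedExp (l : ℕ) : Set (Fin (T.r + 1) →₀ ℕ) :=
  {e | (∀ j : Fin (T.r + 1), l < j → e j = 0) ∧ ∀ j : Fin T.r, e j.succ < p ^ T.n j}

/-- The exponent of the `l`-th generator, extended by zero. -/
def expAt (e : Fin (T.r + 1) →₀ ℕ) (l : ℕ) : ℕ :=
  if h : l < T.r then e (Fin.succ ⟨l, h⟩) else 0

theorem expAt_fin (e : Fin (T.r + 1) →₀ ℕ) (i : Fin T.r) : T.expAt e i = e i.succ := dif_pos i.2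

theorem weight_add (L K : Fin (T.r + 1) →₀ ℕ) : T.weight (L + K) = T.weight L + T.weight K := by
  simp only [weight, Finsupp.add_apply, add_mul, Finset.sum_add_distrib]
  ring

theorem aeval_eq_sum (c : MvPolynomial (Fin (T.r + 1)) k) :
    MvPolynomial.aeval T.f c = ∑ e ∈ c.support, c.coeff e • ∏ j, T.f j ^ e j := by
  rw [MvPolynomial.aeval_def, MvPolynomial.eval₂_eq']
  exact Finset.sum_congr rfl fun e _ => (Algebra.smul_def _ _).symm

variable [IsAlgClosed k] {s : P.ring} (hX : IsHKGCover p G P)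
  (hs : IsLocalRing.maximalIdeal P.ring = Ideal.span {s}) (h0 : 0 < T.r)

include hX hs h0

theorem weight_eq (e : Fin (T.r + 1) →₀ ℕ) : (T.weight e : ℤ) = (e 0 : ℤ) * T.e 0 +
    ∑ l ∈ Finset.range T.r, (T.expAt e l : ℤ) * (T.e (l + 1) * T.jump l : ℕ) := by
  rw [weight, T.e_zero hX h0, Finset.sum_range]
  push_cast
  refine congrArg _ (Finset.sum_congr rfl fun i _ => ?_)
  rw [T.m_eq hX hs, expAt_fin]
  push_cast
  rfl

theorem valuation_monomial (L : Fin (T.r + 1) →₀ ℕ) :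
    P.ring.valuation (∏ j, T.f j ^ L j) = P.ring.valuation (s : F) ^ (-(T.weight L : ℤ)) := by
  have hU := isUnif hX hs
  have hne := hU.val_pos.ne'
  rw [Fin.prod_univ_succ, map_mul, map_pow, T.valuation_f_zero hX hs h0, map_prod, weight,
    ← T.e_zero hX h0]
  have h1 : ∀ i : Fin T.r, P.ring.valuation (T.f i.succ ^ L i.succ) =
      P.ring.valuation (s : F) ^ (-((L i.succ * T.m i : ℕ) : ℤ)) := by
    intro i
    rw [map_pow, T.valuation_f hX hs, ← zpow_natCast, ← zpow_mul, ← T.m_eq hX hs]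
    congr 1
    push_cast
    ring
  have h2 : ∀ S : Finset (Fin T.r), ∏ i ∈ S, P.ring.valuation (T.f i.succ ^ L i.succ) =
      P.ring.valuation (s : F) ^ (-((∑ i ∈ S, L i.succ * T.m i : ℕ) : ℤ)) := by
    intro S
    classical
    induction S using Finset.induction_on with
    | empty => simp
    | insert i S hi ih =>
      rw [Finset.prod_insert hi, Finset.sum_insert hi, ih, h1, ← zpow_add₀ hne]
      congr 1
      push_cast
      ring
  rw [h2, ← zpow_natCast, ← zpow_mul, ← zpow_add₀ hne]
  congr 1
  push_cast
  ring

variable [Fact p.Prime] [CharP k p]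

/-- This is uniqueness of reduced representations in the telescopic semigroup. -/
theorem weight_inj {e e' : Fin (T.r + 1) →₀ ℕ} (he : ∀ j : Fin T.r, e j.succ < p ^ T.n j)
    (he' : ∀ j : Fin T.r, e' j.succ < p ^ T.n j) (h : T.weight e = T.weight e') : e = e' := by
  have hlt : ∀ x : Fin (T.r + 1) →₀ ℕ, (∀ j : Fin T.r, x j.succ < p ^ T.n j) →
      ∀ l < T.r, T.expAt x l < T.q l := fun x hx l hl => by
    rw [T.q_fin ⟨l, hl⟩, T.expAt_fin x ⟨l, hl⟩]
    exact hx _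
  have hpos : ∀ l ≤ T.r, 0 < T.e l := fun l _ => by
    have := T.finite_Γ hX l
    exact Nat.card_pos
  have h1 : (T.weight e : ℤ) = T.weight e' := by exact_mod_cast h
  rw [T.weight_eq hX hs h0, T.weight_eq hX hs h0] at h1
  obtain ⟨h2, h3⟩ := telescopic_unique (q := T.q) (b := T.jump) (e := T.e) (fun l hl => T.e_eq hX hs hl)
    (fun l hl => T.coprime_q_jump hX hs hl) hpos le_rfl (hlt e he) (hlt e' he') h1
  ext j
  refine Fin.cases ?_ (fun i => ?_) j
  · exact_mod_cast h2
  · rw [← expAt_fin, ← expAt_fin]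
    exact h3 i i.2

theorem valuation_le_aeval {c : MvPolynomial (Fin (T.r + 1)) k}
    (hc : ∀ e ∈ c.support, ∀ j : Fin T.r, e j.succ < p ^ T.n j) {e : Fin (T.r + 1) →₀ ℕ}
    (he : e ∈ c.support) :
    P.ring.valuation (s : F) ^ (-(T.weight e : ℤ)) ≤
      P.ring.valuation (MvPolynomial.aeval T.f c) := by
  have hval : ∀ e ∈ c.support, P.ring.valuation (c.coeff e • ∏ j, T.f j ^ e j) =
      P.ring.valuation (s : F) ^ (-(T.weight e : ℤ)) := fun e he => by
    rw [Algebra.smul_def, map_mul, valuation_algebraMap P.algebraMap_mem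
      (MvPolynomial.mem_support_iff.1 he), one_mul, T.valuation_monomial hX hs h0]
  rw [aeval_eq_sum, ← hval e he]
  refine valuation_le_sum _ (fun e => c.coeff e • ∏ j, T.f j ^ e j) ?_ e he
  intro i hi j hj _ _ hij
  rw [hval i hi, hval j hj] at hij
  have := (isUnif hX hs).zpow_inj hij
  exact T.weight_inj hX hs h0 (hc i hi) (hc j hj) (by omega)

theorem eq_zero_of_aeval_eq_zero {c : MvPolynomial (Fin (T.r + 1)) k}
    (hc : ∀ e ∈ c.support, ∀ j : Fin T.r, e j.succ < p ^ T.n j)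
    (h : MvPolynomial.aeval T.f c = 0) : c = 0 := by
  by_contra hne
  obtain ⟨e, he⟩ := MvPolynomial.support_nonempty.2 hne
  have h1 := T.valuation_le_aeval hX hs h0 hc he
  rw [h, map_zero, le_zero_iff] at h1
  exact zpow_ne_zero _ (isUnif hX hs).val_pos.ne' h1

theorem aeval_injOn {c c' : MvPolynomial (Fin (T.r + 1)) k}
    (hc : ∀ e ∈ c.support, ∀ j : Fin T.r, e j.succ < p ^ T.n j)
    (hc' : ∀ e ∈ c'.support, ∀ j : Fin T.r, e j.succ < p ^ T.n j)
    (h : MvPolynomial.aeval T.f c = MvPolynomial.aeval T.f c') : c = c' := by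
  classical
  rw [← sub_eq_zero]
  refine T.eq_zero_of_aeval_eq_zero hX hs h0 (fun e he => ?_) (by rw [map_sub, h, sub_self])
  rcases Finset.mem_union.1 (MvPolynomial.support_sub _ _ _ he) with h | h
  · exact hc e h
  · exact hc' e h

/-- The functions of the field `F_l` that are regular outside `P` are polynomials in the
generators. -/
theorem exists_reduced {l : ℕ} (hl : l ≤ T.r) {y : F} (hyR : y ∈ regularOutside P)
    (hy : y ∈ IntermediateField.fixedField (T.Γ l)) :
    ∃ c ∈ MvPolynomial.restrictSupport k (T.reducedExp l), MvPolynomial.aeval T.f c = y := by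
  classical
  induction l generalizing y with
  | zero =>
    rw [T.Γ_zero hX h0, T.f_zero] at hy
    obtain ⟨A, rfl⟩ := exists_aeval_of_mem_regularOutside T.transcendental_f_zero T.f_zero_pole
      hy hyR
    refine ⟨aeval (MvPolynomial.X 0) A, ?_, ?_⟩
    · rw [aeval_eq_sum_range]
      refine Submodule.sum_mem _ fun n _ => Submodule.smul_mem _ _ ?_
      rw [MvPolynomial.X_pow_eq_monomial, MvPolynomial.monomial_mem_restrictSupport]
      left
      constructor
      · intro j hj
        rw [Finsupp.single_apply, if_neg]
        rintro rfl
        exact absurd hj (lt_irrefl _)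
      · intro j
        rw [Finsupp.single_apply, if_neg (Fin.succ_ne_zero j).symm]
        exact pow_pos (Fact.out : p.Prime).pos _
    · rw [← Polynomial.aeval_algHom_apply, MvPolynomial.aeval_X]
  | succ l ih =>
    set i : Fin T.r := ⟨l, hl⟩
    have hfin := T.finite_Γ hX l
    have := Fintype.ofFinite (T.Γ l)
    have : CharP F p := charP_of_injective_algebraMap (algebraMap k F).injective p
    set B : F[X] := X ^ p ^ T.n i + (∑ j : Fin (T.n i), C (algebraMap k F (T.a i j)) *
      X ^ p ^ (j : ℕ) - C (T.D i)) with hB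
    have hlt : ∀ j : Fin (T.n i), p ^ (j : ℕ) < p ^ T.n i := fun j =>
      Nat.pow_lt_pow_right (Fact.out : p.Prime).one_lt j.2
    have hBdeg : (∑ j : Fin (T.n i), C (algebraMap k F (T.a i j)) *
        X ^ p ^ (j : ℕ) - C (T.D i) : F[X]).degree < (p ^ T.n i : ℕ) := by
      refine (degree_sub_le _ _).trans_lt (max_lt ?_ ?_)
      · refine (degree_sum_le _ _).trans_lt ((Finset.sup_lt_iff (WithBot.bot_lt_coe _)).2
          fun j _ => (degree_C_mul_X_pow_le _ _).trans_lt ?_)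
        exact_mod_cast hlt j
      · refine degree_C_le.trans_lt ?_
        exact_mod_cast pow_pos (Fact.out : p.Prime).pos _
    have hB0 : B ≠ 0 := (monic_X_pow_add hBdeg).ne_zero
    have hBnat : B.natDegree = p ^ T.n i := by
      rw [hB, natDegree_add_eq_left_of_degree_lt, natDegree_X_pow]
      rwa [degree_X_pow]
    have hBeval : B.eval (T.f i.succ) = 0 := by
      rw [hB, D]
      simp [eval_finsetSum]
    -- Interpolation over the roots of B expands y in powers of the new generator below p ^ n, with
    -- coefficients in R and in the field below, to which induction applies.
    obtain ⟨L, hLdeg, hL, hLy⟩ := exists_poly_of_translates (T.Γ l) (R := regularOutside P)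
      (algebraMap_mem_regularOutside P)
      (fun σ hσ z hz => map_mem_regularOutside hX.stable (T.Γ_le l hσ) hz)
      (T.f_mem_regularOutside hX i.succ) hyR
      (fun σ hσ h => (IntermediateField.mem_fixedField_iff _ _).1 hy σ
        (T.mem_Γ_succ_of_apply_eq hX hs i hσ h))
      (fun σ hσ => T.exists_translate i hσ) hB0 (fun σ hσ => by
        have h1 : σ (T.D i) = T.D i := (IntermediateField.mem_fixedField_iff _ _).1
          (T.D_mem_fixedField i) σ hσ
        have h2 : B.map (σ : F →+* F) = B := by
          rw [hB]
          simp [Polynomial.map_sum, h1]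
        change B.eval ((σ : F →+* F) (T.f i.succ)) = 0
        rw [← h2, eval_map_apply, hBeval, map_zero])
    choose c hc hcL using fun n => ih (by omega) (hL n).1 (hL n).2
    rw [hBnat] at hLdeg
    refine ⟨∑ n ∈ Finset.range (p ^ T.n i), c n * MvPolynomial.X i.succ ^ n, ?_, ?_⟩
    · refine Submodule.sum_mem _ fun n hn => ?_
      rw [Finset.mem_range] at hn
      rw [MvPolynomial.mem_restrictSupport_iff]
      intro e he
      obtain ⟨e', he', e'', he'', rfl⟩ := Finset.mem_add.1 (MvPolynomial.support_mul _ _ he)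
      rw [MvPolynomial.X_pow_eq_monomial] at he''
      rw [Finset.mem_singleton.1 (MvPolynomial.support_monomial_subset he'')]
      obtain ⟨h1, h2⟩ := hc n he'
      constructor
      · intro j hj
        rw [Finsupp.add_apply, h1 j (by omega), zero_add, Finsupp.single_apply, if_neg]
        rintro rfl
        rw [Fin.val_succ] at hj
        exact absurd hj (lt_irrefl _)
      · intro j
        rw [Finsupp.add_apply, Finsupp.single_apply]
        by_cases hij : i = j
        · subst hij
          rw [if_pos rfl, h1 i.succ (by rw [Fin.val_succ]; exact Nat.lt_succ_self l), zero_add]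
          exact hn
        · rw [if_neg (fun h => hij (Fin.succ_injective _ h)), add_zero]
          exact h2 j
    · rw [map_sum, ← hLy, eval_eq_sum_range' (n := p ^ T.n i)]
      · refine Finset.sum_congr rfl fun n _ => ?_
        rw [map_mul, map_pow, MvPolynomial.aeval_X, hcL]
      · by_cases hL0 : L = 0
        · rw [hL0, natDegree_zero]
          exact pow_pos (Fact.out : p.Prime).pos _
        · exact (natDegree_lt_iff_degree_lt hL0).2 hLdeg

end Tower

end Monomials

end HKG

namespace HKG
open Polynomial

/-! ### Holomorphic differentials of a Harbater–Katz–Gabber cover -/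

section Regular

variable {k F : Type*} [Field k] [Field F] [Algebra k F] {Q : Place k F}

theorem exists_smul_of_mem_regularAt {η : Ω[F⁄k]}
    (h : ∀ a ∈ Q.ring, ∃ a' ∈ Q.ring, KaehlerDifferential.D k F a = a' • η) {w : Ω[F⁄k]}
    (hw : w ∈ regularAt k Q) : ∃ z ∈ Q.ring, w = z • η := by
  induction hw using Submodule.span_induction with
  | mem x hx =>
    obtain ⟨g, hg, a, ha, rfl⟩ := hx
    obtain ⟨a', ha', h1⟩ := h a ha
    exact ⟨g * a', mul_mem hg ha', by rw [h1, smul_smul]⟩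
  | zero => exact ⟨0, zero_mem _, (zero_smul F η).symm⟩
  | add x y _ _ hx hy =>
    obtain ⟨z, hz, rfl⟩ := hx
    obtain ⟨z', hz', rfl⟩ := hy
    exact ⟨z + z', add_mem hz hz', (add_smul _ _ _).symm⟩
  | smul c x _ hx =>
    obtain ⟨z, hz, rfl⟩ := hx
    exact ⟨algebraMap k F c * z, mul_mem (Q.algebraMap_mem c) hz, by
      rw [mul_smul, algebraMap_smul]⟩

theorem smul_D_mem_regularAt {g a : F} (hg : g ∈ Q.ring) (ha : a ∈ Q.ring) :
    g • KaehlerDifferential.D k F a ∈ regularAt k Q :=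
  Submodule.subset_span ⟨g, hg, a, ha, rfl⟩

theorem smul_D_mem_regularAt₂ {g a : F} (hg : g ∈ Q.ring) (ha : a ∈ Q.ring) :
    g • (KaehlerDifferential.D k F a ⊗ₜ[F] KaehlerDifferential.D k F a) ∈ regularAt₂ k Q :=
  Submodule.subset_span ⟨g, hg, a, ha, a, ha, rfl⟩

theorem mem_holomorphic {w : Ω[F⁄k]} : w ∈ holomorphic k F ↔ ∀ Q : Place k F, w ∈ regularAt k Q :=
  Submodule.mem_iInf _

theorem mem_holomorphic₂ {w : Ω[F⁄k] ⊗[F] Ω[F⁄k]} :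
    w ∈ holomorphic₂ k F ↔ ∀ Q : Place k F, w ∈ regularAt₂ k Q :=
  Submodule.mem_iInf _

end Regular

section Differentials

variable {k F : Type*} [Field k] [Field F] [Algebra k F]
  {p : ℕ} {G : Subgroup (F ≃ₐ[k] F)} {P : Place k F}

namespace Tower

variable (T : Tower p G P)

/-- The degree of the divisor of `d f_0`. -/
def canDeg : ℤ := ∑ l ∈ Finset.range T.r, ((T.q l : ℤ) - 1) * (T.e (l + 1) * T.jump l : ℕ) -
  T.e 0 - 1

variable [IsAlgClosed k] {s : P.ring} (hX : IsHKGCover p G P)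
  (hs : IsLocalRing.maximalIdeal P.ring = Ideal.span {s})

include hX hs

-- Elements leaving the chain at step j move the uniformizer to order exactly b_j + 1, and there are
-- e_j - e_{j+1} of them. This is Hilbert's formula for the different, one layer at a time.
open Classical in
theorem prod_valuation_sub [Fintype G] (h0 : 0 < T.r) {l : ℕ} (hl : l ≤ T.r) :
    ∏ σ ∈ Finset.univ.filter (fun σ : G => (σ : F ≃ₐ[k] F) ∉ T.Γ l),
      P.ring.valuation ((s : F) - (σ : F ≃ₐ[k] F) s) =
    P.ring.valuation (s : F) ^
      (∑ j ∈ Finset.range l, ((T.e j : ℤ) - T.e (j + 1)) * (T.jump j + 1)) := by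
  classical
  have hU := isUnif hX hs
  induction l with
  | zero =>
    rw [Finset.filter_false_of_mem, Finset.prod_empty, Finset.range_zero, Finset.sum_empty,
      zpow_zero]
    intro σ _
    rw [T.Γ_zero hX h0, not_not]
    exact σ.2
  | succ l ih =>
    set i : Fin T.r := ⟨l, hl⟩ with hi
    have hle := T.Γ_succ_le hX hs i
    have hdisj : Disjoint (Finset.univ.filter (fun σ : G => (σ : F ≃ₐ[k] F) ∉ T.Γ l))
        (Finset.univ.filter
          (fun σ : G => (σ : F ≃ₐ[k] F) ∈ T.Γ l ∧ (σ : F ≃ₐ[k] F) ∉ T.Γ (l + 1))) := by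
      rw [Finset.disjoint_filter]
      exact fun σ _ h1 h2 => h1 h2.1
    have hunion : Finset.univ.filter (fun σ : G => (σ : F ≃ₐ[k] F) ∉ T.Γ (l + 1)) =
        Finset.univ.filter (fun σ : G => (σ : F ≃ₐ[k] F) ∉ T.Γ l) ∪
        Finset.univ.filter
          (fun σ : G => (σ : F ≃ₐ[k] F) ∈ T.Γ l ∧ (σ : F ≃ₐ[k] F) ∉ T.Γ (l + 1)) := by
      ext σ
      simp only [Finset.mem_filter, Finset.mem_univ, true_and, Finset.mem_union]
      constructor
      · intro h
        by_cases h2 : (σ : F ≃ₐ[k] F) ∈ T.Γ l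
        · exact Or.inr ⟨h2, h⟩
        · exact Or.inl h2
      · rintro (h | h)
        · exact fun h2 => h (hle h2)
        · exact h.2
    have hcardΓ : ∀ j, (Finset.univ.filter
        (fun σ : G => (σ : F ≃ₐ[k] F) ∈ T.Γ j)).card = T.e j := by
      intro j
      rw [e, ← Nat.card_congr (Subgroup.subgroupOfEquivOfLe (T.Γ_le j)).toEquiv,
        Nat.card_eq_fintype_card, Fintype.card_subtype]
      rfl
    have hcard : ((Finset.univ.filter (fun σ : G => (σ : F ≃ₐ[k] F) ∈ T.Γ l ∧
        (σ : F ≃ₐ[k] F) ∉ T.Γ (l + 1))).card : ℤ) = (T.e l : ℤ) - T.e (l + 1) := by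
      have h1 : Finset.univ.filter (fun σ : G => (σ : F ≃ₐ[k] F) ∈ T.Γ l ∧
          (σ : F ≃ₐ[k] F) ∉ T.Γ (l + 1)) = Finset.univ.filter
            (fun σ : G => (σ : F ≃ₐ[k] F) ∈ T.Γ l) \ Finset.univ.filter
            (fun σ : G => (σ : F ≃ₐ[k] F) ∈ T.Γ (l + 1)) := by
        ext σ
        simp
      rw [h1, Finset.cast_card_sdiff (R := ℤ), hcardΓ, hcardΓ]
      intro σ
      simp only [Finset.mem_filter, Finset.mem_univ, true_and]
      exact fun h => hle h
    have hval : ∀ σ ∈ Finset.univ.filter (fun σ : G => (σ : F ≃ₐ[k] F) ∈ T.Γ l ∧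
        (σ : F ≃ₐ[k] F) ∉ T.Γ (l + 1)), P.ring.valuation ((s : F) - (σ : F ≃ₐ[k] F) s) =
        P.ring.valuation (s : F) ^ ((T.jump l : ℤ) + 1) := by
      intro σ hσ
      obtain ⟨-, h1, h2⟩ := Finset.mem_filter.1 hσ
      have h1' : (σ : F ≃ₐ[k] F) ∈ ramGroup G P (T.b i) := by rwa [← Γ_fin]
      have h2' : (σ : F ≃ₐ[k] F) ∉ ramGroup G P (T.b i + 1) := by rwa [← T.Γ_succ hX hs i]
      rw [mem_ramGroup_iff hs hU hX.stable (residue_of_cover hX)] at h1' h2'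
      rw [Valuation.map_sub_swap, T.jump_fin i]
      refine le_antisymm h1'.2 ?_
      by_contra hlt
      apply h2'
      refine ⟨σ.2, ?_⟩
      push_cast
      exact hU.le_of_lt_zpow (not_le.1 hlt)
    rw [hunion, Finset.prod_union hdisj, ih (by omega), Finset.prod_congr rfl hval,
      Finset.prod_const, Finset.sum_range_succ, ← zpow_natCast, ← zpow_mul, hcard,
      mul_comm ((T.jump l : ℤ) + 1), zpow_add₀ hU.val_pos.ne']

theorem D_f_zero_and_regular (h0 : 0 < T.r) :
    (∃ h, P.ring.valuation h = P.ring.valuation (s : F) ^ T.canDeg ∧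
      KaehlerDifferential.D k F (T.f 0) = h • KaehlerDifferential.D k F (s : F)) ∧
    ∀ a ∈ P.ring, ∃ a' ∈ P.ring,
      KaehlerDifferential.D k F a = a' • KaehlerDifferential.D k F (s : F) := by
  classical
  have := hX.finite
  have := Fintype.ofFinite G
  have h1 := T.prod_valuation_sub hX hs h0 le_rfl
  have h2 : Finset.univ.filter (fun σ : G => (σ : F ≃ₐ[k] F) ∉ T.Γ T.r) =
      Finset.univ.erase 1 := by
    ext σ
    simp [T.Γ_of_le le_rfl]
  rw [h2] at h1
  have h3 := D_generator_and_regular (isUnif hX hs) hX.stable (residue_of_cover hX) T.f_zero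
    T.f_zero_pole h1
  convert h3 using 6
  rw [← T.e_zero hX h0, canDeg]
  -- The part e_j - e_{j+1} telescopes to |G| - 1; subtracting 2|G| leaves `canDeg`.
  have h4 : ∑ j ∈ Finset.range T.r, ((T.e j : ℤ) - T.e (j + 1)) * (T.jump j + 1) =
      ∑ j ∈ Finset.range T.r, (((T.q j : ℤ) - 1) * (T.e (j + 1) * T.jump j : ℕ) +
        ((T.e j : ℤ) - T.e (j + 1))) := by
    refine Finset.sum_congr rfl fun j hj => ?_
    rw [T.e_eq hX hs (Finset.mem_range.1 hj)]
    push_cast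
    ring
  rw [h4, Finset.sum_add_distrib, Finset.sum_range_sub', T.e_last]
  push_cast
  ring

omit hs in
theorem exists_D_eq_smul_of_ne {Q : Place k F} (hQ : Q ≠ P) :
    ∀ a ∈ Q.ring, ∃ a' ∈ Q.ring,
      KaehlerDifferential.D k F a = a' • KaehlerDifferential.D k F (T.f 0) := by
  have := hX.finite
  have := Fintype.ofFinite G
  have htr := hX.trdegLeOne
  intro a ha
  refine exists_D_eq_smul_of_unramified G htr Q.algebraMap_mem (fun σ hσ h1 => ?_)
    (fun c hc hcQ => ?_) ha
  · exact exists_mem_not_mem_of_smul_ne G hσ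
      (smul_ne_of_ramGroup_eq_bot htr (hX.unramified Q hQ) hσ h1)
  · obtain ⟨c', h1, h2⟩ := exists_generator_mem htr Q.algebraMap_mem Q.ne_top
      (mem_regularOutside.1 (T.f_mem_regularOutside hX 0) Q hQ)
    rw [T.f_zero, ← h2] at hc
    have hne : T.f 0 - algebraMap k F c' ≠ 0 := fun h =>
      T.f_zero_pole (sub_eq_zero.1 h ▸ P.algebraMap_mem c')
    obtain ⟨z, hz, h3⟩ := exists_D_eq_smul Q.algebraMap_mem h1 hne hc hcQ
    exact ⟨z, hz, by simpa using h3⟩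

omit hs in
theorem D_f_zero_ne_zero : KaehlerDifferential.D k F (T.f 0) ≠ 0 := by
  have := hX.finite
  have h1 := isSeparable_fixedField G
  rw [T.f_zero] at h1
  exact D_ne_zero T.transcendental_f_zero

/-- Outside P the regular differentials are the regular multiples of df_0, and at P those of ds,
where df_0 has order `canDeg`; comparing coefficients gives both directions. -/
theorem mem_holomorphic_iff (h0 : 0 < T.r) {w : Ω[F⁄k]} : w ∈ holomorphic k F ↔
    ∃ h ∈ regularOutside P, P.ring.valuation h ≤ P.ring.valuation (s : F) ^ (-T.canDeg) ∧
      w = h • KaehlerDifferential.D k F (T.f 0) := by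
  have hU := isUnif hX hs
  obtain ⟨⟨η, hη, hDη⟩, hreg⟩ := T.D_f_zero_and_regular hX hs h0
  have hη0 : η ≠ 0 := by
    rintro rfl
    rw [map_zero] at hη
    exact zpow_ne_zero _ hU.val_pos.ne' hη.symm
  rw [mem_holomorphic]
  constructor
  · intro h
    obtain ⟨z, hz, hw⟩ := exists_smul_of_mem_regularAt hreg (h P)
    have hw' : w = (z / η) • KaehlerDifferential.D k F (T.f 0) := by
      rw [hDη, smul_smul, div_mul_cancel₀ _ hη0, hw]
    refine ⟨z / η, mem_regularOutside.2 fun Q hQ => ?_, ?_, hw'⟩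
    · obtain ⟨z', hz', hw''⟩ :=
        exists_smul_of_mem_regularAt (T.exists_D_eq_smul_of_ne hX hQ) (h Q)
      rw [hw'] at hw''
      rw [smul_left_injective F (T.D_f_zero_ne_zero hX) hw'']
      exact hz'
    · rw [map_div₀, hη, zpow_neg, div_eq_mul_inv]
      exact mul_le_of_le_one_left' (valuation_le_one.2 hz)
  · rintro ⟨h, hR, hv, rfl⟩ Q
    by_cases hQ : Q = P
    · subst hQ
      rw [hDη, smul_smul]
      refine smul_D_mem_regularAt (valuation_le_one.1 ?_) s.2
      rw [map_mul, hη]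
      calc _ ≤ _ := mul_le_mul_left hv _
        _ = 1 := by rw [← zpow_add₀ hU.val_pos.ne', neg_add_cancel, zpow_zero]
    · exact smul_D_mem_regularAt (mem_regularOutside.1 hR Q hQ)
        (mem_regularOutside.1 (T.f_mem_regularOutside hX 0) Q hQ)

theorem smul_mem_holomorphic₂ (h0 : 0 < T.r) {h : F} (hR : h ∈ regularOutside P)
    (hv : P.ring.valuation h ≤ P.ring.valuation (s : F) ^ (-(2 * T.canDeg))) :
    h • (KaehlerDifferential.D k F (T.f 0) ⊗ₜ[F] KaehlerDifferential.D k F (T.f 0)) ∈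
      holomorphic₂ k F := by
  have hU := isUnif hX hs
  obtain ⟨⟨η, hη, hDη⟩, -⟩ := T.D_f_zero_and_regular hX hs h0
  rw [mem_holomorphic₂]
  intro Q
  by_cases hQ : Q = P
  · subst hQ
    rw [hDη, TensorProduct.smul_tmul_smul, smul_smul]
    refine smul_D_mem_regularAt₂ (valuation_le_one.1 ?_) s.2
    rw [map_mul, map_mul, hη]
    calc _ ≤ _ := mul_le_mul_left hv _
      _ = 1 := by
        rw [← zpow_add₀ hU.val_pos.ne', ← zpow_add₀ hU.val_pos.ne']
        ring_nf
        rfl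
  · exact smul_D_mem_regularAt₂ (mem_regularOutside.1 hR Q hQ)
      (mem_regularOutside.1 (T.f_mem_regularOutside hX 0) Q hQ)

variable [Fact p.Prime] [CharP k p]

theorem neg_two_le_canDeg : -2 ≤ T.canDeg := by
  have h1 : ∑ l ∈ Finset.range T.r, ((T.e l : ℤ) - T.e (l + 1)) ≤
      ∑ l ∈ Finset.range T.r, ((T.q l : ℤ) - 1) * (T.e (l + 1) * T.jump l : ℕ) := by
    refine Finset.sum_le_sum fun l hl => ?_
    have hl' := Finset.mem_range.1 hl
    have h2 := T.two_le_q hX hs hl'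
    have h3 : (1 : ℤ) ≤ T.jump l := by
      rw [T.jump_fin ⟨l, hl'⟩]
      exact_mod_cast T.one_le_jump hX hs ⟨l, hl'⟩
    rw [T.e_eq hX hs hl']
    push_cast
    have h4 : (0 : ℤ) ≤ ((T.q l : ℤ) - 1) * T.e (l + 1) := mul_nonneg (by omega) (by positivity)
    nlinarith
  rw [Finset.sum_range_sub', T.e_last] at h1
  rw [canDeg]
  push_cast at h1 ⊢
  linarith

omit [Fact p.Prime] [CharP k p] in
theorem weight_mem_telescopic (h0 : 0 < T.r) {e : Fin (T.r + 1) →₀ ℕ} (he : e ∈ T.reducedExp T.r) :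
    (T.weight e : ℤ) ∈ telescopic T.r T.q T.jump T.e := by
  refine ⟨e 0, T.expAt e, by positivity, fun l hl => ?_, T.weight_eq hX hs h0 e⟩
  rw [T.q_fin ⟨l, hl⟩, T.expAt_fin e ⟨l, hl⟩]
  exact he.2 _

omit [Fact p.Prime] [CharP k p] in
theorem exists_weight_eq (h0 : 0 < T.r) {n : ℤ} (hn : n ∈ telescopic T.r T.q T.jump T.e) :
    ∃ e ∈ T.reducedExp T.r, (T.weight e : ℤ) = n := by
  obtain ⟨a, x, ha, hx, rfl⟩ := hn
  refine ⟨Finsupp.equivFunOnFinite.symm (Fin.cons a.toNat fun i => x i), ⟨?_, ?_⟩, ?_⟩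
  · intro j hj
    omega
  · intro j
    simp only [Finsupp.equivFunOnFinite_symm_apply_apply, Fin.cons_succ]
    rw [← T.q_fin]
    exact hx j j.2
  · rw [T.weight_eq hX hs h0]
    simp only [Finsupp.equivFunOnFinite_symm_apply_apply, Fin.cons_zero]
    rw [Int.toNat_of_nonneg ha]
    refine congrArg _ (Finset.sum_congr rfl fun l hl => ?_)
    rw [T.expAt_fin _ ⟨l, Finset.mem_range.1 hl⟩]
    simp only [Finsupp.equivFunOnFinite_symm_apply_apply, Fin.cons_succ]

/-- The exponents of the reduced monomials that give holomorphic differentials. -/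
def holExp : Set (Fin (T.r + 1) →₀ ℕ) :=
  {e | e ∈ T.reducedExp T.r ∧ (T.weight e : ℤ) ≤ T.canDeg}

/-- Polynomials in the generators, as multiples of `d f_0`. -/
def toDiff : MvPolynomial (Fin (T.r + 1)) k →ₗ[k] Ω[F⁄k] :=
  ((LinearMap.toSpanSingleton F (Ω[F⁄k]) (KaehlerDifferential.D k F (T.f 0))).restrictScalars
    k).comp (MvPolynomial.aeval T.f).toLinearMap

omit hX hs [Fact p.Prime] [CharP k p] [IsAlgClosed k] in
theorem toDiff_apply (c : MvPolynomial (Fin (T.r + 1)) k) :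
    T.toDiff c = MvPolynomial.aeval T.f c • KaehlerDifferential.D k F (T.f 0) := rfl

/-- No cancellation of pole orders: a reduced polynomial has pole order at most `canDeg` exactly
when each of its monomials has. -/
theorem map_toDiff (h0 : 0 < T.r) :
    (MvPolynomial.restrictSupport k T.holExp).map T.toDiff = holomorphic k F := by
  have hU := isUnif hX hs
  have hlast : T.Γ T.r = ⊥ := T.Γ_of_le le_rfl
  ext w
  rw [T.mem_holomorphic_iff hX hs h0, Submodule.mem_map]
  constructor
  · rintro ⟨c, hc, rfl⟩
    refine ⟨_, ?_, ?_, T.toDiff_apply c⟩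
    · rw [aeval_eq_sum]
      refine sum_mem fun e _ => ?_
      rw [Algebra.smul_def]
      exact mul_mem (algebraMap_mem_regularOutside P _)
        (prod_mem fun j _ => pow_mem (T.f_mem_regularOutside hX j) _)
    · rw [aeval_eq_sum]
      refine Valuation.map_sum_le _ fun e he => ?_
      rw [Algebra.smul_def, map_mul, valuation_algebraMap P.algebraMap_mem
        (MvPolynomial.mem_support_iff.1 he), one_mul, T.valuation_monomial hX hs h0,
        hU.zpow_le_zpow]
      have := (hc he).2
      omega
  · rintro ⟨h, hR, hv, rfl⟩
    obtain ⟨c, hc, rfl⟩ := T.exists_reduced hX hs h0 le_rfl hR (by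
      rw [hlast, IntermediateField.fixedField_bot]; trivial)
    refine ⟨c, fun e he => ⟨hc he, ?_⟩, T.toDiff_apply c⟩
    have h1 := (T.valuation_le_aeval hX hs h0 (fun e he => (hc he).2) he).trans hv
    rw [hU.zpow_le_zpow] at h1
    omega

theorem genus_eq_card (h0 : 0 < T.r) : genus k F = Nat.card T.holExp := by
  have hinj : Function.Injective
      (T.toDiff.domRestrict (MvPolynomial.restrictSupport k T.holExp)) := by
    intro c c' h
    have h1 : T.toDiff c = T.toDiff c' := h
    rw [toDiff_apply, toDiff_apply] at h1
    exact Subtype.ext (T.aeval_injOn hX hs h0 (fun e he => (c.2 he).1.2)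
      (fun e he => (c'.2 he).1.2) (smul_left_injective F (T.D_f_zero_ne_zero hX) h1))
  have h1 : holomorphic k F =
      LinearMap.range (T.toDiff.domRestrict (MvPolynomial.restrictSupport k T.holExp)) := by
    rw [LinearMap.range_domRestrict, T.map_toDiff hX hs h0]
  have h2 := LinearMap.finrank_range_of_inj hinj
  have h3 := Module.finrank_eq_nat_card_basis (MvPolynomial.basisRestrictSupport k T.holExp)
  rw [genus, h1, h2, h3]

open Classical in
theorem card_holExp (h0 : 0 < T.r) : Nat.card T.holExp =
    ((Finset.Icc 0 T.canDeg).filter (· ∈ telescopic T.r T.q T.jump T.e)).card := by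
  rw [← Nat.card_eq_finsetCard]
  have hmem : ∀ e : T.holExp, (T.weight e.1 : ℤ) ∈
      (Finset.Icc 0 T.canDeg).filter (· ∈ telescopic T.r T.q T.jump T.e) := fun e => by
    rw [Finset.mem_filter, Finset.mem_Icc]
    exact ⟨⟨by positivity, e.2.2⟩, T.weight_mem_telescopic hX hs h0 e.2.1⟩
  refine Nat.card_congr (Equiv.ofBijective (fun e => ⟨T.weight e.1, hmem e⟩) ⟨?_, ?_⟩)
  · intro e e' h
    have h1 : (T.weight e.1 : ℤ) = T.weight e'.1 := congrArg Subtype.val h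
    exact Subtype.ext (T.weight_inj hX hs h0 e.2.1.2 e'.2.1.2 (by exact_mod_cast h1))
  · rintro ⟨n, hn⟩
    have hn' := hn
    rw [Finset.mem_filter, Finset.mem_Icc] at hn'
    obtain ⟨e, he, h⟩ := T.exists_weight_eq hX hs h0 hn'.2
    exact ⟨⟨e, he, h ▸ hn'.1.2⟩, Subtype.ext h⟩

/-- The genus formula. -/
theorem two_mul_genus (h0 : 0 < T.r) : 2 * (genus k F : ℤ) = T.canDeg + 2 := by
  classical
  rw [T.genus_eq_card hX hs h0, T.card_holExp hX hs h0]
  refine telescopic_card (q := T.q) (b := T.jump) (e := T.e) (fun l hl => T.e_eq hX hs hl) (fun l hl => T.coprime_q_jump hX hs hl)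
    T.e_last (fun l hl => by have := T.two_le_q hX hs hl; omega) ?_ (T.neg_two_le_canDeg hX hs)
  rw [canDeg]
  ring

end Tower

end Differentials

end HKG

namespace HKG
open Polynomial

/-! ### Maps of small degree to the line -/

section Degree

variable {k L : Type*} [Field k] [Field L] [Algebra k L]

/-- Over k(x) the element y is a root of E - A(x), of degree deg E, and it generates L. The
positivity excludes the default value 0 of an infinite rank. -/
theorem finrank_adjoin_le_of_aeval_eq {x y : L} (htop : IntermediateField.adjoin k {x, y} = ⊤)
    {A E : k[X]} (h : aeval x A = aeval y E) (hE : 0 < E.natDegree) :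
    Module.finrank (IntermediateField.adjoin k {x}) L ≤ E.natDegree ∧
      0 < Module.finrank (IntermediateField.adjoin k {x}) L := by
  set K := IntermediateField.adjoin k {x}
  let a : K := aeval (IntermediateField.AdjoinSimple.gen k x) A
  have ha : (algebraMap K L a) = aeval x A := by
    rw [← aeval_algebraMap_apply, IntermediateField.AdjoinSimple.algebraMap_gen]
  set B : K[X] := E.map (algebraMap k K) - C a with hB
  have hBdeg : B.natDegree = E.natDegree := by rw [hB, natDegree_sub_C, natDegree_map]
  have hB0 : B ≠ 0 := by
    rintro h0
    rw [h0, natDegree_zero] at hBdeg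
    omega
  have hBy : aeval y B = 0 := by
    rw [hB, map_sub, aeval_map_algebraMap, aeval_C, ha, h, sub_self]
  have hint : IsIntegral K y := (isAlgebraic_iff_isIntegral).1 ⟨B, hB0, hBy⟩
  have htop' : IntermediateField.adjoin K {y} = ⊤ := by
    rw [← IntermediateField.restrictScalars_eq_top_iff (K := k),
      IntermediateField.adjoin_simple_adjoin_simple, htop]
  have hrank : Module.finrank K L = (minpoly K y).natDegree := by
    rw [← IntermediateField.adjoin.finrank hint, htop', IntermediateField.finrank_top']
  rw [hrank, ← hBdeg]
  refine ⟨natDegree_le_natDegree (minpoly.degree_le_of_ne_zero K y hB0 hBy), minpoly.natDegree_pos hint⟩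

variable [IsAlgClosed k]

theorem exists_algebraMap_eq_of_forall_place {y : L} (h : ∀ Q : Place k L, y ∈ Q.ring) :
    ∃ c : k, algebraMap k L c = y := by
  refine algebraic_mem_range fun hy => ?_
  have hy' : Transcendental k y⁻¹ := by
    rwa [Transcendental, IsAlgebraic.inv_iff]
  obtain ⟨Q, -, hQ⟩ := exists_place_inv_notMem hy'
  rw [inv_inv] at hQ
  exact hQ (h Q)

/-- The line carries no holomorphic differentials. -/
theorem holomorphic_eq_bot {z : L} (hz : Transcendental k z)
    (htop : IntermediateField.adjoin k {z} = ⊤) : holomorphic k L = ⊥ := by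
  have htr : TrdegLeOne k L := by
    refine trdegLeOne_of_adjoin (x := z) ?_
    rw [htop]
    exact ⟨fun y => isAlgebraic_algebraMap (⟨y, trivial⟩ : (⊤ : IntermediateField k L))⟩
  have hz0 : z ≠ 0 := fun h => hz (h ▸ isAlgebraic_zero)
  rw [eq_bot_iff]
  intro w hw
  rw [mem_holomorphic] at hw
  rw [Submodule.mem_bot]
  have hfin : ∀ Q : Place k L, z ∈ Q.ring →
      ∃ h ∈ Q.ring, w = h • KaehlerDifferential.D k L z := by
    intro Q hQ
    refine exists_smul_of_mem_regularAt (fun a ha => ?_) (hw Q)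
    obtain ⟨c, h1, h2⟩ := exists_generator_mem htr Q.algebraMap_mem Q.ne_top hQ
    have hne : z - algebraMap k L c ≠ 0 := fun h => hz (by
      rw [sub_eq_zero.1 h]; exact isAlgebraic_algebraMap c)
    obtain ⟨a', ha', h3⟩ := exists_D_eq_smul Q.algebraMap_mem h1 hne
      (by rw [h2, htop]; trivial) ha
    exact ⟨a', ha', by simpa using h3⟩
  obtain ⟨Q, hQ, -⟩ := exists_place_inv_notMem hz
  obtain ⟨h, -, hwh⟩ := hfin Q hQ
  by_cases hD : KaehlerDifferential.D k L z = 0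
  · rw [hwh, hD, smul_zero]
  by_cases hh0 : h = 0
  · rw [hwh, hh0, zero_smul]
  exfalso
  -- At infinity dz = -z² d(1/z), so h vanishes there doubly and even hz is regular. Both are then
  -- constants, and so is their quotient z.
  have key : ∀ Q : Place k L, h ∈ Q.ring ∧ h * z ∈ Q.ring := by
    intro Q
    by_cases hQ : z ∈ Q.ring
    · obtain ⟨h', hh', hwh'⟩ := hfin Q hQ
      rw [hwh] at hwh'
      rw [smul_left_injective L hD hwh']
      exact ⟨hh', mul_mem hh' hQ⟩
    · have hπ : Q.ring.valuation z⁻¹ < 1 := by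
        rwa [valuation_lt_one_iff_inv (inv_ne_zero hz0), inv_inv]
      obtain ⟨g, hg, hwg⟩ := exists_smul_of_mem_regularAt (fun a ha =>
        exists_D_eq_smul Q.algebraMap_mem hπ (inv_ne_zero hz0)
          (by rw [adjoin_inv, htop]; trivial) ha) (hw Q)
      have hπQ := mem_of_valuation_lt_one hπ
      rw [hwh, Derivation.leibniz_inv, smul_smul] at hwg
      have h1 := smul_left_injective L hD hwg
      constructor
      · rw [h1]
        exact mul_mem hg (neg_mem (pow_mem hπQ 2))
      · have h2 : h * z = -(g * z⁻¹) := by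
          rw [h1]
          field_simp
        rw [h2]
        exact neg_mem (mul_mem hg hπQ)
  obtain ⟨c, hc⟩ := exists_algebraMap_eq_of_forall_place fun Q => (key Q).1
  obtain ⟨c', hc'⟩ := exists_algebraMap_eq_of_forall_place fun Q => (key Q).2
  apply hz
  have : z = algebraMap k L (c' / c) := by
    rw [map_div₀, hc, hc', mul_div_cancel_left₀ _ hh0]
  rw [this]
  exact isAlgebraic_algebraMap _

theorem four_le_of_finrank_le (hgenus : 3 ≤ genus k L) (hhyp : ¬ IsHyperelliptic k L)
    (htrig : ¬ IsTrigonal k L) {x : L} (hx : Transcendental k x) {n : ℕ}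
    (h : Module.finrank (IntermediateField.adjoin k {x}) L ≤ n ∧
      0 < Module.finrank (IntermediateField.adjoin k {x}) L) : 4 ≤ n := by
  by_contra hn
  obtain ⟨h1, h2⟩ := h
  have h3 : Module.finrank (IntermediateField.adjoin k {x}) L = 1 ∨
      Module.finrank (IntermediateField.adjoin k {x}) L = 2 ∨
      Module.finrank (IntermediateField.adjoin k {x}) L = 3 := by omega
  rcases h3 with h3 | h3 | h3
  · have htop := IntermediateField.finrank_eq_one_iff_eq_top.1 h3
    rw [genus, holomorphic_eq_bot hx htop, finrank_bot] at hgenus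
    omega
  · exact hhyp ⟨by omega, x, hx, h3⟩
  · exact htrig ⟨x, hx, h3⟩

end Degree

/-! ### The equation of the lowest step and the gonality bound -/

section FirstStep

variable {k F : Type*} [Field k] [Field F] [Algebra k F]
  {p : ℕ} {G : Subgroup (F ≃ₐ[k] F)} {P : Place k F}

namespace Tower

variable (T : Tower p G P)

/-- The additive polynomial of a step. -/
def addPoly (i : Fin T.r) : k[X] :=
  X ^ p ^ T.n i + ∑ j : Fin (T.n i), C (T.a i j) * X ^ p ^ (j : ℕ)

theorem aeval_addPoly (i : Fin T.r) (y : F) : aeval y (T.addPoly i) =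
    y ^ p ^ T.n i + ∑ j : Fin (T.n i), algebraMap k F (T.a i j) * y ^ p ^ (j : ℕ) := by
  simp [addPoly]

theorem D_eq_aeval (i : Fin T.r) : T.D i = aeval (T.f i.succ) (T.addPoly i) :=
  (T.aeval_addPoly i _).symm

theorem natDegree_addPoly [Fact p.Prime] (i : Fin T.r) : (T.addPoly i).natDegree = p ^ T.n i := by
  rw [addPoly, natDegree_add_eq_left_of_degree_lt, natDegree_X_pow]
  rw [degree_X_pow]
  refine (degree_sum_le _ _).trans_lt ((Finset.sup_lt_iff (WithBot.bot_lt_coe _)).2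
    fun j _ => (degree_C_mul_X_pow_le _ _).trans_lt ?_)
  exact_mod_cast Nat.pow_lt_pow_right (Fact.out : p.Prime).one_lt j.2

variable [IsAlgClosed k] {s : P.ring} (hX : IsHKGCover p G P)
  (hs : IsLocalRing.maximalIdeal P.ring = Ideal.span {s})

include hX hs

theorem valuation_aeval_f_zero (h0 : 0 < T.r) {A : k[X]} (hA : A ≠ 0) :
    P.ring.valuation (aeval (T.f 0) A) =
      P.ring.valuation (s : F) ^ (-((A.natDegree * T.e 0 : ℕ) : ℤ)) := by
  have hU := isUnif hX hs
  have hpos : 0 < T.e 0 := by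
    have := T.finite_Γ hX 0
    exact Nat.card_pos
  have hterm : ∀ n ∈ A.support, P.ring.valuation (A.coeff n • T.f 0 ^ n) =
      P.ring.valuation (s : F) ^ (-((n * T.e 0 : ℕ) : ℤ)) := by
    intro n hn
    rw [Algebra.smul_def, map_mul, valuation_algebraMap P.algebraMap_mem (mem_support_iff.1 hn),
      one_mul, map_pow, T.valuation_f_zero hX hs h0, ← zpow_natCast, ← zpow_mul]
    congr 1
    push_cast
    ring
  rw [aeval_eq_sum_range, ← Finset.sum_subset (supp_subset_range_natDegree_succ (p := A))
    (fun n _ hn => by rw [notMem_support_iff.1 hn, zero_smul])]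
  apply le_antisymm
  · refine Valuation.map_sum_le _ fun n hn => ?_
    rw [hterm n hn, hU.zpow_le_zpow]
    have := Nat.mul_le_mul_right (T.e 0) (le_natDegree_of_mem_supp n hn)
    omega
  · rw [← hterm _ (natDegree_mem_support_of_nonzero hA)]
    refine valuation_le_sum _ (fun n => A.coeff n • T.f 0 ^ n) ?_ _
      (natDegree_mem_support_of_nonzero hA)
    intro i hi j hj _ _ hij
    rw [hterm i hi, hterm j hj] at hij
    have h1 := hU.zpow_inj hij
    exact Nat.eq_of_mul_eq_mul_right hpos (by omega)

variable [Fact p.Prime] [CharP k p]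

/-- The leading power of f_i strictly dominates, since f_i has a genuine pole. -/
theorem valuation_D (i : Fin T.r) : P.ring.valuation (T.D i) =
    P.ring.valuation (s : F) ^ (-((p ^ T.n i * T.m i : ℕ) : ℤ)) := by
  have hU := isUnif hX hs
  have hf : P.ring.valuation (T.f i.succ) = P.ring.valuation (s : F) ^ (-(T.m i : ℤ)) := by
    rw [T.valuation_f hX hs, T.m_eq hX hs]
  have hm : 0 < T.m i := by
    rw [T.m_eq hX hs]
    have := T.finite_Γ hX (i + 1)
    refine Nat.mul_pos Nat.card_pos ?_
    rw [T.jump_fin]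
    exact T.one_le_jump hX hs i
  have hpow : ∀ n : ℕ, P.ring.valuation (T.f i.succ ^ n) =
      P.ring.valuation (s : F) ^ (-((n * T.m i : ℕ) : ℤ)) := by
    intro n
    rw [map_pow, hf, ← zpow_natCast, ← zpow_mul]
    congr 1
    push_cast
    ring
  rw [D, Valuation.map_add_eq_of_lt_left, hpow]
  rw [hpow]
  refine Valuation.map_sum_lt _ (zpow_ne_zero _ hU.val_pos.ne') fun j _ => ?_
  rw [map_mul, hpow]
  refine lt_of_le_of_lt (mul_le_of_le_one_left' (valuation_le_one.2 (P.algebraMap_mem _))) ?_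
  rw [← not_le, hU.zpow_le_zpow, not_le]
  have := (Nat.mul_lt_mul_right hm).2
    (Nat.pow_lt_pow_right (Fact.out : p.Prime).one_lt j.2)
  omega

omit hs [Fact p.Prime] [CharP k p] in
theorem D_mem_regularOutside (i : Fin T.r) : T.D i ∈ regularOutside P :=
  add_mem (pow_mem (T.f_mem_regularOutside hX _) _) (sum_mem fun _ _ =>
    mul_mem (algebraMap_mem_regularOutside P _) (pow_mem (T.f_mem_regularOutside hX _) _))

/-- The equation of the first step. -/
theorem exists_first_equation (h0 : 0 < T.r) : ∃ A : k[X], A.natDegree = T.jump 0 ∧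
    aeval (T.f 0) A = T.D ⟨0, h0⟩ := by
  have hU := isUnif hX hs
  have h1 := T.D_mem_fixedField ⟨0, h0⟩
  change _ ∈ IntermediateField.fixedField (T.Γ 0) at h1
  rw [T.Γ_zero hX h0, T.f_zero] at h1
  obtain ⟨A, hA⟩ := exists_aeval_of_mem_regularOutside T.transcendental_f_zero T.f_zero_pole h1
    (T.D_mem_regularOutside hX _)
  have h2 := T.valuation_D hX hs ⟨0, h0⟩
  have hA0 : A ≠ 0 := by
    rintro rfl
    rw [← hA, map_zero, map_zero] at h2
    exact zpow_ne_zero _ hU.val_pos.ne' h2.symm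
  refine ⟨A, ?_, hA⟩
  rw [← hA, T.valuation_aeval_f_zero hX hs h0 hA0] at h2
  have h3 := hU.zpow_inj h2
  have hpos : 0 < T.e 0 := by
    have := T.finite_Γ hX 0
    exact Nat.card_pos
  refine Nat.eq_of_mul_eq_mul_right hpos ?_
  have h4 : p ^ T.n ⟨0, h0⟩ * T.m ⟨0, h0⟩ = T.jump 0 * T.e 0 := by
    rw [T.m_eq hX hs, T.e_eq hX hs h0, ← T.q_fin ⟨0, h0⟩]
    ring
  omega

omit [IsAlgClosed k] hs [Fact p.Prime] [CharP k p] in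
theorem upper_zero_eq (h0 : 0 < T.r) : T.upper ⟨0, h0⟩ =
    IntermediateField.adjoin k {T.f 0, T.f (Fin.succ ⟨0, h0⟩)} := by
  rw [upper, T.f_gen, ← T.Γ_fin, Set.insert_eq, IntermediateField.adjoin_union, ← T.f_zero]
  exact congrArg (fun H => IntermediateField.fixedField H ⊔ _) (T.Γ_zero hX h0)

theorem four_le_q_and_jump (h0 : 0 < T.r) (hgenus : 3 ≤ genus k (T.upper ⟨0, h0⟩))
    (hhyp : ¬ IsHyperelliptic k (T.upper ⟨0, h0⟩)) (htrig : ¬ IsTrigonal k (T.upper ⟨0, h0⟩)) :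
    4 ≤ T.q 0 ∧ 4 ≤ T.jump 0 := by
  obtain ⟨A, hA, hAD⟩ := T.exists_first_equation hX hs h0
  have hupper := T.upper_zero_eq hX h0
  set L := T.upper ⟨0, h0⟩ with hL
  have hxL : T.f 0 ∈ L := by
    rw [hupper]
    exact IntermediateField.subset_adjoin _ _ (Set.mem_insert _ _)
  have hyL : T.f (Fin.succ ⟨0, h0⟩) ∈ L := by
    rw [hupper]
    exact IntermediateField.subset_adjoin _ _ (Set.mem_insert_of_mem _ rfl)
  set x : L := ⟨T.f 0, hxL⟩ with hx
  set y : L := ⟨T.f (Fin.succ ⟨0, h0⟩), hyL⟩ with hy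
  have htop : IntermediateField.adjoin k {x, y} = ⊤ := by
    apply IntermediateField.lift_injective L
    rw [IntermediateField.lift_adjoin, IntermediateField.lift_top, Set.image_pair]
    exact hupper.symm
  have heq : aeval x A = aeval y (T.addPoly ⟨0, h0⟩) := by
    apply (algebraMap L F).injective
    rw [← aeval_algebraMap_apply, ← aeval_algebraMap_apply]
    exact hAD.trans (T.D_eq_aeval _)
  have htrx : Transcendental k x := fun h =>
    T.transcendental_f_zero (by simpa using h.algebraMap (A := F))
  have htry : Transcendental k y := fun h => by
    have h1 := h.algebraMap (A := F)
    obtain ⟨c, hc⟩ := algebraic_mem_range (not_not.2 h1)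
    replace hc : algebraMap k F c = T.f (Fin.succ ⟨0, h0⟩) := hc
    have h2 := T.valuation_f hX hs ⟨0, h0⟩
    have h3 : P.ring.valuation (T.f (Fin.succ ⟨0, h0⟩)) ≤ 1 :=
      valuation_le_one.2 (hc ▸ P.algebraMap_mem c)
    rw [h2, (isUnif hX hs).zpow_le_one] at h3
    have h4 := T.one_le_jump hX hs ⟨0, h0⟩
    rw [← T.jump_fin] at h4
    have := T.finite_Γ hX (0 + 1)
    have h5 : 0 < T.e (0 + 1) := Nat.card_pos
    have h6 := Nat.mul_pos h5 h4
    simp only at h3 h6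
    omega
  have hq : (T.addPoly ⟨0, h0⟩).natDegree = T.q 0 := by
    rw [natDegree_addPoly]
    exact (T.q_fin ⟨0, h0⟩).symm
  constructor
  · refine four_le_of_finrank_le hgenus hhyp htrig htrx (n := T.q 0) ?_
    rw [← hq]
    refine finrank_adjoin_le_of_aeval_eq htop heq ?_
    have := T.two_le_q hX hs h0
    omega
  · refine four_le_of_finrank_le hgenus hhyp htrig htry (n := T.jump 0) ?_
    rw [← hA]
    refine finrank_adjoin_le_of_aeval_eq (by rwa [Set.pair_comm]) heq.symm ?_
    have h4 := T.one_le_jump hX hs ⟨0, h0⟩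
    rw [← T.jump_fin] at h4
    simp only at h4
    omega

end Tower

end FirstStep

end HKG

namespace HKG

/-! ### Smooth plane quintics -/

open MvPolynomial in
/-- The homogenization of `y ^ 4 + α y ^ 2 + β y - A(x)`, for `A` of degree five. -/
def quinticForm {k : Type*} [Field k] (α β : k) (A : Polynomial k) : MvPolynomial (Fin 3) k :=
  X 1 ^ 4 * X 2 + C α * X 1 ^ 2 * X 2 ^ 3 + C β * X 1 * X 2 ^ 4 -
    (C (A.coeff 0) * X 2 ^ 5 + C (A.coeff 1) * X 0 * X 2 ^ 4 + C (A.coeff 2) * X 0 ^ 2 * X 2 ^ 3 +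
      C (A.coeff 3) * X 0 ^ 3 * X 2 ^ 2 + C (A.coeff 4) * X 0 ^ 4 * X 2 +
      C (A.coeff 5) * X 0 ^ 5)

open Polynomial

section Quintic

variable {k F : Type*} [Field k] [Field F] [Algebra k F]

/-- In characteristic 2 the y-derivative is β times the fourth power of the last coordinate, nonzero
at affine points. At infinity the form reduces to the leading term of A, which leaves the point (0 :
1 : 0), and there the derivative in the last coordinate is nonzero. -/
theorem isPlaneQuintic_of_equation [CharP k 2] {x y : F} {α β : k} {A : k[X]}
    (hA : A.natDegree = 5) (hβ : β ≠ 0) (htop : IntermediateField.adjoin k {x, y} = ⊤)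
    (h : aeval x A = y ^ 4 + algebraMap k F α * y ^ 2 + algebraMap k F β * y) :
    IsPlaneQuintic k F := by
  have h2 : (2 : k) = 0 := CharP.cast_eq_zero k 2
  have h4 : (4 : k) = 0 := by linear_combination 2 * h2
  have ha5 : A.coeff 5 ≠ 0 := by
    rw [← hA]
    exact leadingCoeff_ne_zero.2 (ne_zero_of_natDegree_gt (n := 0) (by omega))
  refine ⟨quinticForm α β A, x, y, ?_, ?_, htop, ?_⟩
  · have hX : ∀ (i : Fin 3) (n : ℕ), (MvPolynomial.X i ^ n : MvPolynomial (Fin 3) k).IsHomogeneous n :=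
      fun i n => by simpa using (MvPolynomial.isHomogeneous_X k i).pow n
    have hC : ∀ c : k, (MvPolynomial.C c : MvPolynomial (Fin 3) k).IsHomogeneous 0 :=
      fun c => MvPolynomial.isHomogeneous_C _ c
    have hX1 : ∀ i : Fin 3, (MvPolynomial.X i : MvPolynomial (Fin 3) k).IsHomogeneous 1 :=
      fun i => MvPolynomial.isHomogeneous_X k i
    exact ((((hX 1 4).mul (hX1 2)).add (((hC _).mul (hX 1 2)).mul (hX 2 3))).add
      (((hC _).mul (hX1 1)).mul (hX 2 4))).sub
      (((((((hC _).mul (hX 2 5)).add (((hC _).mul (hX1 0)).mul (hX 2 4))).add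
        (((hC _).mul (hX 0 2)).mul (hX 2 3))).add (((hC _).mul (hX 0 3)).mul (hX 2 2))).add
        (((hC _).mul (hX 0 4)).mul (hX1 2))).add ((hC _).mul (hX 0 5)))
  · intro z hz hQ
    by_cases hz2 : z 2 = 0
    · refine ⟨2, ?_⟩
      simp [quinticForm, hz2, ha5] at hQ
      have hz1 : z 1 ≠ 0 := by
        intro hz1
        apply hz
        ext j
        fin_cases j
        · exact hQ
        · exact hz1
        · exact hz2
      simp [quinticForm, MvPolynomial.pderiv_X, Derivation.leibniz, Derivation.leibniz_pow, hz2, hQ, hz1]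
    · refine ⟨1, ?_⟩
      simp [quinticForm, MvPolynomial.pderiv_X, Derivation.leibniz, Derivation.leibniz_pow, h2, h4, hβ, hz2]
  · rw [aeval_eq_sum_range, hA] at h
    simp only [Finset.sum_range_succ, Finset.sum_range_zero, Algebra.smul_def] at h
    simp only [quinticForm, map_sub, map_add, map_mul, map_pow, MvPolynomial.aeval_X, MvPolynomial.aeval_C,
      Matrix.cons_val_zero, Matrix.cons_val_one, Matrix.cons_val]
    linear_combination -h

end Quintic

/-! ### Splitting the monomials of D_i -/

section Expressions

variable {k F : Type*} [Field k] [Field F] [Algebra k F]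
  {p : ℕ} {G : Subgroup (F ≃ₐ[k] F)} {P : Place k F}

namespace Tower

variable (T : Tower p G P)

theorem weight_single_zero (n : ℕ) : T.weight (Finsupp.single 0 n) = n * Nat.card G := by
  simp [weight]

theorem weight_single_succ (i : Fin T.r) : T.weight (Finsupp.single i.succ 1) = T.m i := by
  classical
  simp [weight, Finsupp.single_apply]

/-- Greedy splitting of a monomial into two monomials of small weight. -/
theorem exists_split {d M : ℤ} (hd : 0 ≤ d) {e : Fin (T.r + 1) →₀ ℕ} (he : T.weight e ≤ M)
    (hj : ∀ j, e j ≠ 0 → T.weight (Finsupp.single j 1) + M ≤ 2 * d + 1) :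
    ∃ L K, (T.weight L : ℤ) ≤ d ∧ (T.weight K : ℤ) ≤ d ∧ L + K = e := by
  classical
  -- Take a maximal divisor L of weight at most d. One more generator from the complement K exceeds
  -- d, so the weight of K is below M - d plus the weight of that generator, hence at most d.
  obtain ⟨L, hL⟩ := ((Finset.Iic e).filter fun L => (T.weight L : ℤ) ≤ d).exists_maximal
    ⟨0, by simp [weight, hd]⟩
  obtain ⟨hLe, hLd⟩ := Finset.mem_filter.1 hL.prop
  rw [Finset.mem_Iic] at hLe
  obtain ⟨K, rfl⟩ := exists_add_of_le hLe
  refine ⟨L, K, hLd, ?_, rfl⟩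
  rw [weight_add] at he
  push_cast at he
  by_cases hK : K = 0
  · subst hK
    simpa [weight] using hd
  obtain ⟨j, hjK⟩ := Finsupp.ne_iff.1 hK
  have h1 := hj j (by rw [Finsupp.add_apply]; simp at hjK; omega)
  have h2 : ¬ (T.weight (L + Finsupp.single j 1) : ℤ) ≤ d := by
    intro h
    have h3 := hL.le_of_ge (y := L + Finsupp.single j 1) (Finset.mem_filter.2 ⟨Finset.mem_Iic.2
      (add_le_add le_rfl ?_), h⟩) (le_add_of_nonneg_right zero_le)
    · have h4 := h3 j
      simp at h4
    · rw [Finsupp.single_le_iff]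
      simp at hjK
      omega
  rw [weight_add] at h2
  push_cast at h2
  linarith

variable [IsAlgClosed k] {s : P.ring} (hX : IsHKGCover p G P)
  (hs : IsLocalRing.maximalIdeal P.ring = Ideal.span {s}) [Fact p.Prime] [CharP k p]

include hX hs

theorem isPlaneQuintic (hr : T.r = 1) (hq : T.q 0 = 4) (hb : T.jump 0 = 5) :
    IsPlaneQuintic k F := by
  have h0 : 0 < T.r := by omega
  set i : Fin T.r := ⟨0, h0⟩
  have hq' : p ^ T.n i = 4 := by rw [← T.q_fin]; exact hq
  have hp2 : ∀ p n : ℕ, p.Prime → p ^ n = 4 → p = 2 ∧ n = 2 := by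
    intro p n hp hpn
    have hne : n ≠ 0 := by rintro rfl; norm_num at hpn
    have h1 : p ∣ 2 ^ 2 := by
      have := dvd_pow_self p hne
      rw [hpn] at this
      simpa using this
    obtain rfl : p = 2 := (Nat.prime_dvd_prime_iff_eq hp Nat.prime_two).1 (hp.dvd_of_dvd_pow h1)
    exact ⟨rfl, Nat.pow_right_injective (le_refl 2) (by simpa using hpn)⟩
  obtain ⟨rfl, hn⟩ := hp2 p _ Fact.out hq'
  obtain ⟨α, β, hαβ⟩ : ∃ α β : k, T.addPoly i = X ^ 4 + C α * X ^ 2 + C β * X := by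
    have key : ∀ (n : ℕ) (a : Fin n → k), n = 2 → ∃ α β : k,
        (X ^ 2 ^ n + ∑ j : Fin n, C (a j) * X ^ 2 ^ (j : ℕ) : k[X]) =
          X ^ 4 + C α * X ^ 2 + C β * X := by
      rintro n a rfl
      refine ⟨a 1, a 0, ?_⟩
      rw [Fin.sum_univ_two]
      simp
      ring
    exact key _ _ hn
  obtain ⟨A, hA, hAD⟩ := T.exists_first_equation hX hs h0
  rw [hb] at hA
  rw [T.D_eq_aeval, show (⟨0, h0⟩ : Fin T.r) = i from rfl, hαβ] at hAD
  have h2 : (2 : k) = 0 := CharP.cast_eq_zero k 2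
  have htop : IntermediateField.adjoin k {T.f 0, T.f i.succ} = ⊤ := by
    rw [← T.upper_zero_eq hX h0, upper, ← T.Γ_succ hX hs, T.Γ_of_le (by simp [hr]),
      IntermediateField.fixedField_bot]
  refine isPlaneQuintic_of_equation (α := α) (β := β) hA ?_ htop (hAD.trans (by simp))
  -- If β = 0, the right side is a polynomial in squares and its differential vanishes. Then A' = 0,
  -- although the coefficient 5 a₅ = a₅ of A' is nonzero.
  rintro rfl
  have h3 := congrArg (KaehlerDifferential.D k F) hAD
  rw [Derivation.map_aeval, Derivation.map_aeval] at h3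
  have h4 : derivative (X ^ 4 + C α * X ^ 2 + C 0 * X : k[X]) = 0 := by
    simp only [derivative_add, derivative_mul, derivative_C, derivative_X_pow]
    have h5 : (C (2 : k) : k[X]) = 0 := by rw [h2, C_0]
    have h6 : ((4 : ℕ) : k) = 0 := by push_cast; linear_combination 2 * h2
    have h7 : ((2 : ℕ) : k) = 0 := by push_cast; exact h2
    rw [h6, h7]
    simp
  rw [h4, map_zero, zero_smul, smul_eq_zero_iff_left (T.D_f_zero_ne_zero hX)] at h3
  have h5 := (transcendental_iff.1 T.transcendental_f_zero) _ h3
  have h6 := congrArg (fun q => coeff q 4) h5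
  simp only [coeff_derivative, coeff_zero] at h6
  have h7 : A.coeff 5 = 0 := by
    push_cast at h6
    linear_combination h6 - 2 * A.coeff 5 * h2
  rw [← hA] at h7
  have : A ≠ 0 := ne_zero_of_natDegree_gt (n := 0) (by omega)
  exact this (leadingCoeff_eq_zero.1 h7)

theorem pole_le (h0 : 0 < T.r) (h4 : 4 ≤ T.q 0 ∧ 4 ≤ T.jump 0) (i : Fin T.r) :
    ((p ^ T.n i * T.m i : ℕ) : ℤ) ≤ 2 * T.canDeg := by
  have h1 := pole_le_two_mul (q := T.q) (b := T.jump) (e := T.e) (d := T.canDeg)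
    (fun l hl => T.e_eq hX hs hl) (fun l hl => T.coprime_q_jump hX hs hl) T.e_last
    (fun l hl => T.two_le_q hX hs hl) h0 h4.1 h4.2 (by rw [canDeg]; ring) i.2
  rw [← T.q_fin, T.m_eq hX hs]
  push_cast
  exact h1

theorem canDeg_nonneg (h0 : 0 < T.r) (h4 : 4 ≤ T.q 0 ∧ 4 ≤ T.jump 0) : 0 ≤ T.canDeg := by
  have h1 := T.pole_le hX hs h0 h4 ⟨0, h0⟩
  have h2 : (0 : ℤ) ≤ ((p ^ T.n ⟨0, h0⟩ * T.m ⟨0, h0⟩ : ℕ) : ℤ) := by positivity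
  linarith

theorem mem_A_iff (h0 : 0 < T.r) {e : Fin (T.r + 1) →₀ ℕ} :
    e ∈ T.A ↔ (T.weight e : ℤ) ≤ T.canDeg := by
  have h1 := T.two_mul_genus hX hs h0
  rw [A, Set.mem_ofPred_eq, h1, add_sub_cancel_right]

theorem weight_le_of_isExpression {i : Fin T.r} {c : MvPolynomial (Fin (T.r + 1)) k}
    (hc : T.IsExpression i c) {e : Fin (T.r + 1) →₀ ℕ} (he : e ∈ c.support) :
    T.weight e ≤ p ^ T.n i * T.m i := by
  have h0 : 0 < T.r := Nat.lt_of_le_of_lt (Nat.zero_le _) i.2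
  have h1 := T.valuation_le_aeval hX hs h0 (fun e he => (hc.1 e he).2) he
  rw [hc.2, T.valuation_D hX hs, (isUnif hX hs).zpow_le_zpow] at h1
  omega

theorem mem_A_add_A {i : Fin T.r} (h4 : 4 ≤ T.q 0 ∧ 4 ≤ T.jump 0) (hquint : ¬ IsPlaneQuintic k F)
    {e : Fin (T.r + 1) →₀ ℕ} (hei : ∀ j, i.castSucc < j → e j = 0)
    (hw : T.weight e ≤ p ^ T.n i * T.m i) : e ∈ T.A + T.A := by
  have h0 : 0 < T.r := Nat.lt_of_le_of_lt (Nat.zero_le _) i.2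
  have hqm : p ^ T.n i * T.m i = T.q i * (T.e (i + 1) * T.jump i) := by
    rw [← T.q_fin, T.m_eq hX hs]
  suffices h : ∃ L K, (T.weight L : ℤ) ≤ T.canDeg ∧ (T.weight K : ℤ) ≤ T.canDeg ∧ L + K = e by
    obtain ⟨L, K, hL, hK, hLK⟩ := h
    exact Set.mem_add.2 ⟨L, (T.mem_A_iff hX hs h0).2 hL, K, (T.mem_A_iff hX hs h0).2 hK, hLK⟩
  rw [hqm] at hw
  rcases Nat.eq_zero_or_pos (i : ℕ) with hi | hi
  -- In the lowest step only f_0 occurs, with exponent at most the jump, and the power is cut into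
  -- two halves.
  · have he : e = Finsupp.single 0 (e 0) := by
      ext j
      refine Fin.cases ?_ (fun l => ?_) j
      · simp
      · rw [hei l.succ (by rw [Fin.lt_def, Fin.val_castSucc, Fin.val_succ]; omega),
          Finsupp.single_apply, if_neg (Fin.succ_ne_zero l).symm]
    have hhalf := half_le (q := T.q) (b := T.jump) (e := T.e) (d := T.canDeg)
      (fun l hl => T.e_eq hX hs hl) (fun l hl => T.coprime_q_jump hX hs hl) T.e_last
      (fun l hl => T.two_le_q hX hs hl) h0 h4.1 h4.2 (by rw [canDeg]; ring)
      (fun l h1 h2 => by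
        have h3 := T.b_strictMono (show (⟨0, h0⟩ : Fin T.r) < ⟨l, h2⟩ from h1)
        rw [← T.jump_fin, ← T.jump_fin] at h3
        exact Nat.succ_le_of_lt (h4.2.trans_lt h3))
      (fun h => hquint (T.isPlaneQuintic hX hs h.1 h.2.1 h.2.2))
    have hpos : 0 < T.e 0 := by
      have := T.finite_Γ hX 0
      exact Nat.card_pos
    have hn : e 0 ≤ T.jump 0 := by
      rw [he, weight_single_zero, ← T.e_zero hX h0, hi, ← mul_assoc, ← T.e_eq hX hs h0,
        mul_comm] at hw
      exact Nat.le_of_mul_le_mul_left hw hpos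
    have hle : ∀ n ≤ (T.jump 0 + 1) / 2,
        (T.weight (Finsupp.single 0 n) : ℤ) ≤ T.canDeg := by
      intro n hn
      rw [weight_single_zero, ← T.e_zero hX h0, mul_comm]
      refine le_trans ?_ hhalf
      exact_mod_cast Nat.mul_le_mul_left _ hn
    refine ⟨Finsupp.single 0 ((e 0 + 1) / 2), Finsupp.single 0 (e 0 / 2), hle _ (by omega),
      hle _ (by omega), ?_⟩
    rw [← Finsupp.single_add, he]
    congr 1
    simp only [Finsupp.single_eq_same]
    omega
  · obtain ⟨h5, h6⟩ := pole_add_le (q := T.q) (b := T.jump) (e := T.e) (d := T.canDeg)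
      (fun l hl => T.e_eq hX hs hl) T.e_last
      (fun l hl => T.two_le_q hX hs hl) h0 h4.1 h4.2 (by rw [canDeg]; ring) i.2 hi
    refine T.exists_split (T.canDeg_nonneg hX hs h0 h4) (M := T.q i * (T.e (i + 1) * T.jump i))
      (by exact_mod_cast hw) fun j => ?_
    refine Fin.cases (fun _ => ?_) (fun l hl => ?_) j
    · rw [weight_single_zero, one_mul, ← T.e_zero hX h0]
      linarith
    · have hli : (l : ℕ) < i := by
        by_contra h
        refine hl (hei l.succ ?_)
        rw [Fin.lt_def, Fin.val_castSucc, Fin.val_succ]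
        omega
      have := h6 l hli
      rw [weight_single_succ, T.m_eq hX hs]
      push_cast
      linarith

theorem existsUnique_expression (i : Fin T.r) :
    ∃! c : MvPolynomial (Fin (T.r + 1)) k, T.IsExpression i c := by
  have h0 : 0 < T.r := Nat.lt_of_le_of_lt (Nat.zero_le _) i.2
  obtain ⟨c, hc, hcD⟩ := T.exists_reduced hX hs h0 i.2.le (T.D_mem_regularOutside hX i)
    (T.D_mem_fixedField i)
  refine ⟨c, ⟨fun e he => ⟨fun j hj => (hc he).1 j hj, (hc he).2⟩, hcD⟩, fun c' hc' => ?_⟩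
  exact T.aeval_injOn hX hs h0 (fun e he => (hc'.1 e he).2) (fun e he => (hc he).2)
    (hc'.2.trans hcD.symm)

theorem ω_mem_holomorphic (h0 : 0 < T.r) {L : Fin (T.r + 1) →₀ ℕ} (hL : L ∈ T.A) :
    T.ω L ∈ holomorphic k F := by
  rw [T.mem_holomorphic_iff hX hs h0]
  refine ⟨_, prod_mem fun j _ => pow_mem (T.f_mem_regularOutside hX j) _, ?_, rfl⟩
  rw [T.mem_A_iff hX hs h0] at hL
  rw [T.valuation_monomial hX hs h0, (isUnif hX hs).zpow_le_zpow]
  omega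

omit [IsAlgClosed k] hX hs [Fact p.Prime] [CharP k p] in
theorem ω_tmul_ω (L K : Fin (T.r + 1) →₀ ℕ) : T.ω L ⊗ₜ[F] T.ω K =
    (∏ j, T.f j ^ (L + K) j) •
      (KaehlerDifferential.D k F (T.f 0) ⊗ₜ[F] KaehlerDifferential.D k F (T.f 0)) := by
  rw [ω, ω, TensorProduct.smul_tmul_smul, ← Finset.prod_mul_distrib]
  simp only [Finsupp.add_apply, pow_add]

end Tower

end Expressions

end HKG

end

/-! ### The main theorem -/

theorem lemma4p3 {k : Type*} {F : Type*} [Field k] [IsAlgClosed k] [Field F] [Algebra k F]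
    (p : ℕ) [Fact p.Prime] [CharP k p]
    (G : Subgroup (F ≃ₐ[k] F)) (P : HKG.Place k F) (hX : HKG.IsHKGCover p G P)
    (T : HKG.Tower p G P)
    (hgenus : ∀ i, 3 ≤ HKG.genus k (T.upper i))
    (hhyp : ∀ i, ¬ HKG.IsHyperelliptic k (T.upper i))
    (htrig : ∀ i, ¬ HKG.IsTrigonal k (T.upper i))
    (i : Fin T.r) :
    -- the pole divisor of `D_i` is `p ^ n_i * m_i * P`, of degree at most `4 g - 4`
    (HKG.HasOrd P (T.D i) (-((p ^ T.n i * T.m i : ℕ) : ℤ)) ∧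
      (∀ Q : HKG.Place k F, Q ≠ P → T.D i ∈ Q.ring) ∧
      ((p ^ T.n i * T.m i : ℕ) : ℤ) ≤ 4 * (HKG.genus k F : ℤ) - 4) ∧
    -- `D_i df_0 ⊗ df_0` is a holomorphic `2`-differential
    T.D i • (KaehlerDifferential.D k F (T.f 0) ⊗ₜ[F] KaehlerDifferential.D k F (T.f 0)) ∈
      HKG.holomorphic₂ k F ∧
    -- the expression of `D_i` in `f_0, …, f_{i - 1}` exists and is unique
    (∃! c : MvPolynomial (Fin (T.r + 1)) k, T.IsExpression i c) ∧
    -- the `ω_L` with `L ∈ A` are holomorphic differentials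
    (∀ L ∈ T.A, T.ω L ∈ HKG.holomorphic k F) ∧
    -- the monomials of `D_i` lie in `A + A`, which expresses `D_i df_0 ⊗ df_0` through the `ω`
    (¬ HKG.IsPlaneQuintic k F → ∀ c : MvPolynomial (Fin (T.r + 1)) k, T.IsExpression i c →
      (∀ e ∈ c.support, T.weight e ≤ p ^ T.n i * T.m i ∧ e ∈ T.A + T.A) ∧
      ∀ L K : (Fin (T.r + 1) →₀ ℕ) → (Fin (T.r + 1) →₀ ℕ),
        (∀ e ∈ c.support, L e ∈ T.A ∧ K e ∈ T.A ∧ L e + K e = e) →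
        T.D i • (KaehlerDifferential.D k F (T.f 0) ⊗ₜ[F] KaehlerDifferential.D k F (T.f 0)) =
          ∑ e ∈ c.support, c.coeff e • (T.ω (L e) ⊗ₜ[F] T.ω (K e))) := by
  have h0 : 0 < T.r := Nat.lt_of_le_of_lt (Nat.zero_le _) i.2
  -- The uniformizer at P is supplied by the pole order of f_i; discreteness of the valuation is not
  -- built into `Place`.
  obtain ⟨s, hs, -⟩ := T.f_pole i
  have h4 := T.four_le_q_and_jump hX hs h0 (hgenus _) (hhyp _) (htrig _)
  have hpole := T.pole_le hX hs h0 h4 i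
  have hU := HKG.Tower.isUnif hX hs
  have hR := T.D_mem_regularOutside hX i
  refine ⟨⟨?_, HKG.mem_regularOutside.1 hR, ?_⟩, ?_, T.existsUnique_expression hX hs i,
    fun L hL => T.ω_mem_holomorphic hX hs h0 hL, fun hquint c hc => ⟨fun e he => ?_, ?_⟩⟩
  · rw [hU.hasOrd_iff ⟨s, hs⟩]
    exact T.valuation_D hX hs i
  · have := T.two_mul_genus hX hs h0
    linarith
  · refine T.smul_mem_holomorphic₂ hX hs h0 hR ?_
    rw [T.valuation_D hX hs, hU.zpow_le_zpow]
    linarith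
  · have hw := T.weight_le_of_isExpression hX hs hc he
    exact ⟨hw, T.mem_A_add_A hX hs h4 hquint (hc.1 e he).1 hw⟩
  · intro L K hLK
    rw [← hc.2, T.aeval_eq_sum, Finset.sum_smul]
    refine Finset.sum_congr rfl fun e he => ?_
    rw [T.ω_tmul_ω, (hLK e he).2.2, smul_assoc]
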